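/- Let $\mathbb T=\mathbb R/2\pi\mathbb Z$, $\langle x\rangle=(1+x^2)^{1/2}$, and write $k^{2\alpha}$ for $|k|^{2\alpha}$. For a function $u$ on $\mathbb R_t\times\mathbb T_x$ let $u_k(t)=\frac1{2\pi}\int_0^{2\pi}u(t,x)e^{-ikx}\,dx$ be its spatial Fourier coefficients, let $\widehat u(k,\tau)$ be the Fourier transform of $u_k$ in time (in the sense of tempered distributions), and put $$\|u\|_{X^{s,b}}=\big\|\langle\tau-|k|^{2\alpha}\rangle^{b}\langle k\rangle^{s}\,\widehat u(k,\tau)\big\|_{L^2_\tau\ell^2_k}.$$ For $s,b\ge 0$, $X^{s,b}$ is the space of $u\in L^2(\mathbb R\times\mathbb T)$ with finite norm. Fix a constant $c>0$ and define $NR_1(u)$, $NR_2(u)$ at each time $t$ through their spatial Fourier coefficients $$\widehat{NR_1(u)}(k)=2\sum_{\substack{k-k_1+k_2-k_3+k_4-k_5=0\\ |k_1-k||k_2-k_1|\ge c\langle k\rangle^{2-2\alpha}}}\frac{u_{k_1}\overline{u_{k_2}}u_{k_3}\overline{u_{k_4}}u_{k_5}}{k^{2\alpha}-k_1^{2\alpha}+k_2^{2\alpha}-(k-k_1+k_2)^{2\alpha}},$$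 $$\widehat{NR_2(u)}(k)=-\sum_{\substack{k-k_1+k_2-k_3+k_4-k_5=0\\ |k_1-k||k-k_3|\ge c\langle k\rangle^{2-2\alpha}}}\frac{u_{k_1}\overline{u_{k_2}}u_{k_3}\overline{u_{k_4}}u_{k_5}}{k^{2\alpha}-k_1^{2\alpha}+(k-k_1-k_3)^{2\alpha}-k_3^{2\alpha}}.$$ **Proposition.** Let $\frac12<\alpha\le1$, $\frac34-\frac\alpha2<s\le\frac12$, and $a\le\min(2\alpha-1,\,2s+\alpha-1)$, where the inequality is strict if the minimum equals $2s+\alpha-1$. Then there is $b_0<\frac12$ such that for every $b\in(b_0,\frac12)$ there is a constant $C$, depending only on $\alpha,c,s,a,b$, such that for every $u\in X^{s,b}$ the series defining $\widehat{NR_1(u)}(k)$ and $\widehat{NR_2(u)}(k)$ converge absolutely for almost every $t$ and all $k\in\mathbb Z$, and $$\|NR_j(u)\|_{X^{s+a,-b}}\le C\,\|u\|_{X^{s,b}}^5,\qquad j=1,2.$$ -/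

import Mathlib

open MeasureTheory
open scoped ENNReal NNReal

noncomputable section

namespace FracNLS

/-- The torus `𝕋 = ℝ / 2πℤ`. -/
abbrev Torus : Type := AddCircle (2 * Real.pi)

instance factTwoPiPos : Fact (0 < 2 * Real.pi) := ⟨Real.two_pi_pos⟩

/-- The Japanese bracket `⟨x⟩ = (1 + x²)^{1/2}`. -/
def jb (x : ℝ) : ℝ := Real.sqrt (1 + x ^ 2)

/-- The dispersion relation `|k|^{2α}`, written `k^{2α}` for short. -/
def disp (α : ℝ) (k : ℤ) : ℝ := |(k : ℝ)| ^ (2 * α)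

/-- The time-dependent spatial Fourier coefficients
`u_k(t) = (2π)⁻¹ ∫₀^{2π} u(t,x) e^{-ikx} dx` of a space-time function `u`
(`fourierCoeff` integrates against the normalized Haar measure of the torus). -/
def modes (u : ℝ → Torus → ℂ) (k : ℤ) (t : ℝ) : ℂ := fourierCoeff (u t) k

/-- `F` is the Fourier transform `F(τ) = ∫ f(t) e^{-iτt} dt` of `f` in the sense of tempered
distributions: both functions act on Schwartz functions by integration, and
`∫ F φ = ∫ f(t) (∫ φ(τ) e^{-iτt} dτ) dt` for every Schwartz function `φ`. -/
def IsTimeFourier (f F : ℝ → ℂ) : Prop :=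
  (∀ φ : SchwartzMap ℝ ℂ, Integrable (fun t => f t * φ t)) ∧
  (∀ φ : SchwartzMap ℝ ℂ, Integrable (fun τ => F τ * φ τ)) ∧
  ∀ φ : SchwartzMap ℝ ℂ,
    ∫ τ, F τ * φ τ =
      ∫ t, f t * ∫ τ : ℝ, φ τ * Complex.exp (-(Complex.I * (τ : ℂ) * (t : ℂ)))

/-- The quantity `‖⟨τ - |k|^{2α}⟩^b ⟨k⟩^s F(k,τ)‖_{L²_τ ℓ²_k}`. -/
def weightedL2 (α s b : ℝ) (F : ℤ → ℝ → ℂ) : ℝ≥0∞ :=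
  (∑' k : ℤ, ∫⁻ τ : ℝ,
    (ENNReal.ofReal (jb (τ - disp α k) ^ b * jb (k : ℝ) ^ s) * ‖F k τ‖ₑ) ^ 2) ^ (1 / 2 : ℝ)

/-- The `X^{s,b}` norm of the space-time distribution whose time-dependent spatial Fourier
coefficients are `c k t`. The space-time Fourier transform `F` is unique up to null sets, so
the infimum runs over a single value; it is `∞` if there is no such function `F`. -/
def xNorm (α s b : ℝ) (c : ℤ → ℝ → ℂ) : ℝ≥0∞ :=
  ⨅ (F : ℤ → ℝ → ℂ) (_ : ∀ k, IsTimeFourier (c k) (F k)), weightedL2 α s b F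

/-- Membership in `X^{s,b}` for `s, b ≥ 0`, where this is a subspace of `L²(ℝ × 𝕋)`. -/
def MemX (α s b : ℝ) (u : ℝ → Torus → ℂ) : Prop :=
  MemLp (Function.uncurry u) 2 ((volume : Measure ℝ).prod AddCircle.haarAddCircle) ∧
  xNorm α s b (modes u) < ∞

/-- Frequencies `(k₁,…,k₅)`, with `κ i` in the role of `k_{i+1}`, such that
`k - k₁ + k₂ - k₃ + k₄ - k₅ = 0` and `|k₁ - k| |k₂ - k₁| ≥ c ⟨k⟩^{2-2α}`. -/
def freq1 (α c : ℝ) (k : ℤ) : Set (Fin 5 → ℤ) :=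
  {κ | k - κ 0 + κ 1 - κ 2 + κ 3 - κ 4 = 0 ∧
    c * jb (k : ℝ) ^ (2 - 2 * α) ≤ |((κ 0 - k : ℤ) : ℝ)| * |((κ 1 - κ 0 : ℤ) : ℝ)|}

/-- Frequencies `(k₁,…,k₅)`, with `κ i` in the role of `k_{i+1}`, such that
`k - k₁ + k₂ - k₃ + k₄ - k₅ = 0` and `|k₁ - k| |k - k₃| ≥ c ⟨k⟩^{2-2α}`. -/
def freq2 (α c : ℝ) (k : ℤ) : Set (Fin 5 → ℤ) :=
  {κ | k - κ 0 + κ 1 - κ 2 + κ 3 - κ 4 = 0 ∧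
    c * jb (k : ℝ) ^ (2 - 2 * α) ≤ |((κ 0 - k : ℤ) : ℝ)| * |((k - κ 2 : ℤ) : ℝ)|}

/-- The product `a_{k₁} conj(a_{k₂}) a_{k₃} conj(a_{k₄}) a_{k₅}`. -/
def quintic (a : ℤ → ℂ) (κ : Fin 5 → ℤ) : ℂ :=
  a (κ 0) * star (a (κ 1)) * a (κ 2) * star (a (κ 3)) * a (κ 4)

/-- The summand of `NR₁` at output frequency `k`. -/
def nr1Term (α : ℝ) (a : ℤ → ℂ) (k : ℤ) (κ : Fin 5 → ℤ) : ℂ :=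
  quintic a κ /
    ((disp α k - disp α (κ 0) + disp α (κ 1) - disp α (k - κ 0 + κ 1) : ℝ) : ℂ)

/-- The summand of `NR₂` at output frequency `k`. -/
def nr2Term (α : ℝ) (a : ℤ → ℂ) (k : ℤ) (κ : Fin 5 → ℤ) : ℂ :=
  quintic a κ /
    ((disp α k - disp α (κ 0) + disp α (k - κ 0 - κ 2) - disp α (κ 2) : ℝ) : ℂ)

/-- The `k`-th Fourier coefficient of `NR₁(u)` at time `t`. -/
def NR1 (α c : ℝ) (u : ℝ → Torus → ℂ) (k : ℤ) (t : ℝ) : ℂ :=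
  2 * ∑' κ : freq1 α c k, nr1Term α (fun n => modes u n t) k κ

/-- The `k`-th Fourier coefficient of `NR₂(u)` at time `t`. -/
def NR2 (α c : ℝ) (u : ℝ → Torus → ℂ) (k : ℤ) (t : ℝ) : ℂ :=
  -∑' κ : freq2 α c k, nr2Term α (fun n => modes u n t) k κ

end FracNLS

end

/-!
Let `γ = 1 - 9(1 - 2b)`, which is close to `1`. A convolution of five functions `Fᵢ` with
`⟨τ - ωᵢ⟩^b Fᵢ ∈ L²`, alternately reflected in `τ`, again satisfies a weighted `L²` bound, now
around the frequency `ω₁ - ω₂ + ω₃ - ω₄ + ω₅` and with a loss that turns `2b` into `γ`. After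
Cauchy–Schwarz in the spatial frequencies the estimate therefore follows from the boundedness in
`k` of `∑ ⟨k⟩^{2(s+a)} D⁻² ∏ ⟨kᵢ⟩^{-2s} ⟨φ⟩^{-γ}`, where `D` is the denominator of `NR₁` or `NR₂`
and `φ = |k|^{2α} - |k₁|^{2α} + |k₂|^{2α} - |k₃|^{2α} + |k₄|^{2α} - |k₅|^{2α}`. Momentum
conservation recovers `k` from the `kᵢ`, so nothing is lost in the sum over `k`.

Both denominators are mixed second differences
`|k|^{2α} - |k+n|^{2α} - |k+m|^{2α} + |k+n+m|^{2α}`, with `(n, m) = (k₁ - k, k₂ - k₁)` for `NR₁` and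
`(n, m) = (k₁ - k, k₃ - k)` for `NR₂`, and are at least a multiple of
`(|k| + |n| + |m|)^{2α-2} |n| |m|` in modulus. For fixed `(n, m)` two frequencies remain free.
Differences of values of `φ` in one of them are second differences too, so these values are
separated and the factor `⟨φ⟩^{-γ}` is nearly summable; this is where `s > 3/4 - α/2` enters. The
outer sum over `(n, m)` uses the lower bound for `D` and the threshold `|n| |m| ≥ c ⟨k⟩^{2-2α}`, and
yields the conditions on `a`.

The products are formed pointwise in time. Each mode lies in `L⁶` by Plancherel applied to its cube,
which gives the absolute convergence of the series, and the Fourier transform of a product is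
bounded by a convolution after approximating each factor by functions with integrable transform.
-/

noncomputable section

namespace FracNLS

/-! ### The Japanese bracket -/

lemma one_le_jb (x : ℝ) : 1 ≤ jb x :=
  Real.one_le_sqrt.2 (le_add_of_nonneg_right (sq_nonneg x))

lemma jb_pos (x : ℝ) : 0 < jb x := zero_lt_one.trans_le (one_le_jb x)

lemma jb_sq (x : ℝ) : jb x ^ 2 = 1 + x ^ 2 := Real.sq_sqrt (by positivity)

lemma abs_le_jb (x : ℝ) : |x| ≤ jb x :=
  Real.abs_le_sqrt (le_add_of_nonneg_left zero_le_one)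

lemma jb_le_one_add_abs (x : ℝ) : jb x ≤ 1 + |x| := by
  refine Real.sqrt_le_iff.2 ⟨by positivity, ?_⟩
  nlinarith [abs_nonneg x, sq_abs x]

lemma jb_neg (x : ℝ) : jb (-x) = jb x := by simp [jb]

lemma jb_add_le_add_abs (x y : ℝ) : jb (x + y) ≤ jb x + |y| := by
  have hcross : x * y ≤ jb x * |y| :=
    calc x * y ≤ |x| * |y| := (le_abs_self _).trans_eq (abs_mul x y)
      _ ≤ jb x * |y| := by gcongr; exact abs_le_jb x
  refine le_of_sq_le_sq ?_ (add_nonneg (jb_pos x).le (abs_nonneg y))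
  nlinarith [jb_sq (x + y), jb_sq x, sq_abs y]

lemma jb_add_le (x y : ℝ) : jb (x + y) ≤ jb x + jb y :=
  (jb_add_le_add_abs x y).trans (by linarith [abs_le_jb y])

lemma jb_rpow_pos (x r : ℝ) : 0 < jb x ^ r := Real.rpow_pos_of_pos (jb_pos x) r

lemma continuous_jb : Continuous jb := by unfold jb; fun_prop

@[fun_prop]
lemma measurable_jb : Measurable jb := continuous_jb.measurable

/-- The integral `∫ ⟨x⟩^{-r} dx` over the real line. -/
def jbInt (r : ℝ) : ℝ≥0∞ := ∫⁻ x : ℝ, ENNReal.ofReal (jb x ^ (-r))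

lemma jbInt_lt_top {r : ℝ} (hr : 1 < r) : jbInt r < ∞ := by
  have h := (integrable_rpow_neg_one_add_norm_sq (E := ℝ) (μ := volume) (r := r)
    (by simpa using hr)).lintegral_lt_top
  unfold jbInt
  convert h using 4 with x
  rw [jb, Real.sqrt_eq_rpow, ← Real.rpow_mul (by positivity), Real.norm_eq_abs, sq_abs]
  ring_nf

/-- The sum `∑ₖ ⟨k⟩^{-r}` over the integers. -/
def jbSum (r : ℝ) : ℝ≥0∞ := ∑' k : ℤ, ENNReal.ofReal (jb k ^ (-r))

lemma jbSum_lt_top {r : ℝ} (hr : 1 < r) : jbSum r < ∞ := by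
  have hsum : Summable (fun k : ℤ => jb k ^ (-r)) := by
    refine Summable.of_norm_bounded_eventually (Real.summable_abs_int_rpow hr) ?_
    filter_upwards [(Set.finite_singleton (0 : ℤ)).compl_mem_cofinite] with k hk
    have hk : k ≠ 0 := by simpa using hk
    rw [Real.norm_of_nonneg (jb_rpow_pos _ _).le]
    exact Real.rpow_le_rpow_of_nonpos (by positivity) (abs_le_jb _) (by linarith)
  exact hsum.tsum_ofReal_lt_top

lemma tsum_jb_add (r : ℝ) (m : ℤ) :
    ∑' k : ℤ, ENNReal.ofReal (jb ((m + k : ℤ) : ℝ) ^ (-r)) = jbSum r :=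
  (Equiv.addLeft m).tsum_eq (fun k : ℤ => ENNReal.ofReal (jb (k : ℝ) ^ (-r)))

/-! ### Inequalities between powers -/

lemma rpow_neg_le_of_le_mul {x y C r : ℝ} (hx : 0 < x) (hy : 0 < y) (hC : 0 < C) (hr : 0 ≤ r)
    (h : x ≤ C * y) : y ^ (-r) ≤ C ^ r * x ^ (-r) := by
  rw [Real.rpow_neg hx.le, Real.rpow_neg hy.le, ← div_eq_mul_inv, inv_eq_one_div,
    div_le_div_iff₀ (by positivity) (by positivity), one_mul, ← Real.mul_rpow hC.le hy.le]
  exact Real.rpow_le_rpow hx.le h hr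

lemma rpow_neg_mul_rpow_neg_le_left {x y p q : ℝ} (hx : 0 < x) (hxy : x ≤ y) (hq : 0 ≤ q) :
    x ^ (-p) * y ^ (-q) ≤ x ^ (-(p + q)) := by
  rw [neg_add, Real.rpow_add hx]
  gcongr ?_ * ?_
  exact Real.rpow_le_rpow_of_nonpos hx hxy (by linarith)

lemma rpow_neg_mul_rpow_neg_le {x y p q : ℝ} (hx : 0 < x) (hy : 0 < y) (hp : 0 ≤ p)
    (hq : 0 ≤ q) : x ^ (-p) * y ^ (-q) ≤ x ^ (-(p + q)) + y ^ (-(p + q)) := by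
  rcases le_total x y with hxy | hyx
  · exact (rpow_neg_mul_rpow_neg_le_left hx hxy hq).trans
      (le_add_of_nonneg_right (by positivity))
  · rw [mul_comm, add_comm p q]
    exact (rpow_neg_mul_rpow_neg_le_left hy hyx hp).trans
      (le_add_of_nonneg_left (by positivity))

lemma rpow_neg_one_sub_le_rpow_neg_two {P X ε : ℝ} (hP : 0 < P) (hX : 1 ≤ X) (hε : ε ≤ 1 / 2)
    (h : P ^ (4 : ℝ) ≤ X) : X ^ (-(1 - ε)) ≤ P ^ (-2 : ℝ) :=
  calc X ^ (-(1 - ε)) ≤ X ^ (-(1 / 2) : ℝ) :=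
        Real.rpow_le_rpow_of_exponent_le hX (by linarith)
    _ ≤ (P ^ (4 : ℝ)) ^ (-(1 / 2) : ℝ) :=
        Real.rpow_le_rpow_of_nonpos (by positivity) h (by norm_num)
    _ = P ^ (-2 : ℝ) := by rw [← Real.rpow_mul hP.le]; norm_num

/-- If `X^{2ε} ≤ P^η` the spare power of `P` pays for the missing power of `X`; otherwise `X` is
so much larger than `P` that `X` alone gives a summable power of `P`. -/
lemma rpow_neg_mul_rpow_neg_le_add {P X θ η ε : ℝ} (hP : 1 ≤ P) (hX : 1 ≤ X) (hθ : 0 ≤ θ)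
    (hε : 0 < ε) (hε' : ε ≤ 1 / 2) (hεη : 8 * ε ≤ η) :
    P ^ (-(θ + η)) * X ^ (-(1 - ε)) ≤ P ^ (-2 : ℝ) + P ^ (-θ) * X ^ (-(1 + ε)) := by
  have hP0 : 0 < P := by linarith
  have hX0 : 0 < X := by linarith
  rcases le_total (X ^ (2 * ε)) (P ^ η) with hXP | hPX
  · refine le_trans ?_ (le_add_of_nonneg_left (by positivity))
    calc P ^ (-(θ + η)) * X ^ (-(1 - ε))
        = P ^ (-θ) * P ^ (-η) * (X ^ (-(1 + ε)) * X ^ (2 * ε)) := by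
          rw [← Real.rpow_add hP0, ← Real.rpow_add hX0]; ring_nf
      _ ≤ P ^ (-θ) * P ^ (-η) * (X ^ (-(1 + ε)) * P ^ η) := by gcongr
      _ = P ^ (-θ) * X ^ (-(1 + ε)) * (P ^ (-η) * P ^ η) := by ring
      _ = P ^ (-θ) * X ^ (-(1 + ε)) := by rw [← Real.rpow_add hP0]; simp
  · have hP4 : P ^ (4 : ℝ) ≤ X := by
      refine (Real.rpow_le_rpow_iff (by positivity) hX0.le (by linarith : 0 < 2 * ε)).1 ?_
      rw [← Real.rpow_mul hP0.le]
      exact (Real.rpow_le_rpow_of_exponent_le hP (by linarith)).trans hPX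
    refine le_trans ?_ (le_add_of_nonneg_right (by positivity))
    calc P ^ (-(θ + η)) * X ^ (-(1 - ε)) ≤ 1 * P ^ (-2 : ℝ) := by
          gcongr
          · exact Real.rpow_le_one_of_one_le_of_nonpos hP (by linarith)
          · exact rpow_neg_one_sub_le_rpow_neg_two hP0 hX hε' hP4
      _ = P ^ (-2 : ℝ) := one_mul _

/-! ### Second differences of the dispersion relation -/

lemma add_le_add_of_convexOn {g : ℝ → ℝ} {S : Set ℝ} (hg : ConvexOn ℝ S g) {x n m : ℝ}
    (h0 : x ∈ S) (h1 : x + n + m ∈ S) (hnm : 0 ≤ n * m) :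
    g (x + n) + g (x + m) ≤ g x + g (x + n + m) := by
  rcases eq_or_ne (n + m) 0 with h | h
  · have hn : n = 0 := by nlinarith
    have hm : m = 0 := by linarith
    simp [hn, hm]
  have weight_nonneg : ∀ p q : ℝ, p + q ≠ 0 → 0 ≤ p * q → 0 ≤ p / (p + q) := by
    intro p q hpq hmul
    rw [← mul_div_mul_right _ _ hpq]
    exact div_nonneg (by nlinarith [sq_nonneg p]) (mul_self_nonneg _)
  have hn : 0 ≤ n / (n + m) := weight_nonneg n m h hnm
  have hm : 0 ≤ m / (n + m) := by
    simpa only [add_comm m n] using weight_nonneg m n (by rwa [add_comm]) (by linarith)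
  have hsum : m / (n + m) + n / (n + m) = 1 := by field_simp; ring
  have hgn := hg.2 h0 h1 hm hn hsum
  have hgm := hg.2 h0 h1 hn hm (by linarith)
  simp only [smul_eq_mul] at hgn hgm
  rw [show m / (n + m) * x + n / (n + m) * (x + n + m) = x + n by field_simp; ring] at hgn
  rw [show n / (n + m) * x + m / (n + m) * (x + n + m) = x + m by field_simp; ring] at hgm
  calc g (x + n) + g (x + m)
      ≤ (m / (n + m) + n / (n + m)) * (g x + g (x + n + m)) := by linarith
    _ = g x + g (x + n + m) := by rw [hsum, one_mul]

lemma convexOn_comp_abs {G : ℝ → ℝ} {R : ℝ} (hG : ConvexOn ℝ (Set.Icc 0 R) G)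
    (hmono : MonotoneOn G (Set.Icc 0 R)) :
    ConvexOn ℝ (Set.Icc (-R) R) (fun x => G |x|) := by
  have himage : (fun x : ℝ => |x|) '' Set.Icc (-R) R = Set.Icc 0 R := by
    refine Set.Subset.antisymm ?_ fun y hy =>
      ⟨y, ⟨by linarith [hy.1, hy.2], hy.2⟩, abs_of_nonneg hy.1⟩
    rintro _ ⟨x, hx, rfl⟩
    exact ⟨abs_nonneg _, abs_le.2 hx⟩
  have habs : ConvexOn ℝ (Set.Icc (-R) R) (fun x : ℝ => |x|) :=
    (convexOn_univ_norm (E := ℝ)).subset (Set.subset_univ _) (convex_Icc _ _)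
  exact ConvexOn.comp (by rwa [himage]) habs (by rwa [himage])

section Power

variable {p c R : ℝ}

lemma hasDerivAt_rpow_sub_sq {y : ℝ} (hy : y ≠ 0) :
    HasDerivAt (fun y => y ^ p - c * y ^ 2) (p * y ^ (p - 1) - 2 * c * y) y := by
  refine ((Real.hasDerivAt_rpow_const (Or.inl hy)).sub
    ((hasDerivAt_pow 2 y).const_mul c)).congr_deriv ?_
  push_cast
  ring

lemma monotoneOn_deriv_rpow_sub_sq (hp : 1 < p) (hp' : p ≤ 2)
    (hc : 2 * c ≤ p * (p - 1) * R ^ (p - 2)) :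
    MonotoneOn (fun y => p * y ^ (p - 1) - 2 * c * y) (Set.Icc 0 R) := by
  have hderiv : ∀ y ∈ interior (Set.Icc 0 R),
      HasDerivAt (fun y => p * y ^ (p - 1) - 2 * c * y)
        (p * ((p - 1) * y ^ (p - 2)) - 2 * c) y := by
    intro y hy
    rw [interior_Icc] at hy
    refine (((Real.hasDerivAt_rpow_const (Or.inl hy.1.ne')).const_mul p).sub
      ((hasDerivAt_id y).const_mul (2 * c))).congr_deriv ?_
    rw [mul_one, show p - 1 - 1 = p - 2 by ring]
  refine monotoneOn_of_deriv_nonneg (convex_Icc 0 R) ?_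
    (fun y hy => (hderiv y hy).differentiableAt.differentiableWithinAt) fun y hy => ?_
  · have := Real.continuous_rpow_const (q := p - 1) (by linarith)
    fun_prop
  · rw [(hderiv y hy).deriv]
    rw [interior_Icc] at hy
    have hpow : R ^ (p - 2) ≤ y ^ (p - 2) :=
      Real.rpow_le_rpow_of_nonpos hy.1 hy.2.le (by linarith)
    have hp0 : 0 ≤ p * (p - 1) := by nlinarith
    nlinarith

lemma continuous_rpow_sub_sq (hp : 0 ≤ p) : Continuous fun y : ℝ => y ^ p - c * y ^ 2 :=
  (Real.continuous_rpow_const hp).sub (by fun_prop)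

lemma convexOn_rpow_sub_sq (hp : 1 < p) (hp' : p ≤ 2)
    (hc : 2 * c ≤ p * (p - 1) * R ^ (p - 2)) :
    ConvexOn ℝ (Set.Icc 0 R) (fun y => y ^ p - c * y ^ 2) := by
  have hderiv : ∀ y ∈ interior (Set.Icc 0 R),
      HasDerivAt (fun y => y ^ p - c * y ^ 2) (p * y ^ (p - 1) - 2 * c * y) y := fun y hy =>
    hasDerivAt_rpow_sub_sq (by rw [interior_Icc] at hy; exact hy.1.ne')
  refine MonotoneOn.convexOn_of_deriv (convex_Icc 0 R)
    (continuous_rpow_sub_sq (by linarith)).continuousOn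
    (fun y hy => (hderiv y hy).differentiableAt.differentiableWithinAt) fun x hx y hy hxy => ?_
  rw [(hderiv x hx).deriv, (hderiv y hy).deriv]
  exact monotoneOn_deriv_rpow_sub_sq hp hp' hc (interior_subset hx) (interior_subset hy) hxy

lemma monotoneOn_rpow_sub_sq (hp : 1 < p) (hp' : p ≤ 2)
    (hc : 2 * c ≤ p * (p - 1) * R ^ (p - 2)) :
    MonotoneOn (fun y => y ^ p - c * y ^ 2) (Set.Icc 0 R) := by
  have hderiv : ∀ y ∈ interior (Set.Icc 0 R),
      HasDerivAt (fun y => y ^ p - c * y ^ 2) (p * y ^ (p - 1) - 2 * c * y) y := fun y hy =>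
    hasDerivAt_rpow_sub_sq (by rw [interior_Icc] at hy; exact hy.1.ne')
  refine monotoneOn_of_deriv_nonneg (convex_Icc 0 R)
    (continuous_rpow_sub_sq (by linarith)).continuousOn
    (fun y hy => (hderiv y hy).differentiableAt.differentiableWithinAt) fun y hy => ?_
  rw [(hderiv y hy).deriv]
  have hy' := interior_subset hy
  simpa [Real.zero_rpow (by linarith : p - 1 ≠ 0)] using
    monotoneOn_deriv_rpow_sub_sq hp hp' hc (Set.left_mem_Icc.2 (hy'.1.trans hy'.2)) hy' hy'.1

lemma le_abs_second_difference {x n m : ℝ} (hp : 1 < p) (hp' : p ≤ 2)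
    (h0 : |x| ≤ R) (h1 : |x + n| ≤ R) (h2 : |x + m| ≤ R) (h3 : |x + n + m| ≤ R) :
    p * (p - 1) * R ^ (p - 2) * (|n| * |m|) ≤
      |(|x| ^ p - |x + n| ^ p - |x + m| ^ p + |x + n + m| ^ p)| := by
  -- Subtracting the largest quadratic that keeps `|x|^p` convex isolates the second difference
  -- `2 c n m` of `c x²`.
  set c := p * (p - 1) * R ^ (p - 2) / 2 with hc
  have hc2 : 2 * c ≤ p * (p - 1) * R ^ (p - 2) := by linarith
  have hconv := convexOn_comp_abs (convexOn_rpow_sub_sq hp hp' hc2)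
    (monotoneOn_rpow_sub_sq hp hp' hc2)
  rw [show p * (p - 1) * R ^ (p - 2) = 2 * c by rw [hc]; ring, ← abs_mul]
  rcases le_total 0 (n * m) with h | h
  · have := add_le_add_of_convexOn hconv (abs_le.1 h0) (abs_le.1 h3) h
    simp only [sq_abs] at this
    rw [abs_of_nonneg h]
    exact le_trans (by nlinarith) (le_abs_self _)
  · have := add_le_add_of_convexOn hconv (x := x + n) (n := -n) (m := m) (abs_le.1 h1)
      (by simpa using abs_le.1 h2) (by linarith)
    simp only [add_neg_cancel_right, sq_abs] at this
    rw [abs_of_nonpos h]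
    exact le_trans (by nlinarith) (neg_le_abs _)

end Power

/-- The second difference `|k|^{2α} - |k+n|^{2α} - |k+m|^{2α} + |k+n+m|^{2α}`: the denominators
of `NR₁` and `NR₂` and the gaps between the phases below are all of this form. -/
def resonance (α : ℝ) (k n m : ℤ) : ℝ :=
  disp α k - disp α (k + n) - disp α (k + m) + disp α (k + n + m)

lemma le_abs_resonance {α R : ℝ} {k n m : ℤ} (hα : 1 / 2 < α) (hα' : α ≤ 1)
    (h : |(k : ℝ)| + |(n : ℝ)| + |(m : ℝ)| ≤ R) :
    2 * α * (2 * α - 1) * R ^ (2 * α - 2) * (|(n : ℝ)| * |(m : ℝ)|) ≤ |resonance α k n m| := by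
  have hkn := abs_add_le (k : ℝ) n
  have hkm := abs_add_le (k : ℝ) m
  have hknm := abs_add_le ((k : ℝ) + n) m
  have hn := abs_nonneg (n : ℝ)
  have hm := abs_nonneg (m : ℝ)
  have := le_abs_second_difference (p := 2 * α) (x := k) (n := n) (m := m) (R := R)
    (by linarith) (by linarith) (by linarith) (by linarith) (by linarith) (by linarith)
  simpa [resonance, disp] using this

lemma one_le_abs_intCast {n : ℤ} (hn : n ≠ 0) : (1 : ℝ) ≤ |(n : ℝ)| :=
  mod_cast Int.one_le_abs hn

/-- The lower bound degenerates in `k` but not in `n, m`: with `R ≲ ⟨k⟩ |n m|` the factor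
`|n m|^{2α-1} ≥ 1` may be dropped. -/
lemma jb_rpow_le_abs_resonance {α : ℝ} {k n m : ℤ} (hα : 1 / 2 < α) (hα' : α ≤ 1)
    (hn : n ≠ 0) (hm : m ≠ 0) :
    (2 * α - 1) / 3 * jb k ^ (-(2 - 2 * α)) ≤ |resonance α k n m| := by
  have hN := one_le_abs_intCast hn
  have hM := one_le_abs_intCast hm
  have hk := abs_le_jb (k : ℝ)
  have hK := one_le_jb (k : ℝ)
  set N := |(n : ℝ)|
  set M := |(m : ℝ)|
  set K := jb (k : ℝ)
  have hNM : 1 ≤ N * M := one_le_mul_of_one_le_of_one_le hN hM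
  have hsize : |(k : ℝ)| + N + M ≤ 3 * K * (N * M) := by
    have h1 : N ≤ K * (N * M) := by
      calc N = 1 * (N * 1) := by ring
        _ ≤ K * (N * M) := by gcongr
    have h2 : M ≤ K * (N * M) := by
      calc M = 1 * (1 * M) := by ring
        _ ≤ K * (N * M) := by gcongr
    linarith [le_mul_of_one_le_right (by linarith : 0 ≤ K) hNM]
  have hpow : (3 * K * (N * M)) ^ (2 * α - 2) * (N * M) =
      3 ^ (2 * α - 2) * K ^ (2 * α - 2) * (N * M) ^ (2 * α - 1) := by
    rw [Real.mul_rpow (by positivity) (by positivity),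
      Real.mul_rpow (by positivity) (by positivity),
      mul_assoc (3 ^ (2 * α - 2) * K ^ (2 * α - 2)), ← Real.rpow_add_one (by positivity)]
    ring_nf
  have hthird : (1 / 3 : ℝ) ≤ 3 ^ (2 * α - 2) := by
    calc (1 / 3 : ℝ) = 3 ^ (-1 : ℝ) := by rw [Real.rpow_neg_one]; norm_num
      _ ≤ _ := Real.rpow_le_rpow_of_exponent_le (by norm_num) (by linarith)
  have hNMpow : (1 : ℝ) ≤ (N * M) ^ (2 * α - 1) := Real.one_le_rpow hNM (by linarith)
  have h2α : 0 ≤ 2 * α - 1 := by linarith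
  calc (2 * α - 1) / 3 * K ^ (-(2 - 2 * α))
      = 1 * (2 * α - 1) * (1 / 3 * K ^ (2 * α - 2) * 1) := by rw [neg_sub]; ring
    _ ≤ 2 * α * (2 * α - 1) * (3 ^ (2 * α - 2) * K ^ (2 * α - 2) * (N * M) ^ (2 * α - 1)) := by
        gcongr
        linarith
    _ = 2 * α * (2 * α - 1) * (3 * K * (N * M)) ^ (2 * α - 2) * (N * M) := by
        rw [mul_assoc (2 * α * (2 * α - 1)), hpow]
    _ ≤ |resonance α k n m| := le_abs_resonance hα hα' hsize

/-! ### Sums over separated points -/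

lemma jb_rpow_neg_le_four_mul {x y r : ℝ} (h : |y - x| ≤ 1) (hr : 0 ≤ r) (hr' : r ≤ 2) :
    jb x ^ (-r) ≤ 4 * jb y ^ (-r) := by
  have hle : jb y ≤ 2 * jb x := by
    have := jb_add_le_add_abs x (y - x)
    rw [add_sub_cancel] at this
    linarith [one_le_jb x]
  have hfour : (2 : ℝ) ^ r ≤ 4 :=
    (Real.rpow_le_rpow_of_exponent_le one_le_two hr').trans_eq (by norm_num)
  exact (rpow_neg_le_of_le_mul (jb_pos y) (jb_pos x) two_pos hr hle).trans
    (mul_le_mul_of_nonneg_right hfour (jb_rpow_pos _ _).le)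

/-- Each summand is at most an integral over a ball of length `δ p` around `φ p`, and these balls
are disjoint. -/
lemma tsum_separated_le {ι : Type*} [Countable ι] {φ δ : ι → ℝ} {r : ℝ} (hr : 0 ≤ r)
    (hr' : r ≤ 2) (hδ : ∀ p, δ p ≤ 1) (h : Pairwise fun p p' => δ p ≤ |φ p - φ p'|) :
    ∑' p, ENNReal.ofReal (δ p * jb (φ p) ^ (-r)) ≤ 4 * jbInt r := by
  have hdisj : Pairwise (Function.onFun Disjoint fun p => Metric.ball (φ p) (δ p / 2)) := by
    intro p p' hne
    refine Metric.ball_disjoint_ball ?_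
    have hpp' : δ p ≤ |φ p - φ p'| := h hne
    have hp'p : δ p' ≤ |φ p' - φ p| := h hne.symm
    rw [abs_sub_comm] at hp'p
    rw [Real.dist_eq]
    linarith
  have hpt : ∀ p, ENNReal.ofReal (δ p * jb (φ p) ^ (-r)) ≤
      ∫⁻ x in Metric.ball (φ p) (δ p / 2), 4 * ENNReal.ofReal (jb x ^ (-r)) := by
    intro p
    have hvol : volume (Metric.ball (φ p) (δ p / 2)) = ENNReal.ofReal (δ p) := by
      rw [Real.volume_ball]; ring_nf
    calc ENNReal.ofReal (δ p * jb (φ p) ^ (-r))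
        = ∫⁻ _ in Metric.ball (φ p) (δ p / 2), ENNReal.ofReal (jb (φ p) ^ (-r)) := by
          rw [setLIntegral_const, hvol, mul_comm, ENNReal.ofReal_mul (jb_rpow_pos _ _).le]
      _ ≤ _ := by
          refine setLIntegral_mono (by fun_prop) fun x hx => ?_
          rw [Metric.mem_ball, Real.dist_eq] at hx
          refine (ENNReal.ofReal_le_ofReal
            (jb_rpow_neg_le_four_mul (by linarith [hδ p]) hr hr')).trans_eq ?_
          rw [ENNReal.ofReal_mul (by norm_num), ENNReal.ofReal_ofNat]
  calc _ ≤ ∑' p, ∫⁻ x in Metric.ball (φ p) (δ p / 2), 4 * ENNReal.ofReal (jb x ^ (-r)) :=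
        ENNReal.tsum_le_tsum hpt
    _ = ∫⁻ x in ⋃ p, Metric.ball (φ p) (δ p / 2), 4 * ENNReal.ofReal (jb x ^ (-r)) :=
        (lintegral_iUnion (fun p => Metric.isOpen_ball.measurableSet) hdisj _).symm
    _ ≤ ∫⁻ x, 4 * ENNReal.ofReal (jb x ^ (-r)) := setLIntegral_le_lintegral _ _
    _ = 4 * jbInt r := lintegral_const_mul _ (by fun_prop)

/-- The constant in `tsum_phase_le`. -/
def phaseConst (α ε : ℝ) : ℝ≥0∞ :=
  jbSum 2 + ENNReal.ofReal ((2 * α - 1) / 3)⁻¹ * (4 * jbInt (1 + ε))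

lemma phaseConst_lt_top {α ε : ℝ} (hε : 0 < ε) : phaseConst α ε < ∞ :=
  ENNReal.add_lt_top.2 ⟨jbSum_lt_top one_lt_two, ENNReal.mul_lt_top ENNReal.ofReal_lt_top
    (ENNReal.mul_lt_top (by norm_num) (jbInt_lt_top (by linarith)))⟩

lemma tsum_phase_le {α ε η : ℝ} {J : Set ℤ} {φ : ℤ → ℝ} (hα : 1 / 2 < α) (hα' : α ≤ 1)
    (hε : 0 < ε) (hε' : ε ≤ 1 / 2) (hεη : 8 * ε ≤ η)
    (h : J.Pairwise fun p p' => (2 * α - 1) / 3 * jb p ^ (-(2 - 2 * α)) ≤ |φ p - φ p'|) :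
    ∑' p : J, ENNReal.ofReal (jb (p : ℤ) ^ (-(2 - 2 * α + η)) * jb (φ p) ^ (-(1 - ε))) ≤
      phaseConst α ε := by
  set c := (2 * α - 1) / 3
  have hc : 0 < c := by simp only [c]; linarith
  set δ : J → ℝ := fun p => c * jb (p : ℤ) ^ (-(2 - 2 * α))
  have hδ : ∀ p, δ p ≤ 1 := fun p => mul_le_one₀ (by simp only [c]; linarith)
    (jb_rpow_pos _ _).le (Real.rpow_le_one_of_one_le_of_nonpos (one_le_jb _) (by linarith))
  have hsep := tsum_separated_le (φ := fun p : J => φ p) (r := 1 + ε) (by linarith)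
    (by linarith) hδ ((pairwise_subtype_iff_pairwise_set J _).2 h)
  have hpt : ∀ p : J,
      ENNReal.ofReal (jb (p : ℤ) ^ (-(2 - 2 * α + η)) * jb (φ p) ^ (-(1 - ε))) ≤
      ENNReal.ofReal (jb (p : ℤ) ^ (-2 : ℝ)) +
        ENNReal.ofReal c⁻¹ * ENNReal.ofReal (δ p * jb (φ p) ^ (-(1 + ε))) := by
    intro p
    have hpow := jb_rpow_pos (p : ℤ) (-(2 - 2 * α))
    have hphase := jb_rpow_pos (φ p) (-(1 + ε))
    rw [← ENNReal.ofReal_mul (by positivity), ← ENNReal.ofReal_add (jb_rpow_pos _ _).le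
      (by positivity)]
    refine ENNReal.ofReal_le_ofReal ((rpow_neg_mul_rpow_neg_le_add (one_le_jb _) (one_le_jb _)
      (by linarith : 0 ≤ 2 - 2 * α) hε hε' hεη).trans_eq ?_)
    simp only [δ]
    field_simp
  calc _ ≤ ∑' p : J, (ENNReal.ofReal (jb (p : ℤ) ^ (-2 : ℝ)) +
        ENNReal.ofReal c⁻¹ * ENNReal.ofReal (δ p * jb (φ p) ^ (-(1 + ε)))) :=
        ENNReal.tsum_le_tsum hpt
    _ = ∑' p : J, ENNReal.ofReal (jb (p : ℤ) ^ (-2 : ℝ)) +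
        ENNReal.ofReal c⁻¹ * ∑' p, ENNReal.ofReal (δ p * jb (φ p) ^ (-(1 + ε))) := by
        rw [ENNReal.tsum_add, ENNReal.tsum_mul_left]
    _ ≤ phaseConst α ε := by
        unfold phaseConst
        gcongr
        exact ENNReal.tsum_comp_le_tsum_of_injective Subtype.val_injective
          (fun p : ℤ => ENNReal.ofReal (jb (p : ℝ) ^ (-2 : ℝ)))

lemma tsum_difference_phase_le {α ε η : ℝ} (ν : ℝ) {d : ℤ} (hd : d ≠ 0) (hα : 1 / 2 < α)
    (hα' : α ≤ 1) (hε : 0 < ε) (hε' : ε ≤ 1 / 2) (hεη : 8 * ε ≤ η) {σ : ℝ} (hσ : |σ| = 1) :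
    ∑' p : ℤ, ENNReal.ofReal (jb p ^ (-(2 - 2 * α + η)) *
      jb (ν + σ * (disp α p - disp α (p + d))) ^ (-(1 - ε))) ≤ phaseConst α ε := by
  rw [← tsum_univ]
  refine tsum_phase_le (φ := fun p => ν + σ * (disp α p - disp α (p + d))) hα hα' hε hε' hεη ?_
  intro p _ p' _ hne
  have hgap : ν + σ * (disp α p - disp α (p + d)) - (ν + σ * (disp α p' - disp α (p' + d))) =
      σ * resonance α p (p' - p) d := by
    simp only [resonance, add_sub_cancel]
    ring
  rw [hgap, abs_mul, hσ, one_mul]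
  exact jb_rpow_le_abs_resonance hα hα' (sub_ne_zero.2 hne.symm) hd

/-- The phase is invariant under `p ↦ e - p`, so it is separated only on each half line. -/
lemma tsum_sum_phase_le {α ε η : ℝ} (ν : ℝ) (e : ℤ) (hα : 1 / 2 < α)
    (hα' : α ≤ 1) (hε : 0 < ε) (hε' : ε ≤ 1 / 2) (hεη : 8 * ε ≤ η) :
    ∑' p : ℤ, ENNReal.ofReal (jb p ^ (-(2 - 2 * α + η)) *
      jb (ν + disp α p + disp α (e - p)) ^ (-(1 - ε))) ≤ 2 * phaseConst α ε := by
  have hhalf : ∀ J : Set ℤ, (J.Pairwise fun p p' => p + p' ≠ e) →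
      ∑' p : J, ENNReal.ofReal (jb (p : ℤ) ^ (-(2 - 2 * α + η)) *
        jb (ν + disp α p + disp α (e - p)) ^ (-(1 - ε))) ≤ phaseConst α ε := by
    refine fun J hJ => tsum_phase_le (φ := fun p => ν + disp α p + disp α (e - p))
      hα hα' hε hε' hεη ?_
    intro p hp p' hp' hne
    have hgap : ν + disp α p + disp α (e - p) - (ν + disp α p' + disp α (e - p')) =
        resonance α p (p' - p) (e - p - p') := by
      simp only [resonance]
      rw [show p + (p' - p) = p' by ring, show p + (e - p - p') = e - p' by ring,
        show p' + (e - p - p') = e - p by ring]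
      ring
    rw [hgap]
    refine jb_rpow_le_abs_resonance hα hα' (sub_ne_zero.2 hne.symm) fun h => ?_
    exact hJ hp hp' hne (by linarith)
  have hle := hhalf {p | 2 * p ≤ e} fun p hp p' hp' hne => by
    simp only [Set.mem_ofPred_eq] at hp hp'
    omega
  have hgt := hhalf {p | 2 * p ≤ e}ᶜ fun p hp p' hp' _ => by
    simp only [Set.mem_compl_iff, Set.mem_ofPred_eq] at hp hp'
    omega
  rw [two_mul (phaseConst α ε), ← ENNReal.summable.tsum_add_tsum_compl (s := {p : ℤ | 2 * p ≤ e})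
    ENNReal.summable]
  exact add_le_add hle hgt

/-! ### The inner trilinear sum -/

lemma rpow_mul_rpow_le_of_le {X Y s θ η : ℝ} (hX : 0 < X) (hXY : X ≤ Y) (hs : s ≤ 1 / 2)
    (hη : 0 ≤ η) (h : 4 * s = 1 + θ + 2 * η) :
    X ^ (-(2 * s)) * Y ^ (-(2 * s)) ≤ X ^ (-(1 + η)) * Y ^ (-(θ + η)) := by
  have hY : 0 < Y := hX.trans_le hXY
  calc X ^ (-(2 * s)) * Y ^ (-(2 * s))
      = X ^ (-(1 + η)) * X ^ (1 + η - 2 * s) * Y ^ (-(2 * s)) := by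
        rw [← Real.rpow_add hX]; ring_nf
    _ ≤ X ^ (-(1 + η)) * Y ^ (1 + η - 2 * s) * Y ^ (-(2 * s)) := by
        gcongr
        linarith
    _ = X ^ (-(1 + η)) * Y ^ (-(θ + η)) := by
        rw [mul_assoc, ← Real.rpow_add hY]
        congr 2
        linarith

lemma rpow_mul_rpow_le_add {X Y s θ η : ℝ} (hX : 0 < X) (hY : 0 < Y) (hs : s ≤ 1 / 2)
    (hη : 0 ≤ η) (h : 4 * s = 1 + θ + 2 * η) :
    X ^ (-(2 * s)) * Y ^ (-(2 * s)) ≤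
      X ^ (-(1 + η)) * Y ^ (-(θ + η)) + Y ^ (-(1 + η)) * X ^ (-(θ + η)) := by
  rcases le_total X Y with hXY | hYX
  · exact (rpow_mul_rpow_le_of_le hX hXY hs hη h).trans
      (le_add_of_nonneg_right (by positivity))
  · rw [mul_comm]
    exact (rpow_mul_rpow_le_of_le hY hYX hs hη h).trans
      (le_add_of_nonneg_left (by positivity))

lemma rpow_triple_le_of_le {X Y Z Q s θ η : ℝ} (hX : 0 < X) (hY : 0 < Y) (hQ : 0 < Q)
    (hXZ : X ≤ Z) (hYZ : Y ≤ Z) (hQXYZ : Q ≤ X + Y + Z) (hs : s ≤ 1 / 2) (hs0 : 0 ≤ s)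
    (hη : 0 ≤ η) (h : 4 * s = 1 + θ + 2 * η) :
    X ^ (-(2 * s)) * Y ^ (-(2 * s)) * Z ^ (-(2 * s)) ≤ 3 * Q ^ (-(2 * s)) *
      (X ^ (-(1 + η)) * Y ^ (-(θ + η)) + Y ^ (-(1 + η)) * X ^ (-(θ + η))) := by
  have hZ : 0 < Z := hX.trans_le hXZ
  have hthree : (3 : ℝ) ^ (2 * s) ≤ 3 :=
    (Real.rpow_le_rpow_of_exponent_le (by norm_num) (by linarith)).trans_eq (Real.rpow_one 3)
  have hZQ : Z ^ (-(2 * s)) ≤ 3 * Q ^ (-(2 * s)) :=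
    (rpow_neg_le_of_le_mul hQ hZ (by norm_num : (0 : ℝ) < 3) (by linarith)
      (by linarith)).trans (by gcongr)
  rw [mul_comm (3 * _)]
  exact mul_le_mul (rpow_mul_rpow_le_add hX hY hs hη h) hZQ (by positivity) (by positivity)

/-- Only one variable is large, and it carries the output weight. -/
lemma rpow_triple_le {X Y Z Q s θ η : ℝ} (hX : 0 < X) (hY : 0 < Y) (hZ : 0 < Z) (hQ : 0 < Q)
    (hQXYZ : Q ≤ X + Y + Z) (hs : s ≤ 1 / 2) (hs0 : 0 ≤ s) (hη : 0 ≤ η)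
    (h : 4 * s = 1 + θ + 2 * η) :
    X ^ (-(2 * s)) * Y ^ (-(2 * s)) * Z ^ (-(2 * s)) ≤ 3 * Q ^ (-(2 * s)) *
      (X ^ (-(1 + η)) * (Y ^ (-(θ + η)) + Z ^ (-(θ + η))) +
        Y ^ (-(1 + η)) * (X ^ (-(θ + η)) + Z ^ (-(θ + η))) +
        Z ^ (-(1 + η)) * (X ^ (-(θ + η)) + Y ^ (-(θ + η)))) := by
  have hXY : 0 < X ^ (-(1 + η)) * Y ^ (-(θ + η)) := by positivity
  have hXZ : 0 < X ^ (-(1 + η)) * Z ^ (-(θ + η)) := by positivity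
  have hYX : 0 < Y ^ (-(1 + η)) * X ^ (-(θ + η)) := by positivity
  have hYZ : 0 < Y ^ (-(1 + η)) * Z ^ (-(θ + η)) := by positivity
  have hZX : 0 < Z ^ (-(1 + η)) * X ^ (-(θ + η)) := by positivity
  have hZY : 0 < Z ^ (-(1 + η)) * Y ^ (-(θ + η)) := by positivity
  have hmax : (X ≤ Z ∧ Y ≤ Z) ∨ (X ≤ Y ∧ Z ≤ Y) ∨ (Y ≤ X ∧ Z ≤ X) := by grind
  rcases hmax with ⟨hle, hle'⟩ | ⟨hle, hle'⟩ | ⟨hle, hle'⟩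
  · refine (rpow_triple_le_of_le hX hY hQ hle hle' hQXYZ hs hs0 hη h).trans ?_
    refine mul_le_mul_of_nonneg_left ?_ (by positivity)
    linarith
  · rw [mul_right_comm]
    refine (rpow_triple_le_of_le hX hZ hQ hle hle' (by linarith) hs hs0 hη h).trans ?_
    refine mul_le_mul_of_nonneg_left ?_ (by positivity)
    linarith
  · rw [mul_assoc, mul_comm (X ^ _)]
    refine (rpow_triple_le_of_le hY hZ hQ hle hle' (by linarith) hs hs0 hη h).trans ?_
    refine mul_le_mul_of_nonneg_left ?_ (by positivity)
    linarith

/-- The weight `⟨|x|^{2α} + |z|^{2α} - |y|^{2α} - μ⟩^{-γ}` left after integrating a trilinear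
product over the modulations of its factors, at the frequencies `x - y + z = q`. -/
def modWeight (α γ μ : ℝ) (q x z : ℤ) : ℝ :=
  jb (disp α x + disp α z - disp α (x + z - q) - μ) ^ (-γ)

lemma modWeight_pos (α γ μ : ℝ) (q x z : ℤ) : 0 < modWeight α γ μ q x z := jb_rpow_pos _ _

lemma modWeight_le_one {α γ μ : ℝ} {q x z : ℤ} (hγ : 0 ≤ γ) : modWeight α γ μ q x z ≤ 1 :=
  Real.rpow_le_one_of_one_le_of_nonpos (one_le_jb _) (by linarith)

lemma modWeight_symm (α γ μ : ℝ) (q x z : ℤ) :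
    modWeight α γ μ q x z = modWeight α γ μ q z x := by
  simp only [modWeight, add_comm z x, add_comm (disp α z)]

/-- The summand of the inner trilinear sum at the frequencies `x - (x + z - q) + z = q`. -/
def innerTerm (α s γ μ : ℝ) (q x z : ℤ) : ℝ :=
  jb x ^ (-(2 * s)) * jb ((x + z - q : ℤ) : ℝ) ^ (-(2 * s)) * jb z ^ (-(2 * s)) *
    modWeight α γ μ q x z

lemma innerTerm_symm (α s γ μ : ℝ) (q x z : ℤ) :
    innerTerm α s γ μ q x z = innerTerm α s γ μ q z x := by
  simp only [innerTerm, modWeight_symm α γ μ q x z, add_comm z x]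
  ring

/-- The part of the majorant of `innerTerm` in which `x` carries the summable weight. For `x = q`
the modulation does not depend on `z`. -/
def edgeMajorant (α s η ε μ : ℝ) (q x z : ℤ) : ℝ≥0∞ :=
  if x = q then ENNReal.ofReal (jb z ^ (-(4 * s))) else
    ENNReal.ofReal (jb x ^ (-(1 + η))) *
      (ENNReal.ofReal (jb z ^ (-(2 - 2 * α + η)) * modWeight α (1 - ε) μ q x z) +
        ENNReal.ofReal (jb ((x + z - q : ℤ) : ℝ) ^ (-(2 - 2 * α + η)) *
          modWeight α (1 - ε) μ q x z))

/-- The part of the majorant of `innerTerm` in which the middle frequency `x + z - q` carries the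
summable weight. -/
def middleMajorant (α η ε μ : ℝ) (q x z : ℤ) : ℝ≥0∞ :=
  ENNReal.ofReal (jb ((x + z - q : ℤ) : ℝ) ^ (-(1 + η))) *
    ENNReal.ofReal (jb x ^ (-(2 - 2 * α + η)) * modWeight α (1 - ε) μ q x z)

lemma innerTerm_le_of_eq {α s η ε μ : ℝ} {q z : ℤ} (hε : ε ≤ 1) :
    ENNReal.ofReal (innerTerm α s (1 - ε) μ q q z) ≤
      ENNReal.ofReal (3 * jb q ^ (-(2 * s))) * edgeMajorant α s η ε μ q q z := by
  have hq := jb_rpow_pos (q : ℝ) (-(2 * s))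
  have hz := jb_rpow_pos (z : ℝ) (-(4 * s))
  have hmul : jb (z : ℝ) ^ (-(2 * s)) * jb (z : ℝ) ^ (-(2 * s)) = jb (z : ℝ) ^ (-(4 * s)) := by
    rw [← Real.rpow_add (jb_pos _)]; ring_nf
  rw [edgeMajorant, if_pos rfl, ← ENNReal.ofReal_mul (by positivity)]
  refine ENNReal.ofReal_le_ofReal ?_
  rw [innerTerm, add_sub_cancel_left, mul_assoc (jb (q : ℝ) ^ _), hmul]
  calc jb (q : ℝ) ^ (-(2 * s)) * jb (z : ℝ) ^ (-(4 * s)) * modWeight α (1 - ε) μ q q z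
      ≤ jb (q : ℝ) ^ (-(2 * s)) * jb (z : ℝ) ^ (-(4 * s)) * 1 := by
        gcongr
        exact modWeight_le_one (by linarith)
    _ ≤ 3 * jb (q : ℝ) ^ (-(2 * s)) * jb (z : ℝ) ^ (-(4 * s)) := by
        nlinarith [mul_pos hq hz]

lemma jb_le_jb_add_jb_add_jb (q x z : ℤ) :
    jb (q : ℝ) ≤ jb x + jb ((x + z - q : ℤ) : ℝ) + jb z := by
  have hq : (q : ℝ) = x + -((x + z - q : ℤ) : ℝ) + z := by push_cast; ring
  calc jb (q : ℝ) = jb (x + -((x + z - q : ℤ) : ℝ) + z) := by rw [← hq]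
    _ ≤ jb x + jb (-((x + z - q : ℤ) : ℝ)) + jb z :=
        (jb_add_le _ _).trans (by gcongr; exact jb_add_le _ _)
    _ = jb x + jb ((x + z - q : ℤ) : ℝ) + jb z := by rw [jb_neg]

lemma innerTerm_le_of_ne {α s η ε μ : ℝ} {q x z : ℤ} (hx : x ≠ q) (hz : z ≠ q)
    (hs : s ≤ 1 / 2) (hs0 : 0 ≤ s) (hη : 0 ≤ η) (h : 4 * s = 1 + (2 - 2 * α) + 2 * η) :
    ENNReal.ofReal (innerTerm α s (1 - ε) μ q x z) ≤
      ENNReal.ofReal (3 * jb q ^ (-(2 * s))) *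
        (edgeMajorant α s η ε μ q x z + middleMajorant α η ε μ q x z +
          (edgeMajorant α s η ε μ q z x + middleMajorant α η ε μ q z x)) := by
  have hq := jb_rpow_pos (q : ℝ) (-(2 * s))
  have hbound := rpow_triple_le (jb_pos x) (jb_pos ((x + z - q : ℤ) : ℝ)) (jb_pos z) (jb_pos q)
    (jb_le_jb_add_jb_add_jb q x z) hs hs0 hη h
  have hW := modWeight_pos α (1 - ε) μ q x z
  simp only [edgeMajorant, middleMajorant, if_neg hx, if_neg hz, add_comm z x,
    modWeight_symm α _ μ q z x]
  have hX := jb_pos (x : ℝ)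
  have hY := jb_pos ((x + z - q : ℤ) : ℝ)
  have hZ := jb_pos (z : ℝ)
  unfold innerTerm
  set X := jb (x : ℝ)
  set Y := jb ((x + z - q : ℤ) : ℝ)
  set Z := jb (z : ℝ)
  set W := modWeight α (1 - ε) μ q x z
  have hmul (u v : ℝ) (hu : 0 ≤ u) :
      ENNReal.ofReal u * ENNReal.ofReal v = ENNReal.ofReal (u * v) :=
    (ENNReal.ofReal_mul hu).symm
  have hadd (u v : ℝ) (hu : 0 ≤ u) (hv : 0 ≤ v) :
      ENNReal.ofReal u + ENNReal.ofReal v = ENNReal.ofReal (u + v) :=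
    (ENNReal.ofReal_add hu hv).symm
  repeat rw [hadd _ _ (by positivity) (by positivity)]
  repeat rw [hmul _ _ (by positivity)]
  repeat rw [hadd _ _ (by positivity) (by positivity)]
  rw [hmul _ _ (by positivity)]
  refine ENNReal.ofReal_le_ofReal ((mul_le_mul_of_nonneg_right hbound hW.le).trans_eq ?_)
  ring

lemma innerTerm_le {α s η ε μ : ℝ} {q x z : ℤ} (hs : s ≤ 1 / 2) (hs0 : 0 ≤ s)
    (hη : 0 ≤ η) (hε : ε ≤ 1) (h : 4 * s = 1 + (2 - 2 * α) + 2 * η) :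
    ENNReal.ofReal (innerTerm α s (1 - ε) μ q x z) ≤
      ENNReal.ofReal (3 * jb q ^ (-(2 * s))) *
        (edgeMajorant α s η ε μ q x z + middleMajorant α η ε μ q x z +
          (edgeMajorant α s η ε μ q z x + middleMajorant α η ε μ q z x)) := by
  rcases eq_or_ne x q with rfl | hx
  · refine (innerTerm_le_of_eq (η := η) hε).trans ?_
    gcongr
    rw [add_assoc]
    exact le_self_add
  rcases eq_or_ne z q with rfl | hz
  · rw [innerTerm_symm]
    refine (innerTerm_le_of_eq (η := η) hε).trans ?_
    gcongr
    exact le_self_add.trans le_add_self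
  exact innerTerm_le_of_ne hx hz hs hs0 hη h

lemma tsum_edgeMajorant_le {α s η ε : ℝ} (μ : ℝ) (q x : ℤ) (hα : 1 / 2 < α) (hα' : α ≤ 1)
    (hε : 0 < ε) (hε' : ε ≤ 1 / 2) (hεη : 8 * ε ≤ η) :
    ∑' z : ℤ, edgeMajorant α s η ε μ q x z ≤ (if x = q then jbSum (4 * s) else 0) +
      ENNReal.ofReal (jb x ^ (-(1 + η))) * (2 * phaseConst α ε) := by
  unfold edgeMajorant
  rcases eq_or_ne x q with hx | hx
  · simp only [if_pos hx]
    exact le_self_add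
  simp only [if_neg hx, zero_add]
  rw [ENNReal.tsum_mul_left, ENNReal.tsum_add, two_mul (phaseConst α ε)]
  gcongr
  · refine le_trans (le_of_eq ?_) (tsum_difference_phase_le (disp α x - μ) (sub_ne_zero.2 hx)
      hα hα' hε hε' hεη (σ := 1) abs_one)
    refine tsum_congr fun z => ?_
    rw [modWeight, show z + (x - q) = x + z - q by ring]
    ring_nf
  · refine le_trans (le_of_eq ?_) (tsum_difference_phase_le (disp α x - μ)
      (sub_ne_zero.2 hx.symm) hα hα' hε hε' hεη (σ := -1) (by simp))
    rw [← (Equiv.addRight (q - x)).tsum_eq]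
    refine tsum_congr fun y => ?_
    simp only [modWeight, Equiv.coe_addRight]
    rw [show x + (y + (q - x)) - q = y by ring]
    ring_nf

lemma tsum_middleMajorant_le {α η ε : ℝ} (μ : ℝ) (q : ℤ) (hα : 1 / 2 < α) (hα' : α ≤ 1)
    (hε : 0 < ε) (hε' : ε ≤ 1 / 2) (hεη : 8 * ε ≤ η) :
    ∑' x : ℤ, ∑' z : ℤ, middleMajorant α η ε μ q x z ≤
      jbSum (1 + η) * (2 * phaseConst α ε) := by
  have hshift : ∀ x : ℤ, ∑' z : ℤ, middleMajorant α η ε μ q x z =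
      ∑' y : ℤ, ENNReal.ofReal (jb (y : ℝ) ^ (-(1 + η))) *
        ENNReal.ofReal (jb x ^ (-(2 - 2 * α + η)) *
          jb (-disp α y - μ + disp α x + disp α (y + q - x)) ^ (-(1 - ε))) := by
    intro x
    rw [← (Equiv.addRight (q - x)).tsum_eq]
    refine tsum_congr fun y => ?_
    simp only [middleMajorant, modWeight, Equiv.coe_addRight]
    rw [show x + (y + (q - x)) - q = y by ring, show y + (q - x) = y + q - x by ring]
    ring_nf
  simp_rw [hshift]
  rw [ENNReal.tsum_comm]
  simp_rw [ENNReal.tsum_mul_left]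
  rw [jbSum, ← ENNReal.tsum_mul_right]
  gcongr with y
  exact tsum_sum_phase_le (-disp α y - μ) (y + q) hα hα' hε hε' hεη

lemma tsum_edgeMajorant_add_middleMajorant_le {α s η ε : ℝ} (μ : ℝ) (q : ℤ) (hα : 1 / 2 < α)
    (hα' : α ≤ 1) (hε : 0 < ε) (hε' : ε ≤ 1 / 2) (hεη : 8 * ε ≤ η) :
    ∑' x : ℤ, ∑' z : ℤ, (edgeMajorant α s η ε μ q x z + middleMajorant α η ε μ q x z) ≤
      jbSum (4 * s) + jbSum (1 + η) * (4 * phaseConst α ε) := by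
  simp_rw [ENNReal.tsum_add]
  calc _ ≤ ∑' x : ℤ, ((if x = q then jbSum (4 * s) else 0) +
        ENNReal.ofReal (jb x ^ (-(1 + η))) * (2 * phaseConst α ε)) +
        jbSum (1 + η) * (2 * phaseConst α ε) :=
        add_le_add (ENNReal.tsum_le_tsum fun x => tsum_edgeMajorant_le μ q x hα hα' hε hε' hεη)
          (tsum_middleMajorant_le μ q hα hα' hε hε' hεη)
    _ = jbSum (4 * s) + jbSum (1 + η) * (4 * phaseConst α ε) := by
        rw [ENNReal.tsum_add, tsum_ite_eq, ENNReal.tsum_mul_right, ← jbSum]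
        ring

lemma exists_tsum_innerTerm_le {α s η ε : ℝ} (hα : 1 / 2 < α) (hα' : α ≤ 1) (hs : s ≤ 1 / 2)
    (h : 4 * s = 1 + (2 - 2 * α) + 2 * η)
    (hε : 0 < ε) (hε' : ε ≤ 1 / 2) (hεη : 8 * ε ≤ η) :
    ∃ C : ℝ≥0, ∀ (μ : ℝ) (q : ℤ),
      ∑' x : ℤ, ∑' z : ℤ, ENNReal.ofReal (innerTerm α s (1 - ε) μ q x z) ≤
        C * ENNReal.ofReal (jb q ^ (-(2 * s))) := by
  set D := jbSum (4 * s) + jbSum (1 + η) * (4 * phaseConst α ε)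
  have hD : D < ∞ := ENNReal.add_lt_top.2 ⟨jbSum_lt_top (by linarith),
    ENNReal.mul_lt_top (jbSum_lt_top (by linarith))
      (ENNReal.mul_lt_top (by norm_num) (phaseConst_lt_top hε))⟩
  have hhalf := fun μ q => tsum_edgeMajorant_add_middleMajorant_le (s := s) μ q hα hα' hε hε' hεη
  refine ⟨(3 * (D + D)).toNNReal, fun μ q => ?_⟩
  rw [ENNReal.coe_toNNReal
    (ENNReal.mul_lt_top (by norm_num) (ENNReal.add_lt_top.2 ⟨hD, hD⟩)).ne]
  calc _ ≤ ∑' x : ℤ, ∑' z : ℤ, ENNReal.ofReal (3 * jb q ^ (-(2 * s))) *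
        (edgeMajorant α s η ε μ q x z + middleMajorant α η ε μ q x z +
          (edgeMajorant α s η ε μ q z x + middleMajorant α η ε μ q z x)) := by
        gcongr with x z
        exact innerTerm_le hs (by linarith) (by linarith) (by linarith) h
    _ = ENNReal.ofReal (3 * jb q ^ (-(2 * s))) *
        (∑' x : ℤ, ∑' z : ℤ, (edgeMajorant α s η ε μ q x z + middleMajorant α η ε μ q x z) +
          ∑' x : ℤ, ∑' z : ℤ, (edgeMajorant α s η ε μ q z x + middleMajorant α η ε μ q z x)) := by
        simp_rw [ENNReal.tsum_mul_left]
        congr 1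
        simp_rw [← ENNReal.tsum_add]
    _ ≤ ENNReal.ofReal (3 * jb q ^ (-(2 * s))) * (D + D) := by
        gcongr
        · exact hhalf μ q
        · rw [ENNReal.tsum_comm]
          exact hhalf μ q
    _ = 3 * (D + D) * ENNReal.ofReal (jb q ^ (-(2 * s))) := by
        rw [ENNReal.ofReal_mul (by norm_num), ENNReal.ofReal_ofNat]
        ring

/-! ### The outer sum -/

lemma two_rpow_le_two {x : ℝ} (hx : x ≤ 1) : (2 : ℝ) ^ x ≤ 2 :=
  (Real.rpow_le_rpow_of_exponent_le one_le_two hx).trans_eq (Real.rpow_one 2)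

lemma jb_intCast_le_two_mul_abs {n : ℤ} (hn : n ≠ 0) : jb n ≤ 2 * |(n : ℝ)| := by
  linarith [jb_le_one_add_abs (n : ℝ), one_le_abs_intCast hn]

lemma abs_rpow_neg_le_jb {n : ℤ} {r : ℝ} (hn : n ≠ 0) (hr : 0 ≤ r) :
    |(n : ℝ)| ^ (-r) ≤ 2 ^ r * jb n ^ (-r) :=
  rpow_neg_le_of_le_mul (jb_pos _) (abs_pos.2 (Int.cast_ne_zero.2 hn)) two_pos hr
    (jb_intCast_le_two_mul_abs hn)

lemma abs_resonance_inv_le {α R : ℝ} {k n m : ℤ} (hα : 1 / 2 < α) (hα' : α ≤ 1)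
    (hn : n ≠ 0) (hm : m ≠ 0) (h : |(k : ℝ)| + |(n : ℝ)| + |(m : ℝ)| ≤ R) :
    |resonance α k n m|⁻¹ ≤
      (2 * α * (2 * α - 1))⁻¹ * R ^ (2 - 2 * α) * (|(n : ℝ)| * |(m : ℝ)|)⁻¹ := by
  have hN := one_le_abs_intCast hn
  have hM := one_le_abs_intCast hm
  have hR : 0 < R := by linarith [abs_nonneg (k : ℝ)]
  have hα0 : 0 < 2 * α - 1 := by linarith
  rw [← neg_sub (2 * α) 2, Real.rpow_neg hR.le, ← mul_inv, ← mul_inv]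
  exact inv_anti₀ (by positivity) (le_abs_resonance hα hα' h)

lemma abs_resonance_inv_le_of_large {α B : ℝ} {k n m : ℤ} (hα : 1 / 2 < α) (hα' : α ≤ 1)
    (hB : 1 ≤ B) (hn : n ≠ 0) (hm : m ≠ 0)
    (h : |(k : ℝ)| + |(n : ℝ)| + |(m : ℝ)| ≤ B * |(m : ℝ)|) :
    |resonance α k n m|⁻¹ ≤ 4 * (2 * α * (2 * α - 1))⁻¹ * B *
      (jb m ^ (-(2 * α - 1)) * jb n ^ (-1 : ℝ)) := by
  have hM : 0 < |(m : ℝ)| := abs_pos.2 (Int.cast_ne_zero.2 hm)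
  have hα0 : 0 < 2 * α - 1 := by linarith
  have hmul : |(m : ℝ)| ^ (2 - 2 * α) * |(m : ℝ)|⁻¹ = |(m : ℝ)| ^ (-(2 * α - 1)) := by
    rw [← Real.rpow_neg_one, ← Real.rpow_add hM]; ring_nf
  have hBpow : B ^ (2 - 2 * α) ≤ B :=
    (Real.rpow_le_rpow_of_exponent_le hB (by linarith)).trans_eq (Real.rpow_one B)
  have hm_pow : |(m : ℝ)| ^ (-(2 * α - 1)) ≤ 2 * jb m ^ (-(2 * α - 1)) :=
    (abs_rpow_neg_le_jb hm hα0.le).trans (mul_le_mul_of_nonneg_right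
      (two_rpow_le_two (by linarith)) (jb_rpow_pos _ _).le)
  have hn_pow : |(n : ℝ)|⁻¹ ≤ 2 * jb n ^ (-1 : ℝ) := by
    simpa only [Real.rpow_neg_one, Real.rpow_one] using
      abs_rpow_neg_le_jb hn (r := 1) zero_le_one
  have hjb := jb_rpow_pos (m : ℝ) (-(2 * α - 1))
  calc |resonance α k n m|⁻¹
      ≤ (2 * α * (2 * α - 1))⁻¹ * (B * |(m : ℝ)|) ^ (2 - 2 * α) * (|(n : ℝ)| * |(m : ℝ)|)⁻¹ :=
        abs_resonance_inv_le hα hα' hn hm h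
    _ = (2 * α * (2 * α - 1))⁻¹ *
        (B ^ (2 - 2 * α) * |(m : ℝ)| ^ (-(2 * α - 1)) * |(n : ℝ)|⁻¹) := by
        rw [Real.mul_rpow (by linarith) hM.le, mul_inv |(n : ℝ)|, ← hmul]
        ring
    _ ≤ (2 * α * (2 * α - 1))⁻¹ * (B * (2 * jb m ^ (-(2 * α - 1))) * (2 * jb n ^ (-1 : ℝ))) := by
        gcongr
    _ = _ := by ring

lemma resonance_inv_sq_le_of_large {α B : ℝ} {k n m : ℤ} (hα : 1 / 2 < α) (hα' : α ≤ 1)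
    (hB : 1 ≤ B) (hn : n ≠ 0) (hm : m ≠ 0)
    (h : |(k : ℝ)| + |(n : ℝ)| + |(m : ℝ)| ≤ B * |(m : ℝ)|) :
    (resonance α k n m)⁻¹ ^ 2 ≤ 16 * (2 * α * (2 * α - 1))⁻¹ ^ 2 * B ^ 2 *
      (jb m ^ (-(4 * α - 2)) * jb n ^ (-2 : ℝ)) := by
  calc (resonance α k n m)⁻¹ ^ 2 = (|resonance α k n m|⁻¹) ^ 2 := by
        rw [inv_pow, inv_pow, sq_abs]
    _ ≤ (4 * (2 * α * (2 * α - 1))⁻¹ * B *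
        (jb m ^ (-(2 * α - 1)) * jb n ^ (-1 : ℝ))) ^ 2 := by
        gcongr
        exact abs_resonance_inv_le_of_large hα hα' hB hn hm h
    _ = 16 * (2 * α * (2 * α - 1))⁻¹ ^ 2 * B ^ 2 *
        ((jb m ^ (-(2 * α - 1))) ^ 2 * (jb n ^ (-1 : ℝ)) ^ 2) := by ring
    _ = _ := by
        rw [← Real.rpow_mul_natCast (jb_pos _).le, ← Real.rpow_mul_natCast (jb_pos _).le]
        push_cast
        ring_nf

/-- The summand of the outer sum: the square of the quotient of the output weight by the resonance
function, times the weights produced by the Cauchy–Schwarz inequality. -/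
def outerTerm (α s a : ℝ) (k n m : ℤ) : ℝ :=
  jb k ^ (2 * (s + a)) * (resonance α k n m)⁻¹ ^ 2 *
    (jb ((k + n : ℤ) : ℝ) ^ (-(2 * s)) * jb ((k + m : ℤ) : ℝ) ^ (-(2 * s)) *
      jb ((k + n + m : ℤ) : ℝ) ^ (-(2 * s)))

/-- The summand of the outer sum, restricted to the admissible frequencies
`|n||m| ≥ c⟨k⟩^{2-2α}`. -/
def admissibleOuterTerm (α s a c : ℝ) (k n m : ℤ) : ℝ≥0∞ :=
  if c * jb k ^ (2 - 2 * α) ≤ |(n : ℝ)| * |(m : ℝ)| then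
    ENNReal.ofReal (outerTerm α s a k n m) else 0

lemma outerTerm_symm (α s a : ℝ) (k n m : ℤ) : outerTerm α s a k n m = outerTerm α s a k m n := by
  unfold outerTerm resonance
  rw [add_right_comm k n m]
  ring_nf

/-- The majorant of `outerTerm` where `|m|` is at least of the size of `k` and of `n`. -/
def outerMajorant (s : ℝ) (k n m : ℤ) : ℝ :=
  (2 * jb n ^ (-2 : ℝ) + jb ((k + n : ℤ) : ℝ) ^ (-2 : ℝ)) *
    (jb ((k + m : ℤ) : ℝ) ^ (-(4 * s)) + jb ((k + n + m : ℤ) : ℝ) ^ (-(4 * s)))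

lemma jb_rpow_le_add_rpow (k n : ℤ) {r : ℝ} (hr : 0 ≤ r) (hr' : r ≤ 1) :
    jb k ^ r ≤ jb ((k + n : ℤ) : ℝ) ^ r + jb n ^ r := by
  have hk : jb (k : ℝ) ≤ jb ((k + n : ℤ) : ℝ) + jb n := by
    simpa [jb_neg] using jb_add_le ((k + n : ℤ) : ℝ) (-(n : ℝ))
  exact (Real.rpow_le_rpow (jb_pos _).le hk hr).trans
    (Real.rpow_add_le_add_rpow (jb_pos _).le (jb_pos _).le hr hr')

lemma jb_rpow_mul_jb_rpow_neg_le {s : ℝ} (k n : ℤ) (hs0 : 0 ≤ s) (hs : s ≤ 1 / 2) :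
    jb k ^ (2 * s) * (jb n ^ (-2 : ℝ) * jb ((k + n : ℤ) : ℝ) ^ (-(2 * s))) ≤
      2 * jb n ^ (-2 : ℝ) + jb ((k + n : ℤ) : ℝ) ^ (-2 : ℝ) := by
  have hk := jb_rpow_le_add_rpow k n (r := 2 * s) (by linarith) (by linarith)
  have hY := jb_pos ((k + n : ℤ) : ℝ)
  have hN := jb_pos (n : ℝ)
  set Y := jb ((k + n : ℤ) : ℝ)
  set N := jb (n : ℝ)
  have hYcancel : Y ^ (2 * s) * Y ^ (-(2 * s)) = 1 := by rw [← Real.rpow_add hY]; simp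
  have hNpow : N ^ (2 * s) * N ^ (-2 : ℝ) = N ^ (-(2 - 2 * s)) := by
    rw [← Real.rpow_add hN]; ring_nf
  have hmix := rpow_neg_mul_rpow_neg_le hN hY (by linarith : 0 ≤ 2 - 2 * s)
    (by linarith : 0 ≤ 2 * s)
  rw [sub_add_cancel] at hmix
  calc jb k ^ (2 * s) * (N ^ (-2 : ℝ) * Y ^ (-(2 * s)))
      ≤ (Y ^ (2 * s) + N ^ (2 * s)) * (N ^ (-2 : ℝ) * Y ^ (-(2 * s))) := by gcongr
    _ = N ^ (-2 : ℝ) * (Y ^ (2 * s) * Y ^ (-(2 * s))) +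
        N ^ (2 * s) * N ^ (-2 : ℝ) * Y ^ (-(2 * s)) := by ring
    _ = N ^ (-2 : ℝ) + N ^ (-(2 - 2 * s)) * Y ^ (-(2 * s)) := by rw [hYcancel, hNpow, mul_one]
    _ ≤ 2 * N ^ (-2 : ℝ) + Y ^ (-2 : ℝ) := by linarith

lemma jb_rpow_mul_jb_rpow_le {α a : ℝ} {k m : ℤ} (hα : 1 / 2 < α) (hα' : α ≤ 1)
    (ha : a ≤ 2 * α - 1) (hkm : jb k ≤ 4 * |(m : ℝ)|) :
    jb k ^ (2 * a) * jb m ^ (-(4 * α - 2)) ≤ 16 := by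
  have hm := rpow_neg_le_of_le_mul (jb_pos k) (jb_pos m) (by norm_num : (0 : ℝ) < 4)
    (by linarith : 0 ≤ 4 * α - 2) (hkm.trans (by gcongr; exact abs_le_jb _))
  have hfour : (4 : ℝ) ^ (4 * α - 2) ≤ 16 :=
    (Real.rpow_le_rpow_of_exponent_le (by norm_num) (by linarith : 4 * α - 2 ≤ 2)).trans_eq
      (by norm_num)
  have hk := jb_pos (k : ℝ)
  calc jb k ^ (2 * a) * jb m ^ (-(4 * α - 2))
      ≤ jb k ^ (2 * a) * (16 * jb k ^ (-(4 * α - 2))) := by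
        gcongr
        exact hm.trans (by gcongr)
    _ = 16 * jb k ^ (2 * a - (4 * α - 2)) := by
        rw [sub_eq_add_neg (2 * a), Real.rpow_add hk]; ring
    _ ≤ 16 := mul_le_of_le_one_right (by norm_num)
        (Real.rpow_le_one_of_one_le_of_nonpos (one_le_jb _) (by linarith))

lemma outerTerm_le_of_large {α s a : ℝ} {k n m : ℤ} (hα : 1 / 2 < α) (hα' : α ≤ 1)
    (hs0 : 0 ≤ s) (hs : s ≤ 1 / 2) (ha : a ≤ 2 * α - 1) (hn : n ≠ 0) (hm : m ≠ 0)
    (hnm : |(n : ℝ)| ≤ |(m : ℝ)|) (hkm : jb k ≤ 4 * |(m : ℝ)|) :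
    outerTerm α s a k n m ≤
      16 * (2 * α * (2 * α - 1))⁻¹ ^ 2 * 6 ^ 2 * 16 * outerMajorant s k n m := by
  have hres := resonance_inv_sq_le_of_large (α := α) (B := 6) (k := k) hα hα' (by norm_num) hn hm
    (by linarith [abs_le_jb (k : ℝ)])
  have hkm_pow := jb_rpow_mul_jb_rpow_le hα hα' ha hkm
  have hkn_pow := jb_rpow_mul_jb_rpow_neg_le k n hs0 hs
  have hpair := rpow_neg_mul_rpow_neg_le (jb_pos ((k + m : ℤ) : ℝ))
    (jb_pos ((k + n + m : ℤ) : ℝ)) (by linarith : 0 ≤ 2 * s) (by linarith : 0 ≤ 2 * s)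
  rw [show -(2 * s + 2 * s) = -(4 * s) by ring] at hpair
  set C := 16 * (2 * α * (2 * α - 1))⁻¹ ^ 2 * (6 : ℝ) ^ 2
  have hk := jb_pos (k : ℝ)
  have hn := jb_pos (n : ℝ)
  have hkn := jb_pos ((k + n : ℤ) : ℝ)
  have hkm := jb_pos ((k + m : ℤ) : ℝ)
  have hknm := jb_pos ((k + n + m : ℤ) : ℝ)
  unfold outerTerm outerMajorant
  rw [mul_add 2 s a, Real.rpow_add hk]
  set W := jb ((k + n : ℤ) : ℝ) ^ (-(2 * s))
  set V := jb ((k + m : ℤ) : ℝ) ^ (-(2 * s))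
  set V' := jb ((k + n + m : ℤ) : ℝ) ^ (-(2 * s))
  calc jb k ^ (2 * s) * jb k ^ (2 * a) * (resonance α k n m)⁻¹ ^ 2 * (W * V * V')
      ≤ jb k ^ (2 * s) * jb k ^ (2 * a) *
          (C * (jb m ^ (-(4 * α - 2)) * jb n ^ (-2 : ℝ))) * (W * V * V') := by gcongr
    _ = C * (jb k ^ (2 * a) * jb m ^ (-(4 * α - 2))) *
          (jb k ^ (2 * s) * (jb n ^ (-2 : ℝ) * W)) * (V * V') := by ring
    _ ≤ C * 16 * (2 * jb n ^ (-2 : ℝ) + jb ((k + n : ℤ) : ℝ) ^ (-2 : ℝ)) *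
          (jb ((k + m : ℤ) : ℝ) ^ (-(4 * s)) + jb ((k + n + m : ℤ) : ℝ) ^ (-(4 * s))) := by
        gcongr
    _ = _ := by ring

lemma jb_add_rpow_neg_le {s : ℝ} {k l : ℤ} (hs0 : 0 ≤ s) (hs : s ≤ 1 / 2)
    (hl : 2 * |(l : ℝ)| ≤ jb k) :
    jb ((k + l : ℤ) : ℝ) ^ (-(2 * s)) ≤ 2 * jb k ^ (-(2 * s)) := by
  have hk : jb (k : ℝ) ≤ 2 * jb ((k + l : ℤ) : ℝ) := by
    have hadd := jb_add_le_add_abs ((k + l : ℤ) : ℝ) (-(l : ℝ))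
    rw [abs_neg, Int.cast_add, add_neg_cancel_right] at hadd
    rw [Int.cast_add]
    linarith
  exact (rpow_neg_le_of_le_mul (jb_pos _) (jb_pos _) two_pos (by linarith) hk).trans
    (mul_le_mul_of_nonneg_right (two_rpow_le_two (by linarith)) (jb_rpow_pos _ _).le)

lemma inv_sq_le_of_mul_rpow_le {X c K β δ : ℝ} (hc : 0 < c) (hK : 0 < K) (hδ : δ ≤ 1)
    (h : c * K ^ β ≤ X) :
    X⁻¹ ^ 2 ≤ X ^ (-(1 + δ)) * (c ^ (-(1 - δ)) * K ^ (-(β * (1 - δ)))) := by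
  have hX : 0 < X := lt_of_lt_of_le (by positivity) h
  have hsplit : X⁻¹ ^ 2 = X ^ (-(1 + δ)) * X ^ (-(1 - δ)) := by
    rw [← Real.rpow_add hX, inv_pow, ← Real.rpow_natCast, ← Real.rpow_neg hX.le]
    push_cast
    ring_nf
  have hpow : X ^ (-(1 - δ)) ≤ c ^ (-(1 - δ)) * K ^ (-(β * (1 - δ))) :=
    calc X ^ (-(1 - δ)) ≤ (c * K ^ β) ^ (-(1 - δ)) :=
          Real.rpow_le_rpow_of_nonpos (by positivity) h (by linarith)
      _ = c ^ (-(1 - δ)) * K ^ (-(β * (1 - δ))) := by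
          rw [Real.mul_rpow hc.le (by positivity), ← Real.rpow_mul hK.le, mul_neg]
  rw [hsplit]
  gcongr

lemma abs_mul_abs_rpow_neg_le_jb {n m : ℤ} {r : ℝ} (hn : n ≠ 0) (hm : m ≠ 0) (hr : 0 ≤ r)
    (hr' : r ≤ 2) :
    (|(n : ℝ)| * |(m : ℝ)|) ^ (-r) ≤ 16 * (jb n ^ (-r) * jb m ^ (-r)) := by
  have hfour : (2 : ℝ) ^ r ≤ 4 :=
    (Real.rpow_le_rpow_of_exponent_le one_le_two hr').trans_eq (by norm_num)
  have hn' := jb_pos (n : ℝ)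
  have hm' := jb_pos (m : ℝ)
  calc (|(n : ℝ)| * |(m : ℝ)|) ^ (-r) = |(n : ℝ)| ^ (-r) * |(m : ℝ)| ^ (-r) :=
        Real.mul_rpow (abs_nonneg _) (abs_nonneg _)
    _ ≤ (2 ^ r * jb n ^ (-r)) * (2 ^ r * jb m ^ (-r)) := by
        gcongr
        · exact abs_rpow_neg_le_jb hn hr
        · exact abs_rpow_neg_le_jb hm hr
    _ ≤ (4 * jb n ^ (-r)) * (4 * jb m ^ (-r)) := by gcongr
    _ = 16 * (jb n ^ (-r) * jb m ^ (-r)) := by ring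

lemma resonance_inv_sq_le_of_small {α : ℝ} {k n m : ℤ} (hα : 1 / 2 < α) (hα' : α ≤ 1)
    (hn : n ≠ 0) (hm : m ≠ 0) (h : |(n : ℝ)| + |(m : ℝ)| ≤ jb k) :
    (resonance α k n m)⁻¹ ^ 2 ≤
      (2 * α * (2 * α - 1))⁻¹ ^ 2 * (4 * jb k ^ (4 - 4 * α)) * (|(n : ℝ)| * |(m : ℝ)|)⁻¹ ^ 2 := by
  have hα0 : 0 < 2 * α - 1 := by linarith
  have hk := jb_pos (k : ℝ)
  have hres := abs_resonance_inv_le (k := k) (R := 2 * jb (k : ℝ)) hα hα' hn hm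
    (by linarith [abs_le_jb (k : ℝ)])
  have htwo : (2 * jb (k : ℝ)) ^ (2 - 2 * α) ≤ 2 * jb k ^ (2 - 2 * α) := by
    rw [Real.mul_rpow zero_le_two hk.le]
    gcongr
    exact two_rpow_le_two (by linarith)
  calc (resonance α k n m)⁻¹ ^ 2 = (|resonance α k n m|⁻¹) ^ 2 := by
        rw [inv_pow, inv_pow, sq_abs]
    _ ≤ ((2 * α * (2 * α - 1))⁻¹ * (2 * jb k ^ (2 - 2 * α)) *
          (|(n : ℝ)| * |(m : ℝ)|)⁻¹) ^ 2 := by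
        gcongr
        exact hres.trans (by gcongr)
    _ = (2 * α * (2 * α - 1))⁻¹ ^ 2 * (4 * (jb k ^ (2 - 2 * α)) ^ 2) *
          (|(n : ℝ)| * |(m : ℝ)|)⁻¹ ^ 2 := by ring
    _ = _ := by
        rw [← Real.rpow_mul_natCast hk.le]
        push_cast
        ring_nf

lemma rpow_outer_weights_le_one {α s a δ K : ℝ} (hα : 0 ≤ α) (hK : 1 ≤ K) (hδ : 0 ≤ δ)
    (hδa : a + δ ≤ 2 * s + α - 1) :
    K ^ (2 * (s + a)) * K ^ (4 - 4 * α) * K ^ (-((2 - 2 * α) * (1 - δ))) *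
      (K ^ (-(2 * s)) * K ^ (-(2 * s)) * K ^ (-(2 * s))) ≤ 1 := by
  have hK0 : 0 < K := by linarith
  simp only [← Real.rpow_add hK0]
  refine Real.rpow_le_one_of_one_le_of_nonpos hK ?_
  nlinarith

lemma outerTerm_le_of_small {α s a c δ : ℝ} {k n m : ℤ} (hα : 1 / 2 < α) (hα' : α ≤ 1)
    (hc : 0 < c) (hs0 : 0 ≤ s) (hs : s ≤ 1 / 2) (hδ0 : 0 ≤ δ) (hδ1 : δ ≤ 1)
    (hδ : a + δ ≤ 2 * s + α - 1) (hn : n ≠ 0) (hm : m ≠ 0)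
    (hnm : c * jb k ^ (2 - 2 * α) ≤ |(n : ℝ)| * |(m : ℝ)|)
    (hkn : 4 * |(n : ℝ)| ≤ jb k) (hkm : 4 * |(m : ℝ)| ≤ jb k) :
    outerTerm α s a k n m ≤
      (2 * α * (2 * α - 1))⁻¹ ^ 2 * 4 * 8 * 16 * c ^ (-(1 - δ)) *
        (jb n ^ (-(1 + δ)) * jb m ^ (-(1 + δ))) := by
  have hN := abs_nonneg (n : ℝ)
  have hres := resonance_inv_sq_le_of_small hα hα' hn hm (by linarith : _ ≤ jb (k : ℝ))
  have hadm := inv_sq_le_of_mul_rpow_le hc (jb_pos (k : ℝ)) hδ1 hnm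
  have hprod := abs_mul_abs_rpow_neg_le_jb (r := 1 + δ) hn hm (by linarith) (by linarith)
  have hwn := jb_add_rpow_neg_le (k := k) (l := n) hs0 hs (by linarith)
  have hwm := jb_add_rpow_neg_le (k := k) (l := m) hs0 hs (by linarith)
  have hwnm := jb_add_rpow_neg_le (k := k) (l := n + m) hs0 hs (by
    rw [Int.cast_add]; linarith [abs_add_le (n : ℝ) m])
  rw [← add_assoc] at hwnm
  have hpow := rpow_outer_weights_le_one (by linarith) (one_le_jb (k : ℝ)) hδ0 hδ
  have hK := jb_pos (k : ℝ)
  have hjn := jb_pos (n : ℝ)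
  have hjm := jb_pos (m : ℝ)
  have hjkn := jb_rpow_pos ((k + n : ℤ) : ℝ) (-(2 * s))
  have hjkm := jb_rpow_pos ((k + m : ℤ) : ℝ) (-(2 * s))
  have hjknm := jb_rpow_pos ((k + n + m : ℤ) : ℝ) (-(2 * s))
  unfold outerTerm
  set K := jb (k : ℝ)
  calc _ ≤ K ^ (2 * (s + a)) * ((2 * α * (2 * α - 1))⁻¹ ^ 2 * (4 * K ^ (4 - 4 * α)) *
        ((16 * (jb n ^ (-(1 + δ)) * jb m ^ (-(1 + δ)))) *
          (c ^ (-(1 - δ)) * K ^ (-((2 - 2 * α) * (1 - δ)))))) *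
        ((2 * K ^ (-(2 * s))) * (2 * K ^ (-(2 * s))) * (2 * K ^ (-(2 * s)))) := by
        gcongr
        refine hres.trans ?_
        gcongr
        exact hadm.trans (by gcongr)
    _ = (2 * α * (2 * α - 1))⁻¹ ^ 2 * 4 * 8 * 16 * c ^ (-(1 - δ)) *
        (jb n ^ (-(1 + δ)) * jb m ^ (-(1 + δ))) *
        (K ^ (2 * (s + a)) * K ^ (4 - 4 * α) * K ^ (-((2 - 2 * α) * (1 - δ))) *
          (K ^ (-(2 * s)) * K ^ (-(2 * s)) * K ^ (-(2 * s)))) := by ring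
    _ ≤ _ := mul_le_of_le_one_right (by positivity) hpow

lemma ne_zero_of_mul_jb_rpow_le {c x : ℝ} {k n m : ℤ} (hc : 0 < c)
    (h : c * jb k ^ x ≤ |(n : ℝ)| * |(m : ℝ)|) : n ≠ 0 ∧ m ≠ 0 := by
  have : 0 < |(n : ℝ)| * |(m : ℝ)| := (mul_pos hc (jb_rpow_pos _ _)).trans_le h
  constructor <;> rintro rfl <;> simp at this

lemma exists_outerTerm_le {α s a c δ : ℝ} (hα : 1 / 2 < α) (hα' : α ≤ 1) (hc : 0 < c)
    (hs0 : 0 ≤ s) (hs : s ≤ 1 / 2) (ha : a ≤ 2 * α - 1) (hδ0 : 0 ≤ δ) (hδ1 : δ ≤ 1)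
    (hδ : a + δ ≤ 2 * s + α - 1) :
    ∃ A B : ℝ≥0, ∀ k n m : ℤ, c * jb k ^ (2 - 2 * α) ≤ |(n : ℝ)| * |(m : ℝ)| →
      ENNReal.ofReal (outerTerm α s a k n m) ≤
        A * (ENNReal.ofReal (jb n ^ (-(1 + δ))) * ENNReal.ofReal (jb m ^ (-(1 + δ)))) +
        B * (ENNReal.ofReal (outerMajorant s k n m) + ENNReal.ofReal (outerMajorant s k m n)) := by
  set A := (2 * α * (2 * α - 1))⁻¹ ^ 2 * 4 * 8 * 16 * c ^ (-(1 - δ))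
  set B := 16 * (2 * α * (2 * α - 1))⁻¹ ^ 2 * (6 : ℝ) ^ 2 * 16
  have hA : 0 ≤ A := by positivity
  have hB : 0 ≤ B := by positivity
  refine ⟨A.toNNReal, B.toNNReal, fun k n m h => ?_⟩
  change _ ≤ ENNReal.ofReal A * _ + ENNReal.ofReal B * _
  obtain ⟨hn, hm⟩ := ne_zero_of_mul_jb_rpow_le hc h
  rw [mul_add (ENNReal.ofReal B), ← ENNReal.ofReal_mul hB, ← ENNReal.ofReal_mul hB,
    ← ENNReal.ofReal_mul (jb_rpow_pos _ _).le, ← ENNReal.ofReal_mul hA]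
  by_cases hsmall : 4 * |(n : ℝ)| ≤ jb k ∧ 4 * |(m : ℝ)| ≤ jb k
  · exact le_add_right (ENNReal.ofReal_le_ofReal
      (outerTerm_le_of_small hα hα' hc hs0 hs hδ0 hδ1 hδ hn hm h hsmall.1 hsmall.2))
  refine le_add_left ?_
  rcases le_total |(n : ℝ)| |(m : ℝ)| with hnm | hmn
  · refine le_add_right (ENNReal.ofReal_le_ofReal ?_)
    refine outerTerm_le_of_large hα hα' hs0 hs ha hn hm hnm ?_
    by_contra! hkm
    exact hsmall ⟨by linarith, hkm.le⟩
  · refine le_add_left (ENNReal.ofReal_le_ofReal ?_)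
    rw [outerTerm_symm]
    refine outerTerm_le_of_large hα hα' hs0 hs ha hm hn hmn ?_
    by_contra! hkn
    exact hsmall ⟨hkn.le, by linarith⟩

lemma tsum_outerMajorant_le (s : ℝ) (k : ℤ) :
    ∑' n : ℤ, ∑' m : ℤ, ENNReal.ofReal (outerMajorant s k n m) ≤
      (3 * jbSum 2) * (2 * jbSum (4 * s)) := by
  have hofReal : ∀ n m : ℤ, ENNReal.ofReal (outerMajorant s k n m) =
      (2 * ENNReal.ofReal (jb n ^ (-2 : ℝ)) + ENNReal.ofReal (jb ((k + n : ℤ) : ℝ) ^ (-2 : ℝ))) *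
      (ENNReal.ofReal (jb ((k + m : ℤ) : ℝ) ^ (-(4 * s))) +
        ENNReal.ofReal (jb ((k + n + m : ℤ) : ℝ) ^ (-(4 * s)))) := by
    intro n m
    have hjb := fun x r => (jb_rpow_pos x r).le
    rw [outerMajorant,
      ENNReal.ofReal_mul (add_nonneg (mul_nonneg zero_le_two (hjb _ _)) (hjb _ _)),
      ENNReal.ofReal_add (mul_nonneg zero_le_two (hjb _ _)) (hjb _ _),
      ENNReal.ofReal_add (hjb _ _) (hjb _ _), ENNReal.ofReal_mul zero_le_two,
      ENNReal.ofReal_ofNat]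
  simp_rw [hofReal, ENNReal.tsum_mul_left, ENNReal.tsum_add, tsum_jb_add, ENNReal.tsum_mul_right,
    ENNReal.tsum_add, ENNReal.tsum_mul_left, tsum_jb_add]
  rw [← jbSum]
  exact le_of_eq (by ring)

lemma exists_tsum_admissibleOuterTerm_le {α s a c : ℝ} (hα : 1 / 2 < α) (hα' : α ≤ 1) (hc : 0 < c)
    (hs0 : 1 / 4 < s) (hs : s ≤ 1 / 2) (ha : a ≤ 2 * α - 1) (ha' : a < 2 * s + α - 1) :
    ∃ C : ℝ≥0, ∀ k : ℤ, ∑' n : ℤ, ∑' m : ℤ, admissibleOuterTerm α s a c k n m ≤ C := by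
  set δ := min 1 (2 * s + α - 1 - a)
  have hδ0 : 0 < δ := lt_min one_pos (by linarith)
  have hδa : a + δ ≤ 2 * s + α - 1 := by linarith [min_le_right 1 (2 * s + α - 1 - a)]
  obtain ⟨A, B, hAB⟩ := exists_outerTerm_le hα hα' hc (by linarith) hs ha hδ0.le
    (min_le_left _ _) hδa
  set M := (3 * jbSum 2) * (2 * jbSum (4 * s))
  set T : ℝ≥0∞ := A * (jbSum (1 + δ) * jbSum (1 + δ)) + B * (M + M)
  have hT : T ≠ ∞ := by
    have hδ : jbSum (1 + δ) ≠ ∞ := (jbSum_lt_top (by linarith)).ne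
    have hM : M ≠ ∞ := ENNReal.mul_ne_top
      (ENNReal.mul_ne_top (by norm_num) (jbSum_lt_top (by norm_num)).ne)
      (ENNReal.mul_ne_top (by norm_num) (jbSum_lt_top (by linarith)).ne)
    finiteness
  refine ⟨T.toNNReal, fun k => ?_⟩
  rw [ENNReal.coe_toNNReal hT]
  calc _ ≤ ∑' n : ℤ, ∑' m : ℤ, (A * (ENNReal.ofReal (jb n ^ (-(1 + δ))) *
        ENNReal.ofReal (jb m ^ (-(1 + δ)))) + B * (ENNReal.ofReal (outerMajorant s k n m) +
          ENNReal.ofReal (outerMajorant s k m n))) := by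
        gcongr with n m
        unfold admissibleOuterTerm
        split_ifs with h
        · exact hAB k n m h
        · exact zero_le
    _ = A * (jbSum (1 + δ) * jbSum (1 + δ)) + B *
        (∑' n : ℤ, ∑' m : ℤ, ENNReal.ofReal (outerMajorant s k n m) +
          ∑' n : ℤ, ∑' m : ℤ, ENNReal.ofReal (outerMajorant s k m n)) := by
        simp_rw [ENNReal.tsum_add, ENNReal.tsum_mul_left, ENNReal.tsum_add,
          ENNReal.tsum_mul_right]
        rfl
    _ ≤ T := by
        simp only [T]
        gcongr
        · exact tsum_outerMajorant_le s k
        · rw [ENNReal.tsum_comm]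
          exact tsum_outerMajorant_le s k

/-! ### Sums over the frequency sets -/

/-- The time frequency `|k₁|^{2α} - |k₂|^{2α} + |k₃|^{2α} - |k₄|^{2α} + |k₅|^{2α}` of a quintic
product of free solutions. -/
def phase (α : ℝ) (κ : Fin 5 → ℤ) : ℝ :=
  disp α (κ 0) - disp α (κ 1) + disp α (κ 2) - disp α (κ 3) + disp α (κ 4)

/-- The denominator of `NR₁`. -/
def den1 (α : ℝ) (k : ℤ) (κ : Fin 5 → ℤ) : ℝ :=
  disp α k - disp α (κ 0) + disp α (κ 1) - disp α (k - κ 0 + κ 1)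

/-- The denominator of `NR₂`. -/
def den2 (α : ℝ) (k : ℤ) (κ : Fin 5 → ℤ) : ℝ :=
  disp α k - disp α (κ 0) + disp α (k - κ 0 - κ 2) - disp α (κ 2)

lemma disp_neg (α : ℝ) (k : ℤ) : disp α (-k) = disp α k := by simp [disp]

lemma den1_eq_resonance (α : ℝ) (k : ℤ) (κ : Fin 5 → ℤ) :
    den1 α k κ = resonance α k (κ 0 - k) (κ 1 - κ 0) := by
  unfold den1 resonance
  rw [show k + (κ 0 - k) = κ 0 by ring, show k + (κ 1 - κ 0) = k - κ 0 + κ 1 by ring,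
    show κ 0 + (κ 1 - κ 0) = κ 1 by ring]
  ring

lemma den2_eq_resonance (α : ℝ) (k : ℤ) (κ : Fin 5 → ℤ) :
    den2 α k κ = resonance α k (κ 0 - k) (κ 2 - k) := by
  unfold den2 resonance
  rw [show k + (κ 0 - k) = κ 0 by ring, show k + (κ 2 - k) = κ 2 by ring,
    ← disp_neg α (k - κ 0 - κ 2), show -(k - κ 0 - κ 2) = κ 0 + (κ 2 - k) by ring]
  ring

/-- The summand at the frequencies `κ` that the Cauchy–Schwarz inequality produces from the
multiplier `⟨k⟩^{s+a} / D`. -/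
def weightTerm (α s a γ : ℝ) (D : ℤ → (Fin 5 → ℤ) → ℝ) (k : ℤ) (κ : Fin 5 → ℤ) : ℝ :=
  jb k ^ (2 * (s + a)) * (D k κ)⁻¹ ^ 2 * (∏ i, jb (κ i) ^ (-(2 * s))) *
    jb (disp α k - phase α κ) ^ (-γ)

lemma tsum_le_tsum_quadruple {ι : Type*} {g : ι → ℝ≥0∞} {A : ℤ → ℤ → ℝ≥0∞}
    {B : ℤ → ℤ → ℤ → ℤ → ℝ≥0∞} {e : ι → ℤ × ℤ × ℤ × ℤ} (he : Function.Injective e)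
    (h : ∀ i, g i ≤ A (e i).1 (e i).2.1 * B (e i).1 (e i).2.1 (e i).2.2.1 (e i).2.2.2) :
    ∑' i, g i ≤ ∑' n, ∑' m, A n m * ∑' x, ∑' z, B n m x z := by
  calc ∑' i, g i ≤ ∑' i, (fun q : ℤ × ℤ × ℤ × ℤ => A q.1 q.2.1 * B q.1 q.2.1 q.2.2.1 q.2.2.2)
        (e i) := ENNReal.tsum_le_tsum h
    _ ≤ ∑' q : ℤ × ℤ × ℤ × ℤ, A q.1 q.2.1 * B q.1 q.2.1 q.2.2.1 q.2.2.2 :=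
        ENNReal.tsum_comp_le_tsum_of_injective he _
    _ = _ := by simp_rw [ENNReal.tsum_prod', ENNReal.tsum_mul_left]

lemma mem_freq1 {α c : ℝ} {k : ℤ} {κ : Fin 5 → ℤ} : κ ∈ freq1 α c k ↔
    k - κ 0 + κ 1 - κ 2 + κ 3 - κ 4 = 0 ∧
      c * jb (k : ℝ) ^ (2 - 2 * α) ≤ |((κ 0 - k : ℤ) : ℝ)| * |((κ 1 - κ 0 : ℤ) : ℝ)| := Iff.rfl

lemma mem_freq2 {α c : ℝ} {k : ℤ} {κ : Fin 5 → ℤ} : κ ∈ freq2 α c k ↔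
    k - κ 0 + κ 1 - κ 2 + κ 3 - κ 4 = 0 ∧
      c * jb (k : ℝ) ^ (2 - 2 * α) ≤ |((κ 0 - k : ℤ) : ℝ)| * |((κ 2 - k : ℤ) : ℝ)| := by
  rw [Int.cast_sub (κ 2) k, abs_sub_comm (κ 2 : ℝ), ← Int.cast_sub k]
  exact Iff.rfl

/-- Coordinates on `freq1 α c k`: the arguments of the resonance function, followed by the
variables of the inner sum. -/
def coord1 (k : ℤ) (κ : Fin 5 → ℤ) : ℤ × ℤ × ℤ × ℤ := (κ 0 - k, κ 1 - κ 0, κ 2, κ 4)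

/-- Coordinates on `freq2 α c k`: the arguments of the resonance function, followed by the
variables of the inner sum. -/
def coord2 (k : ℤ) (κ : Fin 5 → ℤ) : ℤ × ℤ × ℤ × ℤ := (κ 0 - k, κ 2 - k, κ 1, κ 3)

lemma coord1_injective (α c : ℝ) (k : ℤ) :
    Function.Injective (fun κ : freq1 α c k => coord1 k κ) := by
  rintro ⟨κ, hκ⟩ ⟨κ', hκ'⟩ h
  have hsum := (mem_freq1.1 hκ).1
  have hsum' := (mem_freq1.1 hκ').1
  simp only [coord1, Prod.mk.injEq] at h
  refine Subtype.ext (funext fun i => ?_)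
  fin_cases i <;> simp <;> omega

lemma coord2_injective (α c : ℝ) (k : ℤ) :
    Function.Injective (fun κ : freq2 α c k => coord2 k κ) := by
  rintro ⟨κ, hκ⟩ ⟨κ', hκ'⟩ h
  have hsum := (mem_freq2.1 hκ).1
  have hsum' := (mem_freq2.1 hκ').1
  simp only [coord2, Prod.mk.injEq] at h
  refine Subtype.ext (funext fun i => ?_)
  fin_cases i <;> simp <;> omega

/-- The part of `weightTerm` that depends on the outer frequencies `k + n` and `p` only. The third
weight of `outerTerm` is supplied by the inner sum. -/
def outerPart (α s a : ℝ) (k n m p : ℤ) : ℝ :=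
  jb k ^ (2 * (s + a)) * (resonance α k n m)⁻¹ ^ 2 *
    (jb ((k + n : ℤ) : ℝ) ^ (-(2 * s)) * jb (p : ℝ) ^ (-(2 * s)))

lemma outerPart_nonneg (α s a : ℝ) (k n m p : ℤ) : 0 ≤ outerPart α s a k n m p :=
  mul_nonneg (mul_nonneg (jb_rpow_pos _ _).le (sq_nonneg _))
    (mul_nonneg (jb_rpow_pos _ _).le (jb_rpow_pos _ _).le)

lemma outerPart_mul_eq (α s a : ℝ) {k n m p q : ℤ}
    (hpq : (p = k + n + m ∧ q = k + m) ∨ (p = k + m ∧ q = k + n + m)) :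
    outerPart α s a k n m p * jb q ^ (-(2 * s)) = outerTerm α s a k n m := by
  unfold outerPart outerTerm
  rcases hpq with ⟨rfl, rfl⟩ | ⟨rfl, rfl⟩ <;> ring

lemma weightTerm_den1_eq {α c k κ} (s a γ : ℝ) (hκ : κ ∈ freq1 α c k) :
    weightTerm α s a γ (den1 α) k κ = outerPart α s a k (κ 0 - k) (κ 1 - κ 0) (κ 1) *
      innerTerm α s γ (disp α k - disp α (κ 0) + disp α (κ 1)) (k + (κ 1 - κ 0)) (κ 2) (κ 4) := by
  have hsum := (mem_freq1.1 hκ).1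
  unfold weightTerm outerPart innerTerm modWeight phase
  rw [den1_eq_resonance, Fin.prod_univ_five, show k + (κ 0 - k) = κ 0 by ring,
    show κ 2 + κ 4 - (k + (κ 1 - κ 0)) = κ 3 by linarith, ← jb_neg
      (disp α k - (disp α (κ 0) - disp α (κ 1) + disp α (κ 2) - disp α (κ 3) + disp α (κ 4)))]
  ring_nf

lemma weightTerm_den2_eq {α c k κ} (s a γ : ℝ) (hκ : κ ∈ freq2 α c k) :
    weightTerm α s a γ (den2 α) k κ = outerPart α s a k (κ 0 - k) (κ 2 - k) (κ 2) *
      innerTerm α s γ (disp α (κ 0) + disp α (κ 2) - disp α k) (κ 0 + (κ 2 - k)) (κ 1) (κ 3) := by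
  have hsum := (mem_freq2.1 hκ).1
  unfold weightTerm outerPart innerTerm modWeight phase
  rw [den2_eq_resonance, Fin.prod_univ_five, show k + (κ 0 - k) = κ 0 by ring,
    show κ 1 + κ 3 - (κ 0 + (κ 2 - k)) = κ 4 by linarith]
  ring_nf

section TsumWeightTerm

variable {α s a c γ : ℝ} {C C' : ℝ≥0}

lemma tsum_weightTerm_le_of_coord {ι : Type*} {w : ι → ℝ} {k : ℤ} {coord : ι → ℤ × ℤ × ℤ × ℤ}
    {μ : ℤ → ℤ → ℝ} {p q : ℤ → ℤ → ℤ}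
    (hinner : ∀ (μ : ℝ) (q : ℤ), ∑' x : ℤ, ∑' z : ℤ, ENNReal.ofReal (innerTerm α s γ μ q x z) ≤
      C * ENNReal.ofReal (jb q ^ (-(2 * s))))
    (houter : ∑' n : ℤ, ∑' m : ℤ, admissibleOuterTerm α s a c k n m ≤ C')
    (hpq : ∀ n m, (p n m = k + n + m ∧ q n m = k + m) ∨ (p n m = k + m ∧ q n m = k + n + m))
    (hcoord : Function.Injective coord)
    (hadm : ∀ i, c * jb k ^ (2 - 2 * α) ≤ |((coord i).1 : ℝ)| * |((coord i).2.1 : ℝ)|)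
    (hw : ∀ i, w i = outerPart α s a k (coord i).1 (coord i).2.1 (p (coord i).1 (coord i).2.1) *
      innerTerm α s γ (μ (coord i).1 (coord i).2.1) (q (coord i).1 (coord i).2.1)
        (coord i).2.2.1 (coord i).2.2.2) :
    ∑' i, ENNReal.ofReal (w i) ≤ C * C' := by
  set A : ℤ → ℤ → ℝ≥0∞ := fun n m => if c * jb k ^ (2 - 2 * α) ≤ |(n : ℝ)| * |(m : ℝ)| then
    ENNReal.ofReal (outerPart α s a k n m (p n m)) else 0 with hA
  calc ∑' i, ENNReal.ofReal (w i)
      ≤ ∑' n, ∑' m, A n m *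
          ∑' x, ∑' z, ENNReal.ofReal (innerTerm α s γ (μ n m) (q n m) x z) := by
        refine tsum_le_tsum_quadruple (B := fun n m x z =>
          ENNReal.ofReal (innerTerm α s γ (μ n m) (q n m) x z)) hcoord fun i => le_of_eq ?_
        simp only [hA]
        rw [if_pos (hadm i), hw i, ENNReal.ofReal_mul (outerPart_nonneg _ _ _ _ _ _ _)]
    _ ≤ ∑' n, ∑' m, A n m * (C * ENNReal.ofReal (jb (q n m) ^ (-(2 * s)))) := by
        gcongr
        exact hinner _ _
    _ = ∑' n, ∑' m, C * admissibleOuterTerm α s a c k n m := by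
        refine tsum_congr fun n => tsum_congr fun m => ?_
        simp only [hA, admissibleOuterTerm]
        split_ifs
        · rw [mul_left_comm, ← ENNReal.ofReal_mul (outerPart_nonneg _ _ _ _ _ _ _),
            outerPart_mul_eq α s a (hpq n m)]
        · simp only [zero_mul, mul_zero]
    _ = C * ∑' n, ∑' m, admissibleOuterTerm α s a c k n m := by simp_rw [ENNReal.tsum_mul_left]
    _ ≤ C * C' := by gcongr

lemma tsum_weightTerm_freq1_le
    (hinner : ∀ (μ : ℝ) (q : ℤ), ∑' x : ℤ, ∑' z : ℤ, ENNReal.ofReal (innerTerm α s γ μ q x z) ≤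
      C * ENNReal.ofReal (jb q ^ (-(2 * s)))) (k : ℤ)
    (houter : ∑' n : ℤ, ∑' m : ℤ, admissibleOuterTerm α s a c k n m ≤ C') :
    ∑' κ : freq1 α c k, ENNReal.ofReal (weightTerm α s a γ (den1 α) k κ) ≤ C * C' := by
  refine tsum_weightTerm_le_of_coord (p := fun n m => k + n + m) (q := fun _ m => k + m)
    (μ := fun n m => disp α k - disp α (k + n) + disp α (k + n + m)) hinner houter
    (fun _ _ => Or.inl ⟨rfl, rfl⟩) (coord1_injective α c k) (fun κ => (mem_freq1.1 κ.2).2)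
    fun κ => ?_
  simp only [coord1, add_sub_cancel]
  exact weightTerm_den1_eq s a γ κ.2

lemma tsum_weightTerm_freq2_le
    (hinner : ∀ (μ : ℝ) (q : ℤ), ∑' x : ℤ, ∑' z : ℤ, ENNReal.ofReal (innerTerm α s γ μ q x z) ≤
      C * ENNReal.ofReal (jb q ^ (-(2 * s)))) (k : ℤ)
    (houter : ∑' n : ℤ, ∑' m : ℤ, admissibleOuterTerm α s a c k n m ≤ C') :
    ∑' κ : freq2 α c k, ENNReal.ofReal (weightTerm α s a γ (den2 α) k κ) ≤ C * C' := by
  refine tsum_weightTerm_le_of_coord (p := fun _ m => k + m) (q := fun n m => k + n + m)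
    (μ := fun n m => disp α (k + n) + disp α (k + m) - disp α k) hinner houter
    (fun _ _ => Or.inr ⟨rfl, rfl⟩) (coord2_injective α c k) (fun κ => (mem_freq2.1 κ.2).2)
    fun κ => ?_
  simp only [coord2, add_sub_cancel]
  exact weightTerm_den2_eq s a γ κ.2

end TsumWeightTerm

/-! ### Absolute convergence at a fixed output frequency -/

lemma mul_mul_le_rpow_mul_rpow {x y z : ℝ} (hz : 0 ≤ z) (hzx : z ≤ x) (hzy : z ≤ y) :
    x * y * z ≤ x ^ (3 / 2 : ℝ) * y ^ (3 / 2 : ℝ) := by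
  have rpow_eq_mul_sqrt {t : ℝ} (ht : 0 ≤ t) : t ^ (3 / 2 : ℝ) = t * Real.sqrt t := by
    rw [Real.sqrt_eq_rpow, show (3 / 2 : ℝ) = 1 + 1 / 2 by norm_num,
      Real.rpow_add_of_nonneg ht (by norm_num) (by norm_num), Real.rpow_one]
  have hx := hz.trans hzx
  have hy := hz.trans hzy
  have hsqrt : z ≤ Real.sqrt x * Real.sqrt y := by
    rw [← Real.mul_self_sqrt hz]
    gcongr
  calc x * y * z ≤ x * y * (Real.sqrt x * Real.sqrt y) := by gcongr
    _ = x ^ (3 / 2 : ℝ) * y ^ (3 / 2 : ℝ) := by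
        rw [rpow_eq_mul_sqrt hx, rpow_eq_mul_sqrt hy]
        ring

lemma mul_mul_le_rpow_add {x y z : ℝ} (hx : 0 ≤ x) (hy : 0 ≤ y) (hz : 0 ≤ z) :
    x * y * z ≤ x ^ (3 / 2 : ℝ) * y ^ (3 / 2 : ℝ) + y ^ (3 / 2 : ℝ) * z ^ (3 / 2 : ℝ) +
      x ^ (3 / 2 : ℝ) * z ^ (3 / 2 : ℝ) := by
  have hxy : 0 ≤ x ^ (3 / 2 : ℝ) * y ^ (3 / 2 : ℝ) := by positivity
  have hyz : 0 ≤ y ^ (3 / 2 : ℝ) * z ^ (3 / 2 : ℝ) := by positivity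
  have hxz : 0 ≤ x ^ (3 / 2 : ℝ) * z ^ (3 / 2 : ℝ) := by positivity
  have hmin : (z ≤ x ∧ z ≤ y) ∨ (x ≤ y ∧ x ≤ z) ∨ (y ≤ x ∧ y ≤ z) := by grind
  rcases hmin with ⟨h, h'⟩ | ⟨h, h'⟩ | ⟨h, h'⟩
  · linarith [mul_mul_le_rpow_mul_rpow hz h h']
  · linarith [mul_mul_le_rpow_mul_rpow hx h h']
  · linarith [mul_mul_le_rpow_mul_rpow hy h h']

lemma rpow_three_halves_le {b w s : ℝ} (hb : 0 ≤ b) (hw : 0 < w) :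
    b ^ (3 / 2 : ℝ) ≤ w ^ (2 * s) * b ^ 2 + w ^ (-(6 * s)) := by
  rcases le_total b (w ^ (-(4 * s))) with hbw | hwb
  · calc b ^ (3 / 2 : ℝ) ≤ (w ^ (-(4 * s))) ^ (3 / 2 : ℝ) := by gcongr
      _ = w ^ (-(6 * s)) := by rw [← Real.rpow_mul hw.le]; ring_nf
      _ ≤ _ := le_add_of_nonneg_left (by positivity)
  · have hsqrt : w ^ (-(2 * s)) ≤ b ^ (1 / 2 : ℝ) := by
      calc w ^ (-(2 * s)) = (w ^ (-(4 * s))) ^ (1 / 2 : ℝ) := by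
            rw [← Real.rpow_mul hw.le]; ring_nf
        _ ≤ _ := by gcongr
    calc b ^ (3 / 2 : ℝ) = w ^ (2 * s) * (b ^ (3 / 2 : ℝ) * w ^ (-(2 * s))) := by
          rw [mul_left_comm, ← Real.rpow_add hw, add_neg_cancel, Real.rpow_zero, mul_one]
      _ ≤ w ^ (2 * s) * (b ^ (3 / 2 : ℝ) * b ^ (1 / 2 : ℝ)) := by gcongr
      _ = w ^ (2 * s) * b ^ 2 := by
          rw [← Real.rpow_add_of_nonneg hb (by norm_num) (by norm_num), ← Real.rpow_natCast]
          norm_num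
      _ ≤ _ := le_add_of_nonneg_right (by positivity)

/-- The squared `Hˢ` norm of a function on `𝕋` whose Fourier coefficients have modulus `b`. -/
def sobolevSq (s : ℝ) (b : ℤ → ℝ≥0) : ℝ≥0∞ :=
  ∑' k : ℤ, ENNReal.ofReal (jb k ^ (2 * s) * (b k : ℝ) ^ 2)

lemma tsum_rpow_three_halves_le (s : ℝ) (b : ℤ → ℝ≥0) :
    ∑' k, ENNReal.ofReal ((b k : ℝ) ^ (3 / 2 : ℝ)) ≤ sobolevSq s b + jbSum (6 * s) := by
  unfold jbSum sobolevSq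
  rw [← ENNReal.tsum_add]
  refine ENNReal.tsum_le_tsum fun k => ?_
  rw [← ENNReal.ofReal_add (mul_nonneg (jb_rpow_pos _ _).le (sq_nonneg _)) (jb_rpow_pos _ _).le]
  exact ENNReal.ofReal_le_ofReal (rpow_three_halves_le (b k).2 (jb_pos _))

lemma tsum_add_sub_eq_tsum (g : ℤ → ℝ≥0∞) (x q : ℤ) : ∑' z, g (x + z - q) = ∑' z, g z := by
  rw [← (Equiv.addLeft (x - q)).tsum_eq g]
  refine tsum_congr fun z => ?_
  simp only [Equiv.coe_addLeft, sub_add_eq_add_sub]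

lemma tsum_tsum_pairwise_mul_eq (g : ℤ → ℝ≥0∞) (q : ℤ) :
    ∑' x : ℤ, ∑' z : ℤ, (g x * g (x + z - q) + g (x + z - q) * g z + g x * g z) =
      3 * (∑' k, g k) ^ 2 := by
  have hswap (z : ℤ) : ∑' x : ℤ, g (x + z - q) = ∑' x, g x := by
    simp_rw [add_comm _ z]
    exact tsum_add_sub_eq_tsum g z q
  simp_rw [ENNReal.tsum_add]
  rw [ENNReal.tsum_comm (f := fun x z => g (x + z - q) * g z)]
  simp_rw [ENNReal.tsum_mul_left, ENNReal.tsum_mul_right, tsum_add_sub_eq_tsum, hswap]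
  rw [ENNReal.tsum_mul_right, ENNReal.tsum_mul_left]
  ring

lemma tsum_trilinear_le (s : ℝ) (b : ℤ → ℝ≥0) (q : ℤ) :
    ∑' x : ℤ, ∑' z : ℤ, ENNReal.ofReal (b x * b (x + z - q) * b z) ≤
      3 * (sobolevSq s b + jbSum (6 * s)) ^ 2 := by
  set g : ℤ → ℝ≥0∞ := fun k => ENNReal.ofReal ((b k : ℝ) ^ (3 / 2 : ℝ)) with hg
  have hterm (x z : ℤ) : ENNReal.ofReal (b x * b (x + z - q) * b z) ≤
      g x * g (x + z - q) + g (x + z - q) * g z + g x * g z := by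
    have hpow (l : ℤ) : 0 ≤ (b l : ℝ) ^ (3 / 2 : ℝ) := by positivity
    simp only [hg, ← ENNReal.ofReal_mul (hpow _)]
    rw [← ENNReal.ofReal_add (by positivity) (by positivity),
      ← ENNReal.ofReal_add (by positivity) (by positivity)]
    exact ENNReal.ofReal_le_ofReal (mul_mul_le_rpow_add (b _).2 (b _).2 (b _).2)
  calc ∑' x : ℤ, ∑' z : ℤ, ENNReal.ofReal (b x * b (x + z - q) * b z)
      ≤ ∑' x : ℤ, ∑' z : ℤ, (g x * g (x + z - q) + g (x + z - q) * g z + g x * g z) :=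
        ENNReal.tsum_le_tsum fun x => ENNReal.tsum_le_tsum fun z => hterm x z
    _ = 3 * (∑' k, g k) ^ 2 := tsum_tsum_pairwise_mul_eq g q
    _ ≤ _ := by gcongr; exact tsum_rpow_three_halves_le s b

lemma resonance_comm (α : ℝ) (k n m : ℤ) : resonance α k n m = resonance α k m n := by
  unfold resonance
  rw [add_right_comm k n m]
  ring

lemma resonance_inv_sq_mul_le_of_abs_le {α s w : ℝ} {k n m : ℤ} (hα : 1 / 2 < α) (hα' : α ≤ 1)
    (hs : 0 ≤ s) (hn : n ≠ 0) (hm : m ≠ 0) (hnm : |(n : ℝ)| ≤ |(m : ℝ)|) (hw : w ≤ 1) (p : ℤ) :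
    (resonance α k n m)⁻¹ ^ 2 * (w * jb p ^ (-(2 * s))) ≤
      16 * (2 * α * (2 * α - 1))⁻¹ ^ 2 * (|(k : ℝ)| + 2) ^ 2 *
        (jb n ^ (-2 : ℝ) * (jb m ^ (-(4 * α - 2 + 2 * s)) + jb p ^ (-(4 * α - 2 + 2 * s)))) := by
  have hm' := one_le_abs_intCast hm
  have hjn := jb_rpow_pos n (-2)
  have hjp := jb_rpow_pos p (-(2 * s))
  have hres := resonance_inv_sq_le_of_large (B := |(k : ℝ)| + 2) (k := k) hα hα'
    (by linarith [abs_nonneg (k : ℝ)]) hn hm (by nlinarith [abs_nonneg (k : ℝ)])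
  calc (resonance α k n m)⁻¹ ^ 2 * (w * jb p ^ (-(2 * s)))
      ≤ (resonance α k n m)⁻¹ ^ 2 * (1 * jb p ^ (-(2 * s))) := by gcongr
    _ ≤ 16 * (2 * α * (2 * α - 1))⁻¹ ^ 2 * (|(k : ℝ)| + 2) ^ 2 *
          (jb m ^ (-(4 * α - 2)) * jb n ^ (-2 : ℝ)) * (1 * jb p ^ (-(2 * s))) := by gcongr
    _ = 16 * (2 * α * (2 * α - 1))⁻¹ ^ 2 * (|(k : ℝ)| + 2) ^ 2 *
          (jb n ^ (-2 : ℝ) * (jb m ^ (-(4 * α - 2)) * jb p ^ (-(2 * s)))) := by ring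
    _ ≤ _ := by
        gcongr
        exact rpow_neg_mul_rpow_neg_le (jb_pos _) (jb_pos _) (by linarith) (by linarith)

/-- A summable majorant, for a fixed output frequency `k`, of the squared inverse resonance with the
Sobolev weights at the frequencies `k + n` and `p`. -/
def fixedMajorant (r : ℝ) (k n m p : ℤ) : ℝ :=
  jb n ^ (-2 : ℝ) * (jb m ^ (-r) + jb p ^ (-r)) +
    jb m ^ (-2 : ℝ) * (jb n ^ (-r) + jb ((k + n : ℤ) : ℝ) ^ (-r))

lemma resonance_inv_sq_mul_weights_le {α s : ℝ} {k n m : ℤ} (hα : 1 / 2 < α) (hα' : α ≤ 1)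
    (hs : 0 ≤ s) (hn : n ≠ 0) (hm : m ≠ 0) (p : ℤ) :
    (resonance α k n m)⁻¹ ^ 2 * (jb ((k + n : ℤ) : ℝ) ^ (-(2 * s)) * jb p ^ (-(2 * s))) ≤
      16 * (2 * α * (2 * α - 1))⁻¹ ^ 2 * (|(k : ℝ)| + 2) ^ 2 *
        fixedMajorant (4 * α - 2 + 2 * s) k n m p := by
  have hpos (x r : ℝ) : 0 ≤ jb x ^ r := (jb_rpow_pos x r).le
  have hweight (x : ℝ) : jb x ^ (-(2 * s)) ≤ 1 :=
    Real.rpow_le_one_of_one_le_of_nonpos (one_le_jb _) (by linarith)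
  unfold fixedMajorant
  rcases le_total |(n : ℝ)| |(m : ℝ)| with hnm | hmn
  · refine (resonance_inv_sq_mul_le_of_abs_le hα hα' hs hn hm hnm (hweight _) p).trans ?_
    gcongr
    exact le_add_of_nonneg_right (mul_nonneg (hpos _ _) (add_nonneg (hpos _ _) (hpos _ _)))
  · rw [resonance_comm, mul_comm (jb ((k + n : ℤ) : ℝ) ^ _)]
    refine (resonance_inv_sq_mul_le_of_abs_le hα hα' hs hm hn hmn (hweight _) (k + n)).trans ?_
    gcongr
    exact le_add_of_nonneg_left (mul_nonneg (hpos _ _) (add_nonneg (hpos _ _) (hpos _ _)))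

lemma tsum_fixedMajorant_lt_top {r : ℝ} (hr : 1 < r) (k : ℤ) (e : ℤ → ℤ) :
    ∑' n : ℤ, ∑' m : ℤ, ENNReal.ofReal (fixedMajorant r k n m (e n + m)) < ∞ := by
  have hpos (x r : ℝ) : 0 ≤ jb x ^ r := (jb_rpow_pos x r).le
  have hsplit (n m : ℤ) : ENNReal.ofReal (fixedMajorant r k n m (e n + m)) =
      ENNReal.ofReal (jb n ^ (-2 : ℝ)) * (ENNReal.ofReal (jb m ^ (-r)) +
          ENNReal.ofReal (jb ((e n + m : ℤ) : ℝ) ^ (-r))) +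
        ENNReal.ofReal (jb m ^ (-2 : ℝ)) * (ENNReal.ofReal (jb n ^ (-r)) +
          ENNReal.ofReal (jb ((k + n : ℤ) : ℝ) ^ (-r))) := by
    rw [← ENNReal.ofReal_add (hpos _ _) (hpos _ _), ← ENNReal.ofReal_add (hpos _ _) (hpos _ _),
      ← ENNReal.ofReal_mul (hpos _ _), ← ENNReal.ofReal_mul (hpos _ _),
      ← ENNReal.ofReal_add (mul_nonneg (hpos _ _) (add_nonneg (hpos _ _) (hpos _ _)))
        (mul_nonneg (hpos _ _) (add_nonneg (hpos _ _) (hpos _ _)))]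
    rfl
  have hjr := (jbSum_lt_top hr).ne
  have hj2 := (jbSum_lt_top one_lt_two).ne
  calc ∑' n : ℤ, ∑' m : ℤ, ENNReal.ofReal (fixedMajorant r k n m (e n + m))
      = jbSum 2 * (jbSum r + jbSum r) + jbSum 2 * (jbSum r + jbSum r) := by
        simp_rw [hsplit, ENNReal.tsum_add, ENNReal.tsum_mul_left, ENNReal.tsum_mul_right,
          ENNReal.tsum_mul_left, ENNReal.tsum_add, tsum_jb_add, ENNReal.tsum_mul_right]
        rfl
    _ < ∞ := by finiteness

lemma mul_mul_le_sq_weight_add_sq {s u v : ℝ} (ρ x y : ℝ) (hu : 0 < u) (hv : 0 < v) :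
    ρ * (x * y) ≤ ρ ^ 2 * (u ^ (-(2 * s)) * v ^ (-(2 * s))) +
      u ^ (2 * s) * x ^ 2 * (v ^ (2 * s) * y ^ 2) := by
  have hpow {w : ℝ} (hw : 0 < w) : w ^ (2 * s) = (w ^ s) ^ 2 := by
    rw [← Real.rpow_mul_natCast hw.le, mul_comm, Nat.cast_ofNat]
  rw [Real.rpow_neg hu.le, Real.rpow_neg hv.le, hpow hu, hpow hv]
  calc ρ * (x * y) = (ρ * (u ^ s)⁻¹ * (v ^ s)⁻¹) * (u ^ s * x * (v ^ s * y)) := by field_simp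
    _ ≤ (ρ * (u ^ s)⁻¹ * (v ^ s)⁻¹) ^ 2 + (u ^ s * x * (v ^ s * y)) ^ 2 := by
        nlinarith [sq_nonneg (ρ * (u ^ s)⁻¹ * (v ^ s)⁻¹ - u ^ s * x * (v ^ s * y)),
          sq_nonneg (ρ * (u ^ s)⁻¹ * (v ^ s)⁻¹), sq_nonneg (u ^ s * x * (v ^ s * y))]
    _ = _ := by ring

/-- The factor of the absolute quintic sum that depends on the outer frequencies `k + n` and `p`,
restricted to the non-resonant region. -/
def admissiblePairTerm (α c : ℝ) (b : ℤ → ℝ≥0) (k n m p : ℤ) : ℝ≥0∞ :=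
  if c * jb k ^ (2 - 2 * α) ≤ |(n : ℝ)| * |(m : ℝ)| then
    ENNReal.ofReal (|resonance α k n m|⁻¹ * (b (k + n) * b p)) else 0

section FixedOutput

variable {α s c : ℝ} (hα : 1 / 2 < α) (hα' : α ≤ 1) (hc : 0 < c)
include hα hα' hc

lemma admissiblePairTerm_le (hs : 0 ≤ s) (b : ℤ → ℝ≥0) (k n m p : ℤ) :
    admissiblePairTerm α c b k n m p ≤
      ENNReal.ofReal (16 * (2 * α * (2 * α - 1))⁻¹ ^ 2 * (|(k : ℝ)| + 2) ^ 2) *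
          ENNReal.ofReal (fixedMajorant (4 * α - 2 + 2 * s) k n m p) +
        ENNReal.ofReal (jb ((k + n : ℤ) : ℝ) ^ (2 * s) * (b (k + n) : ℝ) ^ 2) *
          ENNReal.ofReal (jb p ^ (2 * s) * (b p : ℝ) ^ 2) := by
  unfold admissiblePairTerm
  split_ifs with hadm
  swap
  · exact zero_le
  obtain ⟨hn, hm⟩ := ne_zero_of_mul_jb_rpow_le hc hadm
  have hpos (x r : ℝ) : 0 ≤ jb x ^ r := (jb_rpow_pos x r).le
  have hmaj : 0 ≤ fixedMajorant (4 * α - 2 + 2 * s) k n m p :=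
    add_nonneg (mul_nonneg (hpos _ _) (add_nonneg (hpos _ _) (hpos _ _)))
      (mul_nonneg (hpos _ _) (add_nonneg (hpos _ _) (hpos _ _)))
  have hsq (l : ℤ) : 0 ≤ jb l ^ (2 * s) * (b l : ℝ) ^ 2 := mul_nonneg (hpos _ _) (sq_nonneg _)
  rw [← ENNReal.ofReal_mul (by positivity), ← ENNReal.ofReal_mul (hsq _),
    ← ENNReal.ofReal_add (mul_nonneg (by positivity) hmaj) (mul_nonneg (hsq _) (hsq _))]
  refine ENNReal.ofReal_le_ofReal ((mul_mul_le_sq_weight_add_sq (s := s) _ _ _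
    (jb_pos ((k + n : ℤ) : ℝ)) (jb_pos (p : ℝ))).trans ?_)
  rw [inv_pow |_|, sq_abs, ← inv_pow]
  exact add_le_add_left (resonance_inv_sq_mul_weights_le hα hα' hs hn hm p) _

lemma tsum_admissiblePairTerm_lt_top (hs : 0 ≤ s) (hr : 1 < 4 * α - 2 + 2 * s) {b : ℤ → ℝ≥0}
    (hb : sobolevSq s b < ∞) (k : ℤ) (e : ℤ → ℤ) :
    ∑' n : ℤ, ∑' m : ℤ, admissiblePairTerm α c b k n m (e n + m) < ∞ := by
  set g : ℤ → ℝ≥0∞ := fun l => ENNReal.ofReal (jb l ^ (2 * s) * (b l : ℝ) ^ 2)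
  have hshift (l : ℤ) : ∑' m : ℤ, g (l + m) = sobolevSq s b := (Equiv.addLeft l).tsum_eq g
  have hmaj := (tsum_fixedMajorant_lt_top hr k e).ne
  have hb' := hb.ne
  refine (ENNReal.tsum_le_tsum fun n => ENNReal.tsum_le_tsum fun m =>
    admissiblePairTerm_le hα hα' hc hs b k n m (e n + m)).trans_lt ?_
  simp_rw [ENNReal.tsum_add, ENNReal.tsum_mul_left]
  change _ + ∑' n, g (k + n) * ∑' m, g (e n + m) < ∞
  simp_rw [hshift, ENNReal.tsum_mul_right, hshift]
  finiteness

lemma tsum_prod_lt_top_of_coord {ι : Type*} {w : ι → ℝ} {k : ℤ} {coord : ι → ℤ × ℤ × ℤ × ℤ}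
    {q : ℤ → ℤ → ℤ} {b : ℤ → ℝ≥0} (e : ℤ → ℤ) (hs : 1 / 4 < s) (hr : 1 < 4 * α - 2 + 2 * s)
    (hb : sobolevSq s b < ∞) (hcoord : Function.Injective coord)
    (hadm : ∀ i, c * jb k ^ (2 - 2 * α) ≤ |((coord i).1 : ℝ)| * |((coord i).2.1 : ℝ)|)
    (hw : ∀ i, w i = |resonance α k (coord i).1 (coord i).2.1|⁻¹ *
        (b (k + (coord i).1) * b (e (coord i).1 + (coord i).2.1)) *
      (b (coord i).2.2.1 *
        b ((coord i).2.2.1 + (coord i).2.2.2 - q (coord i).1 (coord i).2.1) *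
          b (coord i).2.2.2)) :
    ∑' i, ENNReal.ofReal (w i) < ∞ := by
  have hjb := (jbSum_lt_top (by linarith : 1 < 6 * s)).ne
  have hb' := hb.ne
  calc ∑' i, ENNReal.ofReal (w i)
      ≤ ∑' n, ∑' m, admissiblePairTerm α c b k n m (e n + m) *
          ∑' x : ℤ, ∑' z : ℤ, ENNReal.ofReal (b x * b (x + z - q n m) * b z) := by
        refine tsum_le_tsum_quadruple (B := fun n m x z =>
          ENNReal.ofReal (b x * b (x + z - q n m) * b z)) hcoord fun i => le_of_eq ?_
        rw [admissiblePairTerm, if_pos (hadm i), hw i, ENNReal.ofReal_mul (by positivity)]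
    _ ≤ ∑' n, ∑' m, admissiblePairTerm α c b k n m (e n + m) *
          (3 * (sobolevSq s b + jbSum (6 * s)) ^ 2) := by
        gcongr
        exact tsum_trilinear_le s b _
    _ < ∞ := by
        simp_rw [ENNReal.tsum_mul_right]
        exact ENNReal.mul_lt_top
          (tsum_admissiblePairTerm_lt_top hα hα' hc (by linarith) hr hb k e) (by finiteness)

lemma tsum_freq1_lt_top (hs : 1 / 4 < s) (hr : 1 < 4 * α - 2 + 2 * s) {b : ℤ → ℝ≥0}
    (hb : sobolevSq s b < ∞) (k : ℤ) :
    ∑' κ : freq1 α c k, ENNReal.ofReal (|den1 α k κ|⁻¹ * ∏ i, (b (κ.1 i) : ℝ)) < ∞ := by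
  refine tsum_prod_lt_top_of_coord (coord := fun κ : freq1 α c k => coord1 k κ)
    (q := fun _ m => k + m) hα hα' hc (fun n => k + n) hs hr hb (coord1_injective α c k)
    (fun κ => (mem_freq1.1 κ.2).2) fun ⟨κ, hκ⟩ => ?_
  have hsum := (mem_freq1.1 hκ).1
  simp only [coord1]
  rw [den1_eq_resonance, Fin.prod_univ_five, add_sub_cancel, add_sub_cancel,
    show κ 2 + κ 4 - (k + (κ 1 - κ 0)) = κ 3 by linarith]
  ring

lemma tsum_freq2_lt_top (hs : 1 / 4 < s) (hr : 1 < 4 * α - 2 + 2 * s) {b : ℤ → ℝ≥0}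
    (hb : sobolevSq s b < ∞) (k : ℤ) :
    ∑' κ : freq2 α c k, ENNReal.ofReal (|den2 α k κ|⁻¹ * ∏ i, (b (κ.1 i) : ℝ)) < ∞ := by
  refine tsum_prod_lt_top_of_coord (coord := fun κ : freq2 α c k => coord2 k κ)
    (q := fun n m => k + n + m) hα hα' hc (fun _ => k) hs hr hb (coord2_injective α c k)
    (fun κ => (mem_freq2.1 κ.2).2) fun ⟨κ, hκ⟩ => ?_
  have hsum := (mem_freq2.1 hκ).1
  simp only [coord2]
  rw [den2_eq_resonance, Fin.prod_univ_five, add_sub_cancel, add_sub_cancel,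
    show κ 1 + κ 3 - (κ 0 + (κ 2 - k)) = κ 4 by linarith]
  ring

end FixedOutput

/-! ### Cauchy–Schwarz and convolutions of weighted functions -/

lemma lintegral_sq_le_mul {X : Type*} [MeasurableSpace X] {μ : Measure X} {h u v : X → ℝ≥0∞}
    (hu : AEMeasurable u μ) (hv : AEMeasurable v μ) (hh : ∀ x, h x ^ 2 ≤ u x * v x) :
    (∫⁻ x, h x ∂μ) ^ 2 ≤ (∫⁻ x, u x ∂μ) * ∫⁻ x, v x ∂μ := by
  have hsqrt (t : ℝ≥0∞) : (t ^ (1 / 2 : ℝ)) ^ (2 : ℝ) = t := by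
    rw [← ENNReal.rpow_mul]; norm_num
  have hle (x : X) : h x ≤ u x ^ (1 / 2 : ℝ) * v x ^ (1 / 2 : ℝ) := by
    rw [← ENNReal.mul_rpow_of_nonneg _ _ (by norm_num)]
    calc h x = (h x ^ 2) ^ (1 / 2 : ℝ) := by
          rw [← ENNReal.rpow_natCast, ← ENNReal.rpow_mul]; norm_num
      _ ≤ _ := ENNReal.rpow_le_rpow (hh x) (by norm_num)
  have hCS := ENNReal.lintegral_mul_le_Lp_mul_Lq μ Real.HolderConjugate.two_two
    (hu.pow_const (1 / 2 : ℝ)) (hv.pow_const (1 / 2 : ℝ))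
  simp only [hsqrt] at hCS
  calc (∫⁻ x, h x ∂μ) ^ 2
      ≤ ((∫⁻ x, u x ∂μ) ^ (1 / 2 : ℝ) * (∫⁻ x, v x ∂μ) ^ (1 / 2 : ℝ)) ^ 2 := by
        gcongr
        exact (lintegral_mono hle).trans hCS
    _ = _ := by
        rw [mul_pow, ← ENNReal.rpow_natCast, ← ENNReal.rpow_natCast]
        norm_num [hsqrt]

lemma tsum_sq_le_mul {ι : Type*} {h u v : ι → ℝ≥0∞} (hh : ∀ i, h i ^ 2 ≤ u i * v i) :
    (∑' i, h i) ^ 2 ≤ (∑' i, u i) * ∑' i, v i := by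
  let _ : MeasurableSpace ι := ⊤
  simpa only [lintegral_count] using lintegral_sq_le_mul (μ := Measure.count)
    (measurable_from_top (f := u)).aemeasurable (measurable_from_top (f := v)).aemeasurable hh

lemma jb_rpow_mul_le_of_jb_le {x z p r : ℝ} (q : ℝ) (hr : 0 ≤ r) (hr1 : r ≤ 1) (hrp : r ≤ p)
    (hzx : jb z ≤ jb x) :
    jb x ^ (-p) * jb z ^ (-q) ≤ 2 * jb (x + z) ^ (-r) * jb z ^ (-(p + q - r)) := by
  have hxz := jb_rpow_pos (x + z) (-r)
  have hz := jb_rpow_pos z (-q)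
  have hx := jb_rpow_pos x (-(p - r))
  have hsum : jb x ^ (-r) ≤ 2 * jb (x + z) ^ (-r) := by
    refine (rpow_neg_le_of_le_mul (jb_pos (x + z)) (jb_pos x) two_pos hr ?_).trans ?_
    · linarith [jb_add_le x z]
    · gcongr
      exact two_rpow_le_two hr1
  have hdiff : jb x ^ (-(p - r)) ≤ jb z ^ (-(p - r)) :=
    Real.rpow_le_rpow_of_nonpos (jb_pos z) hzx (by linarith)
  calc jb x ^ (-p) * jb z ^ (-q) = jb x ^ (-r) * jb x ^ (-(p - r)) * jb z ^ (-q) := by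
        rw [← Real.rpow_add (jb_pos _)]; ring_nf
    _ ≤ (2 * jb (x + z) ^ (-r)) * jb z ^ (-(p - r)) * jb z ^ (-q) := by gcongr
    _ = _ := by rw [mul_assoc, ← Real.rpow_add (jb_pos _)]; ring_nf

lemma jb_rpow_mul_le {p q r : ℝ} (x z : ℝ) (hr : 0 ≤ r) (hr1 : r ≤ 1) (hrp : r ≤ p)
    (hrq : r ≤ q) :
    jb x ^ (-p) * jb z ^ (-q) ≤
      2 * jb (x + z) ^ (-r) * (jb x ^ (-(p + q - r)) + jb z ^ (-(p + q - r))) := by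
  have hxz := jb_rpow_pos (x + z) (-r)
  have hx := jb_rpow_pos x (-(p + q - r))
  have hz := jb_rpow_pos z (-(p + q - r))
  rcases le_total (jb z) (jb x) with hzx | hxz'
  · refine (jb_rpow_mul_le_of_jb_le q hr hr1 hrp hzx).trans ?_
    gcongr
    linarith
  · rw [mul_comm, add_comm x z]
    refine (jb_rpow_mul_le_of_jb_le p hr hr1 hrq hxz').trans ?_
    rw [add_comm q p, add_comm z x]
    gcongr
    linarith

lemma lintegral_jb_mul_jb_le {p q r : ℝ} (ω ω' τ : ℝ) (hr : 0 ≤ r) (hr1 : r ≤ 1) (hrp : r ≤ p)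
    (hrq : r ≤ q) :
    ∫⁻ y : ℝ, ENNReal.ofReal (jb (y - ω) ^ (-p)) * ENNReal.ofReal (jb (-y + τ - ω') ^ (-q)) ≤
      4 * jbInt (p + q - r) * ENNReal.ofReal (jb (τ - (ω + ω')) ^ (-r)) := by
  have hle (y : ℝ) : ENNReal.ofReal (jb (y - ω) ^ (-p)) *
      ENNReal.ofReal (jb (-y + τ - ω') ^ (-q)) ≤
      ENNReal.ofReal (2 * jb (τ - (ω + ω')) ^ (-r)) *
        (ENNReal.ofReal (jb (y - ω) ^ (-(p + q - r))) +
          ENNReal.ofReal (jb (y - (τ - ω')) ^ (-(p + q - r)))) := by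
    have hpos (x r : ℝ) : 0 ≤ jb x ^ r := (jb_rpow_pos x r).le
    rw [← ENNReal.ofReal_mul (hpos _ _), ← ENNReal.ofReal_add (hpos _ _) (hpos _ _),
      ← ENNReal.ofReal_mul (mul_nonneg zero_le_two (hpos _ _))]
    refine ENNReal.ofReal_le_ofReal ?_
    rw [show τ - (ω + ω') = y - ω + (-y + τ - ω') by ring,
      show y - (τ - ω') = -(-y + τ - ω') by ring, jb_neg]
    exact jb_rpow_mul_le _ _ hr hr1 hrp hrq
  refine (lintegral_mono hle).trans (le_of_eq ?_)
  rw [lintegral_const_mul _ (by fun_prop), lintegral_add_left (by fun_prop),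
    lintegral_sub_right_eq_self (fun y => ENNReal.ofReal (jb y ^ (-(p + q - r)))),
    lintegral_sub_right_eq_self (fun y => ENNReal.ofReal (jb y ^ (-(p + q - r)))),
    ENNReal.ofReal_mul zero_le_two, ENNReal.ofReal_ofNat, ← two_mul]
  change _ * (2 * jbInt _) = _
  ring

/-- `f` is dominated by the square root of `⟨τ - ω⟩^{-γ}` times a function of integral at
most `A`. By Cauchy–Schwarz this class is stable under convolution. -/
def WeightBound (f : ℝ → ℝ≥0∞) (ω γ : ℝ) (A : ℝ≥0∞) : Prop :=
  ∃ P : ℝ → ℝ≥0∞, Measurable P ∧ ∫⁻ τ, P τ ≤ A ∧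
    ∀ τ, f τ ^ 2 ≤ ENNReal.ofReal (jb (τ - ω) ^ (-γ)) * P τ

lemma lintegral_lconvolution {f g : ℝ → ℝ≥0∞} (hf : Measurable f) (hg : Measurable g) :
    ∫⁻ τ, (f ⋆ₗ g) τ = (∫⁻ τ, f τ) * ∫⁻ τ, g τ := by
  have hshift (y : ℝ) : ∫⁻ τ, f y * g (-y + τ) = f y * ∫⁻ τ, g τ := by
    rw [lintegral_const_mul _ (by fun_prop), lintegral_add_left_eq_self g (-y)]
  simp only [lconvolution_def]
  rw [lintegral_lintegral_swap (by fun_prop)]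
  simp_rw [hshift]
  rw [lintegral_mul_const _ hf]

lemma WeightBound.lconvolution {f g : ℝ → ℝ≥0∞} {ω ω' p q r : ℝ} {A A' : ℝ≥0∞}
    (hf : WeightBound f ω p A) (hg : WeightBound g ω' q A') (hr : 0 ≤ r) (hr1 : r ≤ 1)
    (hrp : r ≤ p) (hrq : r ≤ q) :
    WeightBound (f ⋆ₗ g) (ω + ω') r (4 * jbInt (p + q - r) * (A * A')) := by
  obtain ⟨P, hPm, hPA, hP⟩ := hf
  obtain ⟨Q, hQm, hQA, hQ⟩ := hg
  refine ⟨fun τ => 4 * jbInt (p + q - r) * (P ⋆ₗ Q) τ, by fun_prop, ?_, fun τ => ?_⟩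
  · rw [lintegral_const_mul _ (by fun_prop), lintegral_lconvolution hPm hQm]
    gcongr
  · have hsq (y : ℝ) : (f y * g (-y + τ)) ^ 2 ≤ ENNReal.ofReal (jb (y - ω) ^ (-p)) *
        ENNReal.ofReal (jb (-y + τ - ω') ^ (-q)) * (P y * Q (-y + τ)) := by
      rw [mul_pow, mul_mul_mul_comm]
      exact mul_le_mul' (hP y) (hQ (-y + τ))
    calc (f ⋆ₗ g) τ ^ 2
        ≤ (∫⁻ y, ENNReal.ofReal (jb (y - ω) ^ (-p)) * ENNReal.ofReal (jb (-y + τ - ω') ^ (-q))) *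
          (P ⋆ₗ Q) τ := lintegral_sq_le_mul (by fun_prop) (by fun_prop) hsq
      _ ≤ (4 * jbInt (p + q - r) * ENNReal.ofReal (jb (τ - (ω + ω')) ^ (-r))) *
          (P ⋆ₗ Q) τ := by
          gcongr
          exact lintegral_jb_mul_jb_le ω ω' τ hr hr1 hrp hrq
      _ = _ := by ring

lemma weightBound_of_measurable {f : ℝ → ℝ≥0∞} (hf : Measurable f) (ω b : ℝ) :
    WeightBound f ω (2 * b)
      (∫⁻ τ, (ENNReal.ofReal (jb (τ - ω) ^ b) * f τ) ^ 2) := by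
  refine ⟨_, by fun_prop, le_rfl, fun τ => le_of_eq ?_⟩
  rw [mul_pow, ← mul_assoc, ← ENNReal.ofReal_pow (jb_rpow_pos _ _).le,
    ← ENNReal.ofReal_mul (jb_rpow_pos _ _).le, ← Real.rpow_mul_natCast (jb_pos _).le,
    ← Real.rpow_add (jb_pos _), Nat.cast_ofNat, mul_comm b, neg_add_cancel, Real.rpow_zero,
    ENNReal.ofReal_one, one_mul]

/-- The convolution of five functions. -/
def conv5 (f : Fin 5 → ℝ → ℝ≥0∞) : ℝ → ℝ≥0∞ :=
  (((f 0 ⋆ₗ f 1) ⋆ₗ f 2) ⋆ₗ f 3) ⋆ₗ f 4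

lemma lconvolution_mono {f f' g g' : ℝ → ℝ≥0∞} (hf : ∀ τ, f τ ≤ f' τ) (hg : ∀ τ, g τ ≤ g' τ)
    (τ : ℝ) : (f ⋆ₗ g) τ ≤ (f' ⋆ₗ g') τ :=
  lintegral_mono fun _ => mul_le_mul' (hf _) (hg _)

lemma measurable_conv5 {f : Fin 5 → ℝ → ℝ≥0∞} (hf : ∀ i, Measurable (f i)) :
    Measurable (conv5 f) := by
  unfold conv5
  fun_prop

lemma WeightBound.conv3 {f g h : ℝ → ℝ≥0∞} {ω₁ ω₂ ω₃ ε : ℝ} {A₁ A₂ A₃ : ℝ≥0∞} (hε : 0 ≤ ε)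
    (hε' : 5 * ε ≤ 1) (hf : WeightBound f ω₁ (1 - ε) A₁) (hg : WeightBound g ω₂ (1 - ε) A₂)
    (hh : WeightBound h ω₃ (1 - ε) A₃) :
    WeightBound ((f ⋆ₗ g) ⋆ₗ h) (ω₁ + ω₂ + ω₃) (1 - 5 * ε)
      ((4 * jbInt (1 + ε)) ^ 2 * (A₁ * A₂ * A₃)) := by
  have hfg := hf.lconvolution hg (r := 1 - 3 * ε) (by linarith) (by linarith) (by linarith)
    (by linarith)
  have hfgh := hfg.lconvolution hh (r := 1 - 5 * ε) (by linarith) (by linarith) (by linarith)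
    (by linarith)
  convert hfgh using 1
  ring_nf

lemma WeightBound.conv5 {f : Fin 5 → ℝ → ℝ≥0∞} {ω : Fin 5 → ℝ} {A : Fin 5 → ℝ≥0∞} {ε : ℝ}
    (hε : 0 ≤ ε) (hε' : 9 * ε ≤ 1) (hf : ∀ i, WeightBound (f i) (ω i) (1 - ε) (A i)) :
    WeightBound (conv5 f) (∑ i, ω i) (1 - 9 * ε) ((4 * jbInt (1 + ε)) ^ 4 * ∏ i, A i) := by
  have hconv3 := (hf 0).conv3 hε (by linarith) (hf 1) (hf 2)
  have hconv4 := hconv3.lconvolution (hf 3) (r := 1 - 7 * ε) (by linarith) (by linarith)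
    (by linarith) (by linarith)
  have hconv5 := hconv4.lconvolution (hf 4) (r := 1 - 9 * ε) (by linarith) (by linarith)
    (by linarith) (by linarith)
  rw [Fin.sum_univ_five, Fin.prod_univ_five, FracNLS.conv5]
  convert hconv5 using 1
  ring_nf

section Tempered

open Filter Topology
open scoped FourierTransform SchwartzMap Convolution ContDiff

/-! ### Fourier transforms of functions acting on Schwartz functions -/

/-- `F` is the Fourier transform of `v` in the sense of tempered distributions, in the
normalization `𝓕 φ ξ = ∫ φ x e^{-2πixξ} dx`. -/
structure TemperedPair (v F : ℝ → ℂ) : Prop where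
  integrable_left : ∀ φ : 𝓢(ℝ, ℂ), Integrable (fun t => v t * φ t)
  integrable_right : ∀ φ : 𝓢(ℝ, ℂ), Integrable (fun τ => F τ * φ τ)
  integral_eq : ∀ φ : 𝓢(ℝ, ℂ), ∫ τ, F τ * φ τ = ∫ t, v t * 𝓕 φ t

lemma exists_schwartz_eq_ofReal {g : ℝ → ℝ} (hg : ContDiff ℝ ∞ g) (hg' : HasCompactSupport g) :
    ∃ φ : 𝓢(ℝ, ℂ), ∀ t, φ t = g t := by
  have hcompact : HasCompactSupport (fun t => (g t : ℂ)) :=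
    hg'.comp_left (g := fun x : ℝ => (x : ℂ)) Complex.ofReal_zero
  exact ⟨hcompact.toSchwartzMap (Complex.ofRealCLM.contDiff.comp hg), fun _ => rfl⟩

lemma exists_schwartz_eq_one (R : ℝ) : ∃ φ : 𝓢(ℝ, ℂ), ∀ t : ℝ, |t| ≤ R → φ t = 1 := by
  let f : ContDiffBump (0 : ℝ) := ⟨|R| + 1, |R| + 2, by positivity, by linarith⟩
  obtain ⟨φ, hφ⟩ := exists_schwartz_eq_ofReal f.contDiff f.hasCompactSupport
  refine ⟨φ, fun t ht => ?_⟩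
  have hmem : t ∈ Metric.closedBall (0 : ℝ) (|R| + 1) := by
    rw [mem_closedBall_zero_iff, Real.norm_eq_abs]
    linarith [le_abs_self R]
  rw [hφ, f.one_of_mem_closedBall hmem, Complex.ofReal_one]

lemma locallyIntegrable_of_forall_schwartz {v : ℝ → ℂ}
    (hv : ∀ φ : 𝓢(ℝ, ℂ), Integrable (fun t => v t * φ t)) : LocallyIntegrable v := by
  refine locallyIntegrable_iff.2 fun K hK => ?_
  obtain ⟨R, hR⟩ := hK.isBounded.subset_closedBall (0 : ℝ)
  obtain ⟨φ, hφ⟩ := exists_schwartz_eq_one R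
  refine ((hv φ).integrableOn (s := K)).congr_fun (fun t ht => ?_) hK.measurableSet
  have htR : |t| ≤ R := by simpa using hR ht
  simp only [hφ t htR, mul_one]

lemma TemperedPair.aestronglyMeasurable_left {v F : ℝ → ℂ} (h : TemperedPair v F) :
    AEStronglyMeasurable v :=
  (locallyIntegrable_of_forall_schwartz h.integrable_left).aestronglyMeasurable

lemma TemperedPair.aestronglyMeasurable_right {v F : ℝ → ℂ} (h : TemperedPair v F) :
    AEStronglyMeasurable F :=
  (locallyIntegrable_of_forall_schwartz h.integrable_right).aestronglyMeasurable

lemma ae_eq_of_forall_schwartz {v w : ℝ → ℂ}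
    (hv : ∀ φ : 𝓢(ℝ, ℂ), Integrable (fun t => v t * φ t))
    (hw : ∀ φ : 𝓢(ℝ, ℂ), Integrable (fun t => w t * φ t))
    (h : ∀ φ : 𝓢(ℝ, ℂ), ∫ t, v t * φ t = ∫ t, w t * φ t) : v =ᵐ[volume] w := by
  refine ae_eq_of_integral_contDiff_smul_eq (locallyIntegrable_of_forall_schwartz hv)
    (locallyIntegrable_of_forall_schwartz hw) fun g hg hg' => ?_
  obtain ⟨φ, hφ⟩ := exists_schwartz_eq_ofReal hg hg'
  simpa only [hφ, mul_comm, Complex.real_smul] using h φ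

lemma TemperedPair.congr_right {v F G : ℝ → ℂ} (h : TemperedPair v F) (hFG : F =ᵐ[volume] G) :
    TemperedPair v G := by
  have hmul (φ : 𝓢(ℝ, ℂ)) : (fun τ => F τ * φ τ) =ᵐ[volume] fun τ => G τ * φ τ :=
    hFG.mul EventuallyEq.rfl
  refine ⟨h.integrable_left, fun φ => (h.integrable_right φ).congr (hmul φ), fun φ => ?_⟩
  rw [← integral_congr_ae (hmul φ), h.integral_eq]

lemma TemperedPair.sub {v w F G : ℝ → ℂ} (h : TemperedPair v F) (h' : TemperedPair w G) :
    TemperedPair (fun t => v t - w t) (fun τ => F τ - G τ) := by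
  refine ⟨fun φ => ?_, fun φ => ?_, fun φ => ?_⟩
  · simpa only [sub_mul, Pi.sub_def] using (h.integrable_left φ).sub (h'.integrable_left φ)
  · simpa only [sub_mul, Pi.sub_def] using (h.integrable_right φ).sub (h'.integrable_right φ)
  · simp only [sub_mul]
    rw [integral_sub (h.integrable_right φ) (h'.integrable_right φ),
      integral_sub (h.integrable_left (𝓕 φ)) (h'.integrable_left (𝓕 φ)), h.integral_eq,
      h'.integral_eq]

lemma norm_fourierInv_le (F : ℝ → ℂ) (t : ℝ) : ‖𝓕⁻ F t‖ ≤ ∫ τ, ‖F τ‖ :=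
  VectorFourier.norm_fourierIntegral_le_integral_norm _ _ _ _ _

lemma continuous_fourierInv_of_integrable {F : ℝ → ℂ} (hF : Integrable F) : Continuous (𝓕⁻ F) :=
  VectorFourier.fourierIntegral_continuous Real.continuous_fourierChar
    (by exact continuous_inner.neg) hF

lemma integral_mul_fourierInv_eq {F G : ℝ → ℂ} (hF : Integrable F) (hG : Integrable G) :
    ∫ τ, F τ * 𝓕⁻ G τ = ∫ t, 𝓕⁻ F t * G t := by
  have hflip : (-innerₗ ℝ : ℝ →ₗ[ℝ] ℝ →ₗ[ℝ] ℝ).flip = -innerₗ ℝ := by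
    ext; simp
  have h := VectorFourier.integral_fourierIntegral_smul_eq_flip (L := -innerₗ ℝ)
    Real.continuous_fourierChar (by exact continuous_inner.neg) hF hG
  rw [hflip] at h
  exact h.symm

lemma temperedPair_of_integrable {F : ℝ → ℂ} (hF : Integrable F) : TemperedPair (𝓕⁻ F) F := by
  refine ⟨fun φ => ?_, fun φ => ?_, fun φ => ?_⟩
  · exact φ.integrable.bdd_mul (continuous_fourierInv_of_integrable hF).aestronglyMeasurable
      (Eventually.of_forall (norm_fourierInv_le F))
  · obtain ⟨C, -, hC⟩ := φ.decay 0 0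
    exact hF.mul_bdd φ.continuous.aestronglyMeasurable
      (Eventually.of_forall fun τ => by simpa using hC τ)
  · rw [← integral_mul_fourierInv_eq hF (𝓕 φ).integrable, ← SchwartzMap.fourierInv_coe,
      FourierTransform.fourierInv_fourier_eq]

lemma TemperedPair.ae_eq_fourierInv_toLp {v F : ℝ → ℂ} (h : TemperedPair v F) (hF : MemLp F 2) :
    v =ᵐ[volume] (𝓕⁻ (hF.toLp F) : Lp ℂ 2 (volume : Measure ℝ)) := by
  refine ae_eq_of_forall_schwartz h.integrable_left
    (fun φ => (Lp.memLp _).integrable_mul (φ.memLp 2 volume)) fun ψ => ?_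
  have hdist := congrArg (fun T : 𝓢'(ℝ, ℂ) => T ψ)
    (Lp.fourierInv_toTemperedDistribution_eq (hF.toLp F))
  simp only [TemperedDistribution.fourierInv_apply, Lp.toTemperedDistribution_apply,
    smul_eq_mul] at hdist
  calc ∫ t, v t * ψ t = ∫ t, v t * 𝓕 (𝓕⁻ ψ) t := by
        rw [FourierTransform.fourier_fourierInv_eq]
    _ = ∫ τ, F τ * (𝓕⁻ ψ) τ := (h.integral_eq (𝓕⁻ ψ)).symm
    _ = ∫ τ, (𝓕⁻ ψ) τ * hF.toLp F τ := by
        refine integral_congr_ae ?_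
        filter_upwards [hF.coeFn_toLp] with τ hτ
        rw [hτ, mul_comm]
    _ = ∫ t, ψ t * (𝓕⁻ (hF.toLp F) : Lp ℂ 2 (volume : Measure ℝ)) t := hdist
    _ = _ := by simp_rw [mul_comm]

lemma TemperedPair.eLpNorm_eq {v F : ℝ → ℂ} (h : TemperedPair v F) (hF : MemLp F 2) :
    eLpNorm v 2 = eLpNorm F 2 := by
  have hnorm : ‖(𝓕⁻ (hF.toLp F) : Lp ℂ 2 (volume : Measure ℝ))‖ₑ = ‖hF.toLp F‖ₑ :=
    congrArg ENNReal.ofNNReal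
      (NNReal.eq ((Lp.fourierTransformₗᵢ ℝ ℂ).symm.norm_map (hF.toLp F)))
  rw [eLpNorm_congr_ae (h.ae_eq_fourierInv_toLp hF), ← Lp.enorm_def, hnorm, Lp.enorm_def,
    eLpNorm_congr_ae hF.coeFn_toLp]

lemma lintegral_enorm_pow_eq (v : ℝ → ℂ) (n : ℕ) [n.AtLeastTwo] :
    ∫⁻ t, ‖v t‖ₑ ^ (OfNat.ofNat n : ℕ) = eLpNorm v (OfNat.ofNat n) ^ (OfNat.ofNat n : ℕ) := by
  simpa using (eLpNorm_nnreal_pow_eq_lintegral (μ := (volume : Measure ℝ)) (f := v)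
    (p := OfNat.ofNat n) (NeZero.ne _)).symm

lemma memLp_two_of_lintegral_lt_top {F : ℝ → ℂ} (hF : AEStronglyMeasurable F)
    (h : ∫⁻ τ, ‖F τ‖ₑ ^ 2 < (∞ : ℝ≥0∞)) : MemLp F 2 := by
  rw [lintegral_enorm_pow_eq F 2] at h
  exact ⟨hF, (ENNReal.pow_lt_top_iff (n := 2)).1 h |>.resolve_right two_ne_zero⟩

/-- Complex convolution on the line. -/
def cconv (F G : ℝ → ℂ) : ℝ → ℂ := F ⋆[ContinuousLinearMap.mul ℂ ℂ] G

lemma integrable_cconv {F G : ℝ → ℂ} (hF : Integrable F) (hG : Integrable G) :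
    Integrable (cconv F G) := hF.integrable_convolution _ hG

lemma fourierInv_cconv {F G : ℝ → ℂ} (hF : Integrable F) (hG : Integrable G) (t : ℝ) :
    𝓕⁻ (cconv F G) t = 𝓕⁻ F t * 𝓕⁻ G t := by
  simp only [Real.fourierInv_eq_fourier_neg]
  exact Real.fourier_mul_convolution_eq hF hG (-t)

lemma enorm_cconv_le (F G : ℝ → ℂ) (τ : ℝ) :
    ‖cconv F G τ‖ₑ ≤ ((fun τ => ‖F τ‖ₑ) ⋆ₗ (fun τ => ‖G τ‖ₑ)) τ := by
  refine (enorm_integral_le_lintegral_enorm _).trans (le_of_eq ?_)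
  rw [lconvolution_def]
  refine lintegral_congr fun y => ?_
  simp only [ContinuousLinearMap.mul_apply', enorm_mul]
  rw [sub_eq_neg_add]

end Tempered

section Strichartz

open Filter Topology
open scoped FourierTransform SchwartzMap

/-! ### The `L⁶` bound in time -/

/-- The squared norm of `⟨τ - ω⟩^b F` in `L²`. -/
def wNorm (b ω : ℝ) (F : ℝ → ℂ) : ℝ≥0∞ :=
  ∫⁻ τ, (ENNReal.ofReal (jb (τ - ω) ^ b) * ‖F τ‖ₑ) ^ 2

/-- The constant in the `L⁶` bound. -/
def sixConst (b : ℝ) : ℝ≥0∞ := (4 * jbInt (1 + (1 - 2 * b))) ^ 2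

lemma sixConst_lt_top {b : ℝ} (hb : b < 1 / 2) : sixConst b < ∞ :=
  ENNReal.pow_lt_top (ENNReal.mul_lt_top (by norm_num) (jbInt_lt_top (by linarith)))

lemma one_le_jb_rpow (x : ℝ) {b : ℝ} (hb : 0 ≤ b) : 1 ≤ ENNReal.ofReal (jb x ^ b) :=
  ENNReal.one_le_ofReal.2 (Real.one_le_rpow (one_le_jb x) hb)

lemma lintegral_enorm_sq_le_wNorm {b : ℝ} (hb : 0 ≤ b) (ω : ℝ) (F : ℝ → ℂ) :
    ∫⁻ τ, ‖F τ‖ₑ ^ 2 ≤ wNorm b ω F := by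
  refine lintegral_mono fun τ => ?_
  gcongr
  exact le_mul_of_one_le_left' (one_le_jb_rpow _ hb)

lemma wNorm_mono {b ω : ℝ} {F G : ℝ → ℂ} (h : ∀ τ, ‖F τ‖ₑ ≤ ‖G τ‖ₑ) :
    wNorm b ω F ≤ wNorm b ω G := by
  refine lintegral_mono fun τ => ?_
  gcongr
  exact h τ

lemma memLp_two_of_wNorm_lt_top {F : ℝ → ℂ} (hF : AEStronglyMeasurable F) {b ω : ℝ} (hb : 0 ≤ b)
    (hA : wNorm b ω F < ∞) : MemLp F 2 :=
  memLp_two_of_lintegral_lt_top hF ((lintegral_enorm_sq_le_wNorm hb ω F).trans_lt hA)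

lemma weightBound_enorm {F : ℝ → ℂ} (hF : Measurable F) (b ω : ℝ) :
    WeightBound (fun τ => ‖F τ‖ₑ) ω (1 - (1 - 2 * b)) (wNorm b ω F) := by
  rw [sub_sub_cancel]
  exact weightBound_of_measurable hF.enorm ω b

lemma lintegral_enorm_cconv_cconv_sq_le {F : ℝ → ℂ} (hF : Measurable F) {b : ℝ} (ω : ℝ)
    (hb : 2 / 5 ≤ b) (hb' : b < 1 / 2) :
    ∫⁻ τ, ‖cconv (cconv F F) F τ‖ₑ ^ 2 ≤ sixConst b * wNorm b ω F ^ 3 := by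
  have hF' := weightBound_enorm hF b ω
  obtain ⟨P, -, hPA, hP⟩ := hF'.conv3 (by linarith) (by linarith) hF' hF'
  have hweight (τ : ℝ) : ENNReal.ofReal (jb (τ - (ω + ω + ω)) ^ (-(1 - 5 * (1 - 2 * b)))) ≤ 1 :=
    ENNReal.ofReal_le_one.2 (Real.rpow_le_one_of_one_le_of_nonpos (one_le_jb _) (by linarith))
  calc ∫⁻ τ, ‖cconv (cconv F F) F τ‖ₑ ^ 2 ≤ ∫⁻ τ, P τ := lintegral_mono fun τ => by
        refine (pow_le_pow_left' ((enorm_cconv_le _ _ τ).trans (lconvolution_mono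
          (fun τ => enorm_cconv_le F F τ) (fun _ => le_rfl) τ)) 2).trans ?_
        exact (hP τ).trans (mul_le_of_le_one_left' (hweight τ))
    _ ≤ sixConst b * wNorm b ω F ^ 3 := hPA.trans (le_of_eq (by rw [sixConst]; ring))

-- The sixth power of the `L⁶` norm of `𝓕⁻ F` is the square of the `L²` norm of its cube, and the
-- cube has Fourier transform `F ⋆ F ⋆ F`.
lemma eLpNorm_fourierInv_pow_six_le {F : ℝ → ℂ} (hFm : Measurable F) (hF : Integrable F)
    {b ω : ℝ} (hb : 2 / 5 ≤ b) (hb' : b < 1 / 2) (hA : wNorm b ω F < ∞) :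
    eLpNorm (𝓕⁻ F) 6 ^ 6 ≤ sixConst b * wNorm b ω F ^ 3 := by
  obtain ⟨H, hH⟩ : ∃ H, H = cconv (cconv F F) F := ⟨_, rfl⟩
  have hFF : Integrable (cconv F F) := integrable_cconv hF hF
  have hHi : Integrable H := hH ▸ integrable_cconv hFF hF
  have hbound : ∫⁻ τ, ‖H τ‖ₑ ^ 2 ≤ _ := hH ▸ lintegral_enorm_cconv_cconv_sq_le hFm ω hb hb'
  have hH2 : MemLp H 2 := memLp_two_of_lintegral_lt_top hHi.aestronglyMeasurable
    (hbound.trans_lt (ENNReal.mul_lt_top (sixConst_lt_top hb') (ENNReal.pow_lt_top hA)))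
  have hcube (t : ℝ) : ‖𝓕⁻ F t‖ₑ ^ 6 = ‖𝓕⁻ H t‖ₑ ^ 2 := by
    rw [hH, fourierInv_cconv hFF hF, fourierInv_cconv hF hF, enorm_mul, enorm_mul]
    ring
  rw [← lintegral_enorm_pow_eq, lintegral_congr hcube, lintegral_enorm_pow_eq,
    (temperedPair_of_integrable hHi).eLpNorm_eq hH2, ← lintegral_enorm_pow_eq]
  exact hbound

/-- Truncation to `|τ| ≤ n`. -/
def trunc (F : ℝ → ℂ) (n : ℕ) : ℝ → ℂ := (Metric.closedBall (0 : ℝ) n).indicator F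

lemma measurable_trunc {F : ℝ → ℂ} (hF : Measurable F) (n : ℕ) : Measurable (trunc F n) :=
  hF.indicator Metric.isClosed_closedBall.measurableSet

lemma TemperedPair.integrable_trunc {v F : ℝ → ℂ} (h : TemperedPair v F) (n : ℕ) :
    Integrable (trunc F n) :=
  (integrable_indicator_iff Metric.isClosed_closedBall.measurableSet).2
    ((locallyIntegrable_of_forall_schwartz h.integrable_right).integrableOn_isCompact
      (isCompact_closedBall _ _))

lemma enorm_trunc_le (F : ℝ → ℂ) (n : ℕ) (τ : ℝ) : ‖trunc F n τ‖ₑ ≤ ‖F τ‖ₑ :=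
  enorm_indicator_le_enorm_self _ _

lemma enorm_sub_trunc_le (F : ℝ → ℂ) (n : ℕ) (τ : ℝ) : ‖F τ - trunc F n τ‖ₑ ≤ ‖F τ‖ₑ := by
  unfold trunc
  by_cases h : τ ∈ Metric.closedBall (0 : ℝ) n <;> simp [h]

lemma eventually_trunc_eq (F : ℝ → ℂ) (τ : ℝ) : ∀ᶠ n in atTop, trunc F n τ = F τ := by
  obtain ⟨N, hN⟩ := exists_nat_ge |τ|
  filter_upwards [eventually_ge_atTop N] with n hn
  refine Set.indicator_of_mem (mem_closedBall_zero_iff.2 ?_) F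
  exact hN.trans (Nat.cast_le.2 hn)

lemma tendsto_wNorm_sub_trunc {F : ℝ → ℂ} (hF : Measurable F) {b ω : ℝ}
    (hA : wNorm b ω F < ∞) :
    Tendsto (fun n => wNorm b ω (fun τ => F τ - trunc F n τ)) atTop (𝓝 0) := by
  rw [← lintegral_zero (μ := (volume : Measure ℝ))]
  refine tendsto_lintegral_of_dominated_convergence
    (fun τ => (ENNReal.ofReal (jb (τ - ω) ^ b) * ‖F τ‖ₑ) ^ 2) (fun n => ?_)
    (fun n => Eventually.of_forall fun τ => ?_) hA.ne (Eventually.of_forall fun τ => ?_)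
  · have := measurable_trunc hF n
    fun_prop
  · dsimp only
    gcongr
    exact enorm_sub_trunc_le F n τ
  · refine tendsto_const_nhds.congr' ?_
    filter_upwards [eventually_trunc_eq F τ] with n hn
    simp [hn]

lemma TemperedPair.sub_trunc {v F : ℝ → ℂ} (h : TemperedPair v F) (n : ℕ) :
    TemperedPair (fun t => v t - 𝓕⁻ (trunc F n) t) (fun τ => F τ - trunc F n τ) :=
  h.sub (temperedPair_of_integrable (h.integrable_trunc n))

lemma TemperedPair.tendsto_eLpNorm_two_fourierInv_trunc_sub {v F : ℝ → ℂ} (h : TemperedPair v F)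
    (hF : Measurable F) {b ω : ℝ} (hb : 0 ≤ b) (hA : wNorm b ω F < ∞) :
    Tendsto (fun n => eLpNorm (𝓕⁻ (trunc F n) - v) 2) atTop (𝓝 0) := by
  have hsq (n : ℕ) : eLpNorm (𝓕⁻ (trunc F n) - v) 2 ^ 2 ≤
      wNorm b ω (fun τ => F τ - trunc F n τ) := by
    have hmem : MemLp (fun τ => F τ - trunc F n τ) 2 :=
      memLp_two_of_wNorm_lt_top (hF.sub (measurable_trunc hF n)).aestronglyMeasurable hb
        ((wNorm_mono (enorm_sub_trunc_le F n)).trans_lt hA)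
    have hnorm : eLpNorm (v - 𝓕⁻ (trunc F n)) 2 = eLpNorm (fun τ => F τ - trunc F n τ) 2 :=
      (h.sub_trunc n).eLpNorm_eq hmem
    rw [eLpNorm_sub_comm, hnorm]
    exact (lintegral_enorm_pow_eq _ 2).symm.le.trans
      (lintegral_enorm_sq_le_wNorm hb ω _)
  have hsq_tendsto : Tendsto (fun n => eLpNorm (𝓕⁻ (trunc F n) - v) 2 ^ 2) atTop (𝓝 0) :=
    tendsto_of_tendsto_of_tendsto_of_le_of_le tendsto_const_nhds
      (tendsto_wNorm_sub_trunc hF hA) (fun _ => zero_le) hsq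
  have hroot := ((ENNReal.continuous_rpow_const (y := (1 / 2 : ℝ))).tendsto 0).comp hsq_tendsto
  rw [ENNReal.zero_rpow_of_pos one_half_pos] at hroot
  refine hroot.congr fun n => ?_
  rw [Function.comp_apply, ← ENNReal.rpow_natCast, ← ENNReal.rpow_mul]
  norm_num

lemma TemperedPair.eLpNorm_pow_six_le {v F : ℝ → ℂ} (h : TemperedPair v F) (hF : Measurable F)
    {b ω : ℝ} (hb : 2 / 5 ≤ b) (hb' : b < 1 / 2) (hA : wNorm b ω F < ∞) :
    eLpNorm v 6 ^ 6 ≤ sixConst b * wNorm b ω F ^ 3 := by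
  have hmeas (n : ℕ) : AEStronglyMeasurable (𝓕⁻ (trunc F n)) :=
    (continuous_fourierInv_of_integrable (h.integrable_trunc n)).aestronglyMeasurable
  obtain ⟨ns, -, hns⟩ := (tendstoInMeasure_of_tendsto_eLpNorm two_ne_zero hmeas
    h.aestronglyMeasurable_left
    (h.tendsto_eLpNorm_two_fourierInv_trunc_sub hF (by linarith) hA)).exists_seq_tendsto_ae
  have hbound (n : ℕ) :
      eLpNorm (𝓕⁻ (trunc F n)) 6 ≤ (sixConst b * wNorm b ω F ^ 3) ^ (6⁻¹ : ℝ) := by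
    have hle := wNorm_mono (b := b) (ω := ω) (enorm_trunc_le F n)
    rw [ENNReal.le_rpow_inv_iff (by norm_num), ENNReal.rpow_ofNat]
    refine (eLpNorm_fourierInv_pow_six_le (measurable_trunc hF n) (h.integrable_trunc n)
      hb hb' (hle.trans_lt hA)).trans ?_
    gcongr
  have hv : eLpNorm v 6 ≤ (sixConst b * wNorm b ω F ^ 3) ^ (6⁻¹ : ℝ) :=
    (Lp.eLpNorm_lim_le_liminf_eLpNorm (fun n => hmeas (ns n)) v hns).trans
      (liminf_le_of_le (by isBoundedDefault) fun _ hc =>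
        hc.exists.choose_spec.trans (hbound _))
  rwa [ENNReal.le_rpow_inv_iff (by norm_num), ENNReal.rpow_ofNat] at hv

lemma TemperedPair.memLp_six {v F : ℝ → ℂ} (h : TemperedPair v F) (hF : Measurable F)
    {b ω : ℝ} (hb : 2 / 5 ≤ b) (hb' : b < 1 / 2) (hA : wNorm b ω F < ∞) : MemLp v 6 := by
  refine ⟨h.aestronglyMeasurable_left, ?_⟩
  have hlt := (h.eLpNorm_pow_six_le hF hb hb' hA).trans_lt
    (ENNReal.mul_lt_top (sixConst_lt_top hb') (ENNReal.pow_lt_top hA))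
  exact (ENNReal.pow_lt_top_iff (n := 6)).1 hlt |>.resolve_right (by norm_num)

/-- `v` is a limit in `L⁶` of functions whose Fourier transforms are integrable and dominated
by `E`. -/
structure SixApprox (v : ℝ → ℂ) (E : ℝ → ℝ≥0∞) : Prop where
  memLp : MemLp v 6
  approx : ∀ δ : ℝ≥0∞, δ ≠ 0 → ∃ H : ℝ → ℂ, Integrable H ∧ (∀ τ, ‖H τ‖ₑ ≤ E τ) ∧
    MemLp (𝓕⁻ H) 6 ∧ eLpNorm (fun t => v t - 𝓕⁻ H t) 6 ≤ δ

lemma TemperedPair.sixApprox {v F : ℝ → ℂ} (h : TemperedPair v F) (hF : Measurable F)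
    {b ω : ℝ} (hb : 2 / 5 ≤ b) (hb' : b < 1 / 2) (hA : wNorm b ω F < ∞) :
    SixApprox v (fun τ => ‖F τ‖ₑ) := by
  refine ⟨h.memLp_six hF hb hb' hA, fun δ hδ => ?_⟩
  have htail : Tendsto (fun n => sixConst b * wNorm b ω (fun τ => F τ - trunc F n τ) ^ 3)
      atTop (𝓝 0) := by
    simpa using ENNReal.Tendsto.const_mul (a := sixConst b)
      (((ENNReal.continuous_pow 3).tendsto 0).comp (tendsto_wNorm_sub_trunc hF hA))
      (Or.inr (sixConst_lt_top hb').ne)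
  have hδ6 : 0 < δ ^ 6 := by positivity
  obtain ⟨n, hn⟩ := (htail.eventually_lt_const hδ6).exists
  refine ⟨trunc F n, h.integrable_trunc n, enorm_trunc_le F n, ?_, ?_⟩
  · exact (temperedPair_of_integrable (h.integrable_trunc n)).memLp_six (measurable_trunc hF n)
      hb hb' ((wNorm_mono (enorm_trunc_le F n)).trans_lt hA)
  · have hle := (h.sub_trunc n).eLpNorm_pow_six_le (hF.sub (measurable_trunc hF n)) hb hb'
      ((wNorm_mono (enorm_sub_trunc_le F n)).trans_lt hA)
    exact (ENNReal.pow_le_pow_left_iff (by norm_num)).1 (hle.trans hn.le)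

lemma fourierInv_star_comp_neg (H : ℝ → ℂ) :
    𝓕⁻ (fun τ => star (H (-τ))) = fun t => star (𝓕⁻ H t) := by
  ext t
  rw [Real.fourierInv_eq', Real.fourierInv_eq',
    ← integral_neg_eq_self (fun τ => Complex.exp (↑(2 * Real.pi * inner ℝ τ t) * Complex.I) •
      star (H (-τ))), ← starRingEnd_apply, ← integral_conj]
  refine integral_congr_ae (Eventually.of_forall fun τ => ?_)
  simp [← Complex.exp_conj, Complex.conj_ofNat]

lemma SixApprox.conj {v : ℝ → ℂ} {E : ℝ → ℝ≥0∞} (h : SixApprox v E) :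
    SixApprox (fun t => star (v t)) (fun τ => E (-τ)) := by
  refine ⟨h.memLp.star, fun δ hδ => ?_⟩
  obtain ⟨H, hH, hHE, hH6, hHδ⟩ := h.approx δ hδ
  refine ⟨fun τ => star (H (-τ)),
    Complex.conjCLE.toContinuousLinearMap.integrable_comp hH.comp_neg,
    fun τ => by simpa using hHE (-τ), ?_, ?_⟩
  · rw [fourierInv_star_comp_neg]
    exact hH6.star
  · rw [fourierInv_star_comp_neg]
    refine (eLpNorm_congr_norm_ae (Eventually.of_forall fun t => ?_)).trans_le hHδ
    rw [← star_sub, norm_star]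

end Strichartz

section Multilinear

open Filter Topology
open scoped FourierTransform SchwartzMap

/-! ### Products of five functions tested against Schwartz functions -/

lemma lintegral_prod_mul_le {f : Fin 5 → ℝ → ℂ} {ψ : ℝ → ℂ}
    (hf : ∀ i, AEStronglyMeasurable (f i)) (hψ : AEStronglyMeasurable ψ) :
    ∫⁻ t, ‖(∏ i, f i t) * ψ t‖ₑ ≤ (∏ i, eLpNorm (f i) 6) * eLpNorm ψ 6 := by
  let g : Option (Fin 5) → ℝ → ℂ := fun o => o.elim ψ f
  have hg : ∀ o, AEStronglyMeasurable (g o) := by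
    rintro (_ | i)
    · exact hψ
    · exact hf i
  have hHolder := ENNReal.lintegral_prod_norm_pow_le (μ := (volume : Measure ℝ)) Finset.univ
    (f := fun o t => ‖g o t‖ₑ ^ 6) (fun o _ => (hg o).enorm.pow_const 6)
    (p := fun _ => (6⁻¹ : ℝ)) (by simp) (fun _ _ => by norm_num)
  have hroot (x : ℝ≥0∞) : (x ^ 6) ^ (6⁻¹ : ℝ) = x := by
    rw [← ENNReal.rpow_ofNat, ← ENNReal.rpow_mul]
    norm_num
  simp only [hroot, lintegral_enorm_pow_eq, Fintype.prod_option, g, Option.elim] at hHolder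
  rw [mul_comm]
  refine le_trans (le_of_eq (lintegral_congr fun t => ?_)) hHolder
  rw [mul_comm, enorm_mul]
  congr 1
  simp [enorm_eq_nnnorm, nnnorm_prod]

lemma integrable_prod_mul {f : Fin 5 → ℝ → ℂ} {ψ : ℝ → ℂ} (hf : ∀ i, MemLp (f i) 6)
    (hψ : MemLp ψ 6) : Integrable (fun t => (∏ i, f i t) * ψ t) :=
  ⟨(Finset.aestronglyMeasurable_fun_prod _ fun i _ => (hf i).1).mul hψ.1,
    (lintegral_prod_mul_le (fun i => (hf i).1) hψ.1).trans_lt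
      (ENNReal.mul_lt_top (ENNReal.prod_lt_top fun i _ => (hf i).2) hψ.2)⟩

lemma enorm_integral_prod_fourierInv_mul_le {H : Fin 5 → ℝ → ℂ} {E : Fin 5 → ℝ → ℝ≥0∞}
    (hH : ∀ i, Integrable (H i)) (hE : ∀ i τ, ‖H i τ‖ₑ ≤ E i τ) (φ : 𝓢(ℝ, ℂ)) :
    ‖∫ t, (∏ i, 𝓕⁻ (H i) t) * 𝓕 φ t‖ₑ ≤ ∫⁻ τ, conv5 E τ * ‖φ τ‖ₑ := by
  have h₂ := integrable_cconv (hH 0) (hH 1)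
  have h₃ := integrable_cconv h₂ (hH 2)
  have h₄ := integrable_cconv h₃ (hH 3)
  have h₅ := integrable_cconv h₄ (hH 4)
  have hprod (t : ℝ) : ∏ i, 𝓕⁻ (H i) t =
      𝓕⁻ (cconv (cconv (cconv (cconv (H 0) (H 1)) (H 2)) (H 3)) (H 4)) t := by
    rw [fourierInv_cconv h₄ (hH 4), fourierInv_cconv h₃ (hH 3), fourierInv_cconv h₂ (hH 2),
      fourierInv_cconv (hH 0) (hH 1), Fin.prod_univ_five]
  simp only [hprod]
  rw [← (temperedPair_of_integrable h₅).integral_eq]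
  refine (enorm_integral_le_lintegral_enorm _).trans (lintegral_mono fun τ => ?_)
  rw [enorm_mul]
  gcongr
  refine (enorm_cconv_le _ _ τ).trans (lconvolution_mono (fun τ => ?_) (hE 4) τ)
  refine (enorm_cconv_le _ _ τ).trans (lconvolution_mono (fun τ => ?_) (hE 3) τ)
  refine (enorm_cconv_le _ _ τ).trans (lconvolution_mono (fun τ => ?_) (hE 2) τ)
  exact (enorm_cconv_le _ _ τ).trans (lconvolution_mono (hE 0) (hE 1) τ)

lemma prod_update_apply (v : Fin 5 → ℝ → ℂ) (j : Fin 5) (w : ℝ → ℂ) (t : ℝ) :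
    ∏ i, Function.update v j w i t = w t * ∏ i ∈ Finset.univ \ {j}, v i t := by
  simp only [Function.apply_update (fun _ (f : ℝ → ℂ) => f t)]
  exact Finset.prod_update_of_mem (Finset.mem_univ j) _ _

lemma memLp_update {v : Fin 5 → ℝ → ℂ} (hv : ∀ i, MemLp (v i) 6) {w : ℝ → ℂ} (hw : MemLp w 6)
    (j i : Fin 5) : MemLp (Function.update v j w i) 6 := by
  rcases eq_or_ne i j with rfl | hij
  · rwa [Function.update_self]
  · rw [Function.update_of_ne hij]
    exact hv i

lemma enorm_integral_prod_mul_le_update_add {v : Fin 5 → ℝ → ℂ} {w ψ : ℝ → ℂ}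
    (hv : ∀ i, MemLp (v i) 6) (hw : MemLp w 6) (hψ : MemLp ψ 6) (j : Fin 5) :
    ‖∫ t, (∏ i, v i t) * ψ t‖ₑ ≤ ‖∫ t, (∏ i, Function.update v j w i t) * ψ t‖ₑ +
      eLpNorm (fun t => v j t - w t) 6 *
        ((∏ i ∈ Finset.univ \ {j}, eLpNorm (v i) 6) * eLpNorm ψ 6) := by
  have hd : MemLp (fun t => v j t - w t) 6 := (hv j).sub hw
  have hvj (t : ℝ) : ∏ i, v i t = v j t * ∏ i ∈ Finset.univ \ {j}, v i t := by
    rw [← prod_update_apply, Function.update_eq_self]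
  have hsplit : ∫ t, (∏ i, v i t) * ψ t = (∫ t, (∏ i, Function.update v j w i t) * ψ t) +
      ∫ t, (∏ i, Function.update v j (fun t => v j t - w t) i t) * ψ t := by
    rw [← integral_add (integrable_prod_mul (memLp_update hv hw j) hψ)
      (integrable_prod_mul (memLp_update hv hd j) hψ)]
    refine integral_congr_ae (Eventually.of_forall fun t => ?_)
    simp only [prod_update_apply, hvj]
    ring
  rw [hsplit]
  refine (enorm_add_le _ _).trans (add_le_add_right ?_ _)
  refine (enorm_integral_le_lintegral_enorm _).trans
    ((lintegral_prod_mul_le (fun i => (memLp_update hv hd j i).1) hψ.1).trans (le_of_eq ?_))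
  simp only [Function.apply_update (fun _ (f : ℝ → ℂ) => eLpNorm f 6)]
  rw [Finset.prod_update_of_mem (Finset.mem_univ j), mul_assoc]

lemma le_of_forall_le_add_mul {x B K : ℝ≥0∞} (hK : K ≠ ∞)
    (h : ∀ δ : ℝ≥0∞, δ ≠ 0 → x ≤ B + δ * K) : x ≤ B := by
  refine ENNReal.le_of_forall_pos_le_add fun ε hε _ => ?_
  refine (h (ε / (K + 1)) (by simp [ENNReal.div_eq_zero_iff, hε.ne', hK])).trans ?_
  gcongr
  calc (ε : ℝ≥0∞) / (K + 1) * K ≤ ε / (K + 1) * (K + 1) := by gcongr; exact le_self_add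
    _ ≤ ε := (ENNReal.div_mul_cancel (by simp) (by simp [hK])).le

lemma enorm_integral_prod_mul_le_of_forall_update {v : Fin 5 → ℝ → ℂ} {ψ : ℝ → ℂ}
    (hv : ∀ i, MemLp (v i) 6) (hψ : MemLp ψ 6) {j : Fin 5} {E : ℝ → ℝ≥0∞} {B : ℝ≥0∞}
    (hj : SixApprox (v j) E)
    (hB : ∀ H : ℝ → ℂ, Integrable H → (∀ τ, ‖H τ‖ₑ ≤ E τ) → MemLp (𝓕⁻ H) 6 →
      ‖∫ t, (∏ i, Function.update v j (𝓕⁻ H) i t) * ψ t‖ₑ ≤ B) :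
    ‖∫ t, (∏ i, v i t) * ψ t‖ₑ ≤ B := by
  have hfin : (∏ i ∈ Finset.univ \ {j}, eLpNorm (v i) 6) * eLpNorm ψ 6 ≠ ∞ :=
    ENNReal.mul_ne_top (ENNReal.prod_ne_top fun i _ => (hv i).eLpNorm_ne_top) hψ.eLpNorm_ne_top
  refine le_of_forall_le_add_mul hfin fun δ hδ => ?_
  obtain ⟨H, hH, hHE, hH6, hHδ⟩ := hj.approx δ hδ
  refine (enorm_integral_prod_mul_le_update_add hv hH6 hψ j).trans ?_
  gcongr
  exact hB H hH hHE hH6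

-- The factors are replaced one at a time by inverse Fourier transforms of integrable functions;
-- `S` is the set of factors still to be replaced.
lemma enorm_integral_prod_mul_le_of_finset {E : Fin 5 → ℝ → ℝ≥0∞} (φ : 𝓢(ℝ, ℂ))
    (S : Finset (Fin 5)) : ∀ v : Fin 5 → ℝ → ℂ, (∀ i, MemLp (v i) 6) →
      (∀ i ∈ S, SixApprox (v i) (E i)) →
      (∀ i ∉ S, ∃ H : ℝ → ℂ, Integrable H ∧ (∀ τ, ‖H τ‖ₑ ≤ E i τ) ∧ v i = 𝓕⁻ H) →
      ‖∫ t, (∏ i, v i t) * 𝓕 φ t‖ₑ ≤ ∫⁻ τ, conv5 E τ * ‖φ τ‖ₑ := by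
  induction S using Finset.induction_on with
  | empty =>
    intro v _ _ hv
    choose H hH hHE hvH using fun i => hv i (Finset.notMem_empty i)
    simp only [hvH]
    exact enorm_integral_prod_fourierInv_mul_le hH hHE φ
  | insert j S hj ih =>
    intro v hv6 hvS hv
    refine enorm_integral_prod_mul_le_of_forall_update hv6 ((𝓕 φ).memLp 6 volume)
      (hvS j (Finset.mem_insert_self j S)) fun H hH hHE hH6 => ?_
    refine ih _ (memLp_update hv6 hH6 j) (fun i hi => ?_) (fun i hi => ?_)
    · rw [Function.update_of_ne (ne_of_mem_of_not_mem hi hj)]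
      exact hvS i (Finset.mem_insert_of_mem hi)
    · rcases eq_or_ne i j with rfl | hij
      · exact ⟨H, hH, hHE, Function.update_self ..⟩
      · rw [Function.update_of_ne hij]
        exact hv i (by simp [hij, hi])

lemma enorm_integral_prod_mul_le {v : Fin 5 → ℝ → ℂ} {E : Fin 5 → ℝ → ℝ≥0∞}
    (h : ∀ i, SixApprox (v i) (E i)) (φ : 𝓢(ℝ, ℂ)) :
    ‖∫ t, (∏ i, v i t) * 𝓕 φ t‖ₑ ≤ ∫⁻ τ, conv5 E τ * ‖φ τ‖ₑ :=
  enorm_integral_prod_mul_le_of_finset φ Finset.univ v (fun i => (h i).memLp) (fun i _ => h i)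
    (fun i hi => absurd (Finset.mem_univ i) hi)

end Multilinear

section Riesz

open Filter Topology
open scoped FourierTransform SchwartzMap

/-! ### Representation of weighted `L²` functionals -/

lemma hasTemperateGrowth_jb_rpow (ω b : ℝ) :
    (fun τ : ℝ => ((jb (τ - ω) ^ b : ℝ) : ℂ)).HasTemperateGrowth := by
  have hpow : (fun x : ℝ => (1 + ‖x‖ ^ 2) ^ (b / 2)).HasTemperateGrowth :=
    Function.hasTemperateGrowth_one_add_norm_sq_rpow ℝ (b / 2)
  have hshift : (fun τ : ℝ => τ - ω).HasTemperateGrowth := by fun_prop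
  convert Complex.ofRealCLM.hasTemperateGrowth.comp (hpow.comp hshift) using 2 with τ
  simp only [Function.comp_apply, Complex.ofRealCLM_apply, Real.norm_eq_abs, sq_abs, jb]
  rw [Real.sqrt_eq_rpow, ← Real.rpow_mul (by positivity), one_div_mul_eq_div]

/-- Multiplication of Schwartz functions by `⟨τ - ω⟩^b`. -/
def jbMul (ω b : ℝ) : 𝓢(ℝ, ℂ) →L[ℂ] 𝓢(ℝ, ℂ) :=
  SchwartzMap.smulLeftCLM ℂ (fun τ : ℝ => ((jb (τ - ω) ^ b : ℝ) : ℂ))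

lemma jbMul_apply (ω b : ℝ) (φ : 𝓢(ℝ, ℂ)) (τ : ℝ) :
    jbMul ω b φ τ = ((jb (τ - ω) ^ b : ℝ) : ℂ) * φ τ := by
  rw [jbMul, SchwartzMap.smulLeftCLM_apply_apply (hasTemperateGrowth_jb_rpow ω b), smul_eq_mul]

lemma jbMul_neg_jbMul (ω b : ℝ) (φ : 𝓢(ℝ, ℂ)) : jbMul ω (-b) (jbMul ω b φ) = φ := by
  ext τ
  rw [jbMul_apply, jbMul_apply, ← mul_assoc, ← Complex.ofReal_mul, ← Real.rpow_add (jb_pos _),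
    neg_add_cancel, Real.rpow_zero, Complex.ofReal_one, one_mul]

lemma enorm_jb_rpow (x b : ℝ) : ‖((jb x ^ b : ℝ) : ℂ)‖ₑ = ENNReal.ofReal (jb x ^ b) := by
  rw [← ofReal_norm, Complex.norm_real, Real.norm_of_nonneg (jb_rpow_pos _ _).le]

lemma enorm_jbMul_apply (ω b : ℝ) (φ : 𝓢(ℝ, ℂ)) (τ : ℝ) :
    ‖jbMul ω b φ τ‖ₑ = ENNReal.ofReal (jb (τ - ω) ^ b) * ‖φ τ‖ₑ := by
  rw [jbMul_apply, enorm_mul, enorm_jb_rpow]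

lemma wNorm_neg_jb_rpow_mul (ω b : ℝ) (g : ℝ → ℂ) :
    wNorm (-b) ω (fun τ => ((jb (τ - ω) ^ b : ℝ) : ℂ) * g τ) = ∫⁻ τ, ‖g τ‖ₑ ^ 2 := by
  refine lintegral_congr fun τ => ?_
  rw [enorm_mul, enorm_jb_rpow, ← mul_assoc, ← ENNReal.ofReal_mul (jb_rpow_pos _ _).le,
    ← Real.rpow_add (jb_pos _), neg_add_cancel, Real.rpow_zero, ENNReal.ofReal_one, one_mul]

lemma exists_inner_eq_of_denseRange {V H : Type*} [AddCommGroup V] [Module ℂ V]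
    [NormedAddCommGroup H] [InnerProductSpace ℂ H] [CompleteSpace H] {e : V →ₗ[ℂ] H}
    (he : DenseRange e) {f : V →ₗ[ℂ] ℂ} {C : ℝ} (hC : 0 ≤ C) (hf : ∀ x, ‖f x‖ ≤ C * ‖e x‖) :
    ∃ g : H, ‖g‖ ≤ C ∧ ∀ x, inner ℂ g (e x) = f x := by
  refine ⟨(InnerProductSpace.toDual ℂ H).symm (f.extendOfNorm e), ?_, fun x => ?_⟩
  · rw [LinearIsometryEquiv.norm_map]
    exact (f.extendOfNorm e).opNorm_le_bound hC (LinearMap.norm_extendOfNorm_apply_le he _ hf)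
  · rw [InnerProductSpace.toDual_symm_apply]
    exact LinearMap.extendOfNorm_eq he ⟨C, hf⟩ x

lemma exists_integral_mul_eq_of_sq_le {f : 𝓢(ℝ, ℂ) →ₗ[ℂ] ℂ} {B : ℝ≥0∞} (hB : B ≠ ∞)
    (hf : ∀ ψ, ‖f ψ‖ₑ ^ 2 ≤ B * ∫⁻ τ, ‖ψ τ‖ₑ ^ 2) :
    ∃ g : ℝ → ℂ, MemLp g 2 ∧ ∫⁻ τ, ‖g τ‖ₑ ^ 2 ≤ B ∧ ∀ ψ, ∫ τ, g τ * ψ τ = f ψ := by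
  have hnorm (ψ : 𝓢(ℝ, ℂ)) : ‖f ψ‖ ≤ √B.toReal * ‖SchwartzMap.toLpCLM ℂ ℂ 2 volume ψ‖ := by
    have hsq : ∫⁻ τ, ‖ψ τ‖ₑ ^ 2 = ‖SchwartzMap.toLpCLM ℂ ℂ 2 volume ψ‖ₑ ^ 2 := by
      rw [lintegral_enorm_pow_eq, Lp.enorm_def]
      exact congrArg (· ^ 2) (eLpNorm_congr_ae (ψ.coeFn_toLp 2 volume)).symm
    have hreal := ENNReal.toReal_mono
      (ENNReal.mul_ne_top hB (ENNReal.pow_ne_top enorm_ne_top)) (hsq ▸ hf ψ)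
    rw [ENNReal.toReal_pow, ENNReal.toReal_mul, ENNReal.toReal_pow, toReal_enorm,
      toReal_enorm] at hreal
    refine le_of_sq_le_sq ?_ (by positivity)
    rwa [mul_pow, Real.sq_sqrt ENNReal.toReal_nonneg]
  obtain ⟨g, hg, hgf⟩ := exists_inner_eq_of_denseRange
    (e := (SchwartzMap.toLpCLM ℂ ℂ 2 (volume : Measure ℝ)).toLinearMap)
    (SchwartzMap.denseRange_toLpCLM (by norm_num)) (Real.sqrt_nonneg _) hnorm
  refine ⟨fun τ => star (g τ), (Lp.memLp g).star, ?_, fun ψ => ?_⟩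
  · simp only [enorm_eq_nnnorm, nnnorm_star]
    simp only [← enorm_eq_nnnorm]
    rw [lintegral_enorm_pow_eq, ← Lp.enorm_def,
      ← ENNReal.toReal_le_toReal (ENNReal.pow_ne_top enorm_ne_top) hB, ENNReal.toReal_pow,
      toReal_enorm]
    exact (Real.le_sqrt (norm_nonneg _) ENNReal.toReal_nonneg).1 hg
  · rw [← hgf ψ, L2.inner_def]
    refine integral_congr_ae ?_
    filter_upwards [ψ.coeFn_toLp 2 volume] with τ hτ
    change _ = inner ℂ (g τ) (ψ.toLp 2 volume τ)
    rw [hτ, RCLike.inner_apply, mul_comm, starRingEnd_apply]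

/-- The Fourier transform of `N`, as a functional on Schwartz functions. -/
def fourierFunctional {N : ℝ → ℂ} (hN : ∀ φ : 𝓢(ℝ, ℂ), Integrable (fun t => N t * φ t)) :
    𝓢(ℝ, ℂ) →ₗ[ℂ] ℂ where
  toFun φ := ∫ t, N t * 𝓕 φ t
  map_add' φ ψ := by
    simp only [FourierTransform.fourier_add, add_apply, mul_add]
    exact integral_add (hN _) (hN _)
  map_smul' c φ := by
    simp only [FourierTransform.fourier_smul, smul_apply, smul_eq_mul, mul_left_comm _ c,
      RingHom.id_apply]
    exact integral_const_mul _ _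

lemma exists_temperedPair {N : ℝ → ℂ} (hN : ∀ φ : 𝓢(ℝ, ℂ), Integrable (fun t => N t * φ t))
    {E : ℝ → ℝ≥0∞} (hE : Measurable E) {b ω : ℝ}
    (hbound : ∀ φ : 𝓢(ℝ, ℂ), ‖∫ t, N t * 𝓕 φ t‖ₑ ≤ ∫⁻ τ, E τ * ‖φ τ‖ₑ)
    (hfin : ∫⁻ τ, (ENNReal.ofReal (jb (τ - ω) ^ (-b)) * E τ) ^ 2 < ∞) :
    ∃ G : ℝ → ℂ, TemperedPair N G ∧
      wNorm (-b) ω G ≤ ∫⁻ τ, (ENNReal.ofReal (jb (τ - ω) ^ (-b)) * E τ) ^ 2 := by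
  obtain ⟨g, hg, hgE, hgf⟩ := exists_integral_mul_eq_of_sq_le
    (f := fourierFunctional hN ∘ₗ (jbMul ω (-b)).toLinearMap) hfin.ne fun ψ =>
      (pow_le_pow_left' (hbound (jbMul ω (-b) ψ)) 2).trans <|
        lintegral_sq_le_mul (by fun_prop) (by fun_prop) fun τ => by
          rw [enorm_jbMul_apply]
          exact le_of_eq (by ring)
  have hmul (φ : 𝓢(ℝ, ℂ)) (τ : ℝ) :
      ((jb (τ - ω) ^ b : ℝ) : ℂ) * g τ * φ τ = g τ * jbMul ω b φ τ := by
    rw [jbMul_apply]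
    ring
  refine ⟨fun τ => ((jb (τ - ω) ^ b : ℝ) : ℂ) * g τ, ⟨hN, fun φ => ?_, fun φ => ?_⟩, ?_⟩
  · simp only [hmul]
    exact hg.integrable_mul ((jbMul ω b φ).memLp 2 volume)
  · simp only [hmul, hgf]
    change ∫ t, N t * 𝓕 (jbMul ω (-b) (jbMul ω b φ)) t = _
    rw [jbMul_neg_jbMul]
  · rwa [wNorm_neg_jb_rpow_mul]

end Riesz

section QuinticSums

open Filter Topology
open scoped FourierTransform SchwartzMap

/-! ### Sums of quintic terms at a fixed output frequency -/

/-- The factors of `quintic`. -/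
def quinticFactor (v : ℤ → ℝ → ℂ) (κ : Fin 5 → ℤ) : Fin 5 → ℝ → ℂ :=
  ![v (κ 0), fun t => star (v (κ 1) t), v (κ 2), fun t => star (v (κ 3) t), v (κ 4)]

/-- The moduli of the Fourier transforms of the factors of `quintic`; conjugating
a function of time reflects its Fourier transform. -/
def quinticFourier (F : ℤ → ℝ → ℂ) (κ : Fin 5 → ℤ) : Fin 5 → ℝ → ℝ≥0∞ :=
  ![fun τ => ‖F (κ 0) τ‖ₑ, fun τ => ‖F (κ 1) (-τ)‖ₑ, fun τ => ‖F (κ 2) τ‖ₑ,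
    fun τ => ‖F (κ 3) (-τ)‖ₑ, fun τ => ‖F (κ 4) τ‖ₑ]

lemma quintic_eq_prod (v : ℤ → ℝ → ℂ) (κ : Fin 5 → ℤ) (t : ℝ) :
    quintic (fun n => v n t) κ = ∏ i, quinticFactor v κ i t := by
  rw [Fin.prod_univ_five]
  rfl

lemma sixApprox_quinticFactor {v F : ℤ → ℝ → ℂ}
    (h : ∀ k, SixApprox (v k) (fun τ => ‖F k τ‖ₑ)) (κ : Fin 5 → ℤ) :
    ∀ i, SixApprox (quinticFactor v κ i) (quinticFourier F κ i)
  | 0 => h (κ 0)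
  | 1 => (h (κ 1)).conj
  | 2 => h (κ 2)
  | 3 => (h (κ 3)).conj
  | 4 => h (κ 4)

lemma memLp_quinticFactor {v : ℤ → ℝ → ℂ} (hv : ∀ k, MemLp (v k) 6) (κ : Fin 5 → ℤ) :
    ∀ i, MemLp (quinticFactor v κ i) 6
  | 0 => hv (κ 0)
  | 1 => (hv (κ 1)).star
  | 2 => hv (κ 2)
  | 3 => (hv (κ 3)).star
  | 4 => hv (κ 4)

lemma eLpNorm_quinticFactor (v : ℤ → ℝ → ℂ) (κ : Fin 5 → ℤ) (i : Fin 5) :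
    eLpNorm (quinticFactor v κ i) 6 = eLpNorm (v (κ i)) 6 := by
  refine eLpNorm_congr_norm_ae (Eventually.of_forall fun t => ?_)
  fin_cases i <;> simp [quinticFactor]

lemma measurable_quinticFourier {F : ℤ → ℝ → ℂ} (hF : ∀ k, Measurable (F k)) (κ : Fin 5 → ℤ) :
    ∀ i, Measurable (quinticFourier F κ i)
  | 0 => (hF (κ 0)).enorm
  | 1 => ((hF (κ 1)).comp measurable_neg).enorm
  | 2 => (hF (κ 2)).enorm
  | 3 => ((hF (κ 3)).comp measurable_neg).enorm
  | 4 => (hF (κ 4)).enorm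

lemma WeightBound.comp_neg {f : ℝ → ℝ≥0∞} {ω γ : ℝ} {A : ℝ≥0∞} (h : WeightBound f ω γ A) :
    WeightBound (fun τ => f (-τ)) (-ω) γ A := by
  obtain ⟨P, hPm, hPA, hP⟩ := h
  refine ⟨fun τ => P (-τ), by fun_prop, ?_, fun τ => ?_⟩
  · rwa [lintegral_neg_eq_self P]
  · refine (hP (-τ)).trans (le_of_eq ?_)
    rw [← jb_neg (-τ - ω)]
    ring_nf

/-- The constant in the bound for convolutions of five weighted functions. -/
def fiveConst (b : ℝ) : ℝ≥0∞ := (4 * jbInt (1 + (1 - 2 * b))) ^ 4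

lemma fiveConst_lt_top {b : ℝ} (hb : b < 1 / 2) : fiveConst b < ∞ :=
  ENNReal.pow_lt_top (ENNReal.mul_lt_top (by norm_num) (jbInt_lt_top (by linarith)))

lemma weightBound_conv5_quinticFourier {α b : ℝ} {F : ℤ → ℝ → ℂ} (hF : ∀ k, Measurable (F k))
    (hb : 4 / 9 ≤ b) (hb' : b ≤ 1 / 2) (κ : Fin 5 → ℤ) :
    WeightBound (conv5 (quinticFourier F κ)) (phase α κ) (1 - 9 * (1 - 2 * b))
      (fiveConst b * ∏ i, wNorm b (disp α (κ i)) (F (κ i))) := by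
  have hbound (k : ℤ) := weightBound_enorm (hF k) b (disp α k)
  have hfactor : ∀ i, WeightBound (quinticFourier F κ i)
      (![disp α (κ 0), -disp α (κ 1), disp α (κ 2), -disp α (κ 3), disp α (κ 4)] i)
      (1 - (1 - 2 * b)) (wNorm b (disp α (κ i)) (F (κ i)))
    | 0 => hbound (κ 0)
    | 1 => (hbound (κ 1)).comp_neg
    | 2 => hbound (κ 2)
    | 3 => (hbound (κ 3)).comp_neg
    | 4 => hbound (κ 4)
  convert WeightBound.conv5 (by linarith) (by linarith) hfactor using 1
  · rw [Fin.sum_univ_five, phase]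
    change _ = disp α (κ 0) + -disp α (κ 1) + disp α (κ 2) + -disp α (κ 3) + disp α (κ 4)
    ring
  · rw [fiveConst]

variable {S : Set (Fin 5 → ℤ)} {D : (Fin 5 → ℤ) → ℝ} {v F : ℤ → ℝ → ℂ}

/-- The sum over the frequencies in `S` of the quintic products of the modes `v`, divided by the
denominators `D`; this is the shape of `NR1` and `NR2` at a fixed output frequency. -/
def quinticSum (S : Set (Fin 5 → ℤ)) (D : (Fin 5 → ℤ) → ℝ) (v : ℤ → ℝ → ℂ) (t : ℝ) : ℂ :=
  ∑' κ : S, quintic (fun n => v n t) κ / (D κ : ℂ)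

/-- The majorant of the Fourier transform of `quinticSum S D v`, where `F` is the family of Fourier
transforms of `v`. -/
def quinticMajorant (S : Set (Fin 5 → ℤ)) (D : (Fin 5 → ℤ) → ℝ) (F : ℤ → ℝ → ℂ) (τ : ℝ) :
    ℝ≥0∞ :=
  ∑' κ : S, ENNReal.ofReal |D κ|⁻¹ * conv5 (quinticFourier F κ) τ

lemma measurable_quinticMajorant (hF : ∀ k, Measurable (F k)) :
    Measurable (quinticMajorant S D F) := by
  refine Measurable.tsum fun κ => ?_
  have := measurable_conv5 (measurable_quinticFourier hF κ)
  fun_prop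

lemma lintegral_quinticMajorant_mul (hF : ∀ k, Measurable (F k)) {ψ : ℝ → ℝ≥0∞}
    (hψ : Measurable ψ) :
    ∫⁻ τ, quinticMajorant S D F τ * ψ τ =
      ∑' κ : S, ENNReal.ofReal |D κ|⁻¹ * ∫⁻ τ, conv5 (quinticFourier F κ) τ * ψ τ := by
  have hmeas (κ : S) := measurable_conv5 (measurable_quinticFourier hF κ)
  simp only [quinticMajorant, ← ENNReal.tsum_mul_right]
  rw [lintegral_tsum fun κ => by have := hmeas κ; fun_prop]
  refine tsum_congr fun κ => ?_
  rw [← lintegral_const_mul' _ _ ENNReal.ofReal_ne_top]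
  simp only [mul_assoc]

lemma enorm_div_ofReal (z : ℂ) (d : ℝ) :
    ‖z / (d : ℂ)‖ₑ = ENNReal.ofReal |d|⁻¹ * ‖z‖ₑ := by
  rw [div_eq_inv_mul, enorm_mul, ← ofReal_norm (d : ℂ)⁻¹, norm_inv, Complex.norm_real,
    Real.norm_eq_abs]

lemma aestronglyMeasurable_quintic_div (hv : ∀ k, MemLp (v k) 6) (κ : Fin 5 → ℤ) :
    AEStronglyMeasurable (fun t => quintic (fun n => v n t) κ / (D κ : ℂ)) := by
  simp only [quintic_eq_prod, div_eq_mul_inv]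
  exact (Finset.aestronglyMeasurable_fun_prod _ fun i _ =>
    (memLp_quinticFactor hv κ i).1).mul_const _

lemma lintegral_enorm_quintic_div_mul_le (hv : ∀ k, MemLp (v k) 6) (κ : Fin 5 → ℤ) {ψ : ℝ → ℂ}
    (hψ : AEStronglyMeasurable ψ) :
    ∫⁻ t, ‖quintic (fun n => v n t) κ / (D κ : ℂ) * ψ t‖ₑ ≤
      ENNReal.ofReal |D κ|⁻¹ * (∏ i, eLpNorm (v (κ i)) 6) * eLpNorm ψ 6 := by
  have hHolder := lintegral_prod_mul_le (fun i => (memLp_quinticFactor hv κ i).1) hψ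
  simp only [eLpNorm_quinticFactor] at hHolder
  rw [mul_assoc]
  refine le_trans (le_of_eq ?_) (mul_le_mul_right hHolder _)
  rw [← lintegral_const_mul' _ _ ENNReal.ofReal_ne_top]
  refine lintegral_congr fun t => ?_
  rw [enorm_mul, enorm_div_ofReal, quintic_eq_prod, enorm_mul, mul_assoc]

lemma tsum_lintegral_quintic_lt_top (hv : ∀ k, MemLp (v k) 6)
    (hsum : ∑' κ : S, ENNReal.ofReal |D κ|⁻¹ * ∏ i, eLpNorm (v ((κ : Fin 5 → ℤ) i)) 6 < ∞)
    {ψ : ℝ → ℂ} (hψ : MemLp ψ 6) :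
    ∑' κ : S, ∫⁻ t, ‖quintic (fun n => v n t) κ / (D κ : ℂ) * ψ t‖ₑ < ∞ := by
  refine lt_of_le_of_lt ?_ (ENNReal.mul_lt_top hsum hψ.2)
  rw [← ENNReal.tsum_mul_right]
  exact ENNReal.tsum_le_tsum fun κ => lintegral_enorm_quintic_div_mul_le hv κ hψ.1

lemma lintegral_tsum_enorm_quintic_lt_top (hv : ∀ k, MemLp (v k) 6)
    (hsum : ∑' κ : S, ENNReal.ofReal |D κ|⁻¹ * ∏ i, eLpNorm (v ((κ : Fin 5 → ℤ) i)) 6 < ∞)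
    {ψ : ℝ → ℂ} (hψ : MemLp ψ 6) :
    ∫⁻ t, ∑' κ : S, ‖quintic (fun n => v n t) κ / (D κ : ℂ) * ψ t‖ₑ < ∞ := by
  have hmeas (κ : S) :
      AEMeasurable fun t => ‖quintic (fun n => v n t) κ / (D κ : ℂ) * ψ t‖ₑ :=
    ((aestronglyMeasurable_quintic_div hv κ).mul hψ.1).enorm
  rw [lintegral_tsum hmeas]
  exact tsum_lintegral_quintic_lt_top hv hsum hψ

lemma ae_summable_quintic (hv : ∀ k, MemLp (v k) 6)
    (hsum : ∑' κ : S, ENNReal.ofReal |D κ|⁻¹ * ∏ i, eLpNorm (v ((κ : Fin 5 → ℤ) i)) 6 < ∞) :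
    ∀ᵐ t, Summable fun κ : S => quintic (fun n => v n t) κ / (D κ : ℂ) := by
  choose φ hφ using exists_schwartz_eq_one
  have hlocal (n : ℕ) :
      ∀ᵐ t, ∑' κ : S, ‖quintic (fun n => v n t) κ / (D κ : ℂ) * φ n t‖ₑ < ∞ := by
    have hφ6 := (φ n).memLp 6 volume
    exact ae_lt_top' (AEMeasurable.tsum fun κ =>
      ((aestronglyMeasurable_quintic_div hv κ).mul hφ6.1).enorm)
      (lintegral_tsum_enorm_quintic_lt_top hv hsum hφ6).ne
  filter_upwards [ae_all_iff.2 hlocal] with t ht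
  obtain ⟨n, hn⟩ := exists_nat_ge |t|
  have hsumt := ht n
  simp only [hφ n t hn, mul_one] at hsumt
  exact Summable.of_enorm hsumt.ne

lemma integrable_quinticSum_mul (hv : ∀ k, MemLp (v k) 6)
    (hsum : ∑' κ : S, ENNReal.ofReal |D κ|⁻¹ * ∏ i, eLpNorm (v ((κ : Fin 5 → ℤ) i)) 6 < ∞)
    (φ : 𝓢(ℝ, ℂ)) : Integrable fun t => quinticSum S D v t * φ t := by
  refine ⟨AEStronglyMeasurable.mul ?_ φ.continuous.aestronglyMeasurable, ?_⟩
  · exact (AEMeasurable.tsum fun κ : S =>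
      (aestronglyMeasurable_quintic_div hv κ).aemeasurable).aestronglyMeasurable
  · refine lt_of_le_of_lt (lintegral_mono fun t => ?_)
      (lintegral_tsum_enorm_quintic_lt_top hv hsum (φ.memLp 6 volume))
    dsimp only [quinticSum]
    rw [← tsum_mul_right]
    exact enorm_tsum_le_tsum_enorm

lemma enorm_integral_quintic_div_mul_le (h : ∀ k, SixApprox (v k) (fun τ => ‖F k τ‖ₑ))
    (κ : Fin 5 → ℤ) (φ : 𝓢(ℝ, ℂ)) :
    ‖∫ t, quintic (fun n => v n t) κ / (D κ : ℂ) * 𝓕 φ t‖ₑ ≤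
      ENNReal.ofReal |D κ|⁻¹ * ∫⁻ τ, conv5 (quinticFourier F κ) τ * ‖φ τ‖ₑ := by
  simp only [div_mul_eq_mul_div, integral_div, enorm_div_ofReal, quintic_eq_prod]
  gcongr
  exact enorm_integral_prod_mul_le (sixApprox_quinticFactor h κ) φ

lemma enorm_integral_quinticSum_mul_le (hF : ∀ k, Measurable (F k))
    (h : ∀ k, SixApprox (v k) (fun τ => ‖F k τ‖ₑ))
    (hsum : ∑' κ : S, ENNReal.ofReal |D κ|⁻¹ * ∏ i, eLpNorm (v ((κ : Fin 5 → ℤ) i)) 6 < ∞)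
    (φ : 𝓢(ℝ, ℂ)) :
    ‖∫ t, quinticSum S D v t * 𝓕 φ t‖ₑ ≤ ∫⁻ τ, quinticMajorant S D F τ * ‖φ τ‖ₑ := by
  have hv (k : ℤ) := (h k).memLp
  simp only [quinticSum, ← tsum_mul_right]
  rw [integral_tsum (f := fun (κ : S) t => quintic (fun n => v n t) κ / (D κ : ℂ) * 𝓕 φ t)
    (fun κ => (aestronglyMeasurable_quintic_div hv κ).mul (𝓕 φ).continuous.aestronglyMeasurable)
    (tsum_lintegral_quintic_lt_top hv hsum ((𝓕 φ).memLp 6 volume)).ne,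
    lintegral_quinticMajorant_mul hF φ.continuous.measurable.enorm]
  exact enorm_tsum_le_tsum_enorm.trans
    (ENNReal.tsum_le_tsum fun κ => enorm_integral_quintic_div_mul_le h κ φ)

end QuinticSums

section QuinticEstimate

/-! ### The weighted bound for quintic sums -/

lemma jb_rpow_sq_mul_jb_rpow_le {b γ : ℝ} (τ ω θ : ℝ) (hγ : 0 ≤ γ) (hγ' : γ ≤ 1)
    (hγb : γ ≤ 2 * b) :
    (jb (τ - ω) ^ (-b)) ^ 2 * jb (τ - θ) ^ (-γ) ≤ 4 * jb (ω - θ) ^ (-γ) := by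
  have hmul := jb_rpow_mul_le (ω - τ) (τ - θ) hγ hγ' hγb le_rfl
  have hone (y : ℝ) : jb y ^ (-(2 * b + γ - γ)) ≤ 1 :=
    Real.rpow_le_one_of_one_le_of_nonpos (one_le_jb y) (by linarith)
  have hpos := jb_rpow_pos (ω - θ) (-γ)
  rw [sub_add_sub_cancel] at hmul
  rw [← Real.rpow_mul_natCast (jb_pos _).le, ← jb_neg (τ - ω), neg_sub, Nat.cast_ofNat,
    neg_mul, mul_comm b]
  nlinarith [hone (ω - τ), hone (τ - θ)]

lemma sq_mul_le_of_sq_le {E P : ℝ≥0∞} {b γ τ ω θ : ℝ} (d : ℝ) (hγ : 0 ≤ γ) (hγ' : γ ≤ 1)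
    (hγb : γ ≤ 2 * b) (hE : E ^ 2 ≤ ENNReal.ofReal (jb (τ - θ) ^ (-γ)) * P) :
    (ENNReal.ofReal (jb (τ - ω) ^ (-b)) * (ENNReal.ofReal |d|⁻¹ * E)) ^ 2 ≤
      4 * ENNReal.ofReal (d⁻¹ ^ 2 * jb (ω - θ) ^ (-γ)) * P := by
  have hjb := jb_rpow_pos (τ - ω) (-b)
  have hd : ENNReal.ofReal |d|⁻¹ ^ 2 = ENNReal.ofReal (d⁻¹ ^ 2) := by
    rw [← abs_inv, ← ENNReal.ofReal_pow (abs_nonneg _), sq_abs]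
  calc (ENNReal.ofReal (jb (τ - ω) ^ (-b)) * (ENNReal.ofReal |d|⁻¹ * E)) ^ 2
      = ENNReal.ofReal (d⁻¹ ^ 2) * ENNReal.ofReal ((jb (τ - ω) ^ (-b)) ^ 2) * E ^ 2 := by
        rw [ENNReal.ofReal_pow hjb.le, ← hd]
        ring
    _ ≤ ENNReal.ofReal (d⁻¹ ^ 2) * ENNReal.ofReal ((jb (τ - ω) ^ (-b)) ^ 2) *
        (ENNReal.ofReal (jb (τ - θ) ^ (-γ)) * P) := by gcongr
    _ = ENNReal.ofReal (d⁻¹ ^ 2) *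
        ENNReal.ofReal ((jb (τ - ω) ^ (-b)) ^ 2 * jb (τ - θ) ^ (-γ)) * P := by
        rw [ENNReal.ofReal_mul (by positivity)]
        ring
    _ ≤ ENNReal.ofReal (d⁻¹ ^ 2) * ENNReal.ofReal (4 * jb (ω - θ) ^ (-γ)) * P := by
        refine mul_le_mul_left (mul_le_mul_right (ENNReal.ofReal_le_ofReal ?_) _) _
        exact jb_rpow_sq_mul_jb_rpow_le τ ω θ hγ hγ' hγb
    _ = 4 * ENNReal.ofReal (d⁻¹ ^ 2 * jb (ω - θ) ^ (-γ)) * P := by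
        rw [ENNReal.ofReal_mul (by positivity), ENNReal.ofReal_mul (by positivity),
          ENNReal.ofReal_ofNat]
        ring

lemma ofReal_weightTerm_mul_prod (α s a γ : ℝ) (D : ℤ → (Fin 5 → ℤ) → ℝ) (k : ℤ)
    (κ : Fin 5 → ℤ) :
    ENNReal.ofReal (weightTerm α s a γ D k κ) * ∏ i, ENNReal.ofReal (jb (κ i) ^ (2 * s)) =
      ENNReal.ofReal (jb k ^ (2 * (s + a))) *
        ENNReal.ofReal ((D k κ)⁻¹ ^ 2 * jb (disp α k - phase α κ) ^ (-γ)) := by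
  have hcancel : (∏ i, jb (κ i) ^ (-(2 * s))) * ∏ i, jb (κ i) ^ (2 * s) = 1 := by
    rw [← Finset.prod_mul_distrib]
    refine Finset.prod_eq_one fun i _ => ?_
    rw [← Real.rpow_add (jb_pos _), neg_add_cancel, Real.rpow_zero]
  rw [← ENNReal.ofReal_prod_of_nonneg fun i _ => (jb_rpow_pos _ _).le,
    ← ENNReal.ofReal_mul' (Finset.prod_nonneg fun i _ => (jb_rpow_pos _ _).le),
    ← ENNReal.ofReal_mul (jb_rpow_pos _ _).le, weightTerm]
  congr 1
  linear_combination
    (jb k ^ (2 * (s + a)) * (D k κ)⁻¹ ^ 2 * jb (disp α k - phase α κ) ^ (-γ)) * hcancel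

-- Cauchy–Schwarz in the frequencies, with the weights `weightTerm`.
lemma mul_sq_quinticMajorant_le {α s b γ τ : ℝ} (a : ℝ) {F : ℤ → ℝ → ℂ}
    {P : (Fin 5 → ℤ) → ℝ≥0∞} (hγ : 0 ≤ γ) (hγ' : γ ≤ 1) (hγb : γ ≤ 2 * b)
    (S : Set (Fin 5 → ℤ)) (D : ℤ → (Fin 5 → ℤ) → ℝ) (k : ℤ)
    (hP : ∀ κ, conv5 (quinticFourier F κ) τ ^ 2 ≤
      ENNReal.ofReal (jb (τ - phase α κ) ^ (-γ)) * P κ) :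
    ENNReal.ofReal (jb k ^ (2 * (s + a))) *
        (ENNReal.ofReal (jb (τ - disp α k) ^ (-b)) * quinticMajorant S (D k) F τ) ^ 2 ≤
      4 * (∑' κ : S, ENNReal.ofReal (weightTerm α s a γ D k κ)) *
        ∑' κ : S, (∏ i, ENNReal.ofReal (jb ((κ : Fin 5 → ℤ) i) ^ (2 * s))) * P κ := by
  have hsq : ENNReal.ofReal (jb k ^ (2 * (s + a))) = ENNReal.ofReal (jb k ^ (s + a)) ^ 2 := by
    rw [← ENNReal.ofReal_pow (jb_rpow_pos _ _).le, ← Real.rpow_mul_natCast (jb_pos _).le,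
      Nat.cast_ofNat, mul_comm 2]
  rw [hsq, ← mul_pow, quinticMajorant, ← ENNReal.tsum_mul_left, ← ENNReal.tsum_mul_left,
    ← ENNReal.tsum_mul_left (a := 4)]
  refine tsum_sq_le_mul fun κ => ?_
  rw [mul_pow, ← hsq]
  calc _ ≤ ENNReal.ofReal (jb k ^ (2 * (s + a))) * (4 * ENNReal.ofReal
        ((D k κ)⁻¹ ^ 2 * jb (disp α k - phase α κ) ^ (-γ)) * P κ) :=
        mul_le_mul_right (sq_mul_le_of_sq_le _ hγ hγ' hγb (hP κ)) _
    _ = 4 * (ENNReal.ofReal (jb k ^ (2 * (s + a))) * ENNReal.ofReal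
        ((D k κ)⁻¹ ^ 2 * jb (disp α k - phase α κ) ^ (-γ))) * P κ := by ring
    _ = _ := by
        rw [← ofReal_weightTerm_mul_prod]
        ring

/-- The contribution of the spatial frequency `k` to the square of `weightedL2`. -/
def modeSq (α s b : ℝ) (F : ℤ → ℝ → ℂ) (k : ℤ) : ℝ≥0∞ :=
  ENNReal.ofReal (jb k ^ (2 * s)) * wNorm b (disp α k) (F k)

lemma mul_lintegral_quinticMajorant_sq_le {α s b : ℝ} (a : ℝ) {F : ℤ → ℝ → ℂ}
    (hF : ∀ k, Measurable (F k)) (hb : 4 / 9 ≤ b) (hb' : b ≤ 1 / 2) (S : Set (Fin 5 → ℤ))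
    (D : ℤ → (Fin 5 → ℤ) → ℝ) (k : ℤ) :
    ENNReal.ofReal (jb k ^ (2 * (s + a))) *
        ∫⁻ τ, (ENNReal.ofReal (jb (τ - disp α k) ^ (-b)) * quinticMajorant S (D k) F τ) ^ 2 ≤
      4 * (∑' κ : S, ENNReal.ofReal (weightTerm α s a (1 - 9 * (1 - 2 * b)) D k κ)) *
        (fiveConst b * ∑' κ : S, ∏ i, modeSq α s b F ((κ : Fin 5 → ℤ) i)) := by
  choose P hPm hPint hP using weightBound_conv5_quinticFourier (α := α) hF hb hb'
  have hmeas (κ : S) : Measurable fun τ =>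
      (∏ i, ENNReal.ofReal (jb ((κ : Fin 5 → ℤ) i) ^ (2 * s))) * P κ τ := (hPm κ).const_mul _
  rw [← lintegral_const_mul' _ _ ENNReal.ofReal_ne_top]
  refine (lintegral_mono fun τ => mul_sq_quinticMajorant_le (s := s) a (by linarith)
    (by linarith) (by linarith) S D k fun κ => hP κ τ).trans ?_
  rw [lintegral_const_mul _ (Measurable.tsum hmeas),
    lintegral_tsum fun κ => (hmeas κ).aemeasurable, ← ENNReal.tsum_mul_left (a := fiveConst b)]
  gcongr with κ
  rw [lintegral_const_mul _ (hPm κ)]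
  simp only [modeSq, Finset.prod_mul_distrib]
  rw [mul_left_comm]
  exact mul_le_mul_right (hPint κ) _

lemma tsum_fin_pi_prod (A : ℤ → ℝ≥0∞) (n : ℕ) :
    ∑' κ : Fin n → ℤ, ∏ i, A (κ i) = (∑' k, A k) ^ n := by
  induction n with
  | zero => simp
  | succ n ih =>
    rw [← (Fin.consEquiv (fun _ : Fin (n + 1) => ℤ)).tsum_eq, ENNReal.tsum_prod']
    simp only [Fin.consEquiv_apply, Fin.prod_univ_succ, Fin.cons_zero, Fin.cons_succ,
      ENNReal.tsum_mul_left, ih, ENNReal.tsum_mul_right]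
    rw [mul_comm, pow_succ]

lemma eLpNorm_six_sq_le {v F : ℝ → ℂ} (h : TemperedPair v F) (hF : Measurable F)
    {b ω : ℝ} (hb : 2 / 5 ≤ b) (hb' : b < 1 / 2) (hA : wNorm b ω F < ∞) :
    eLpNorm v 6 ^ 2 ≤ sixConst b ^ (3⁻¹ : ℝ) * wNorm b ω F := by
  rw [← ENNReal.pow_le_pow_left_iff (n := 3) (by norm_num), mul_pow, ← pow_mul]
  refine (h.eLpNorm_pow_six_le hF hb hb' hA).trans (le_of_eq ?_)
  congr 1
  rw [← ENNReal.rpow_ofNat, ← ENNReal.rpow_mul]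
  norm_num

lemma wNorm_lt_top_of_tsum_modeSq_lt_top {α s b : ℝ} {F : ℤ → ℝ → ℂ}
    (hM : ∑' k, modeSq α s b F k < ∞) (k : ℤ) : wNorm b (disp α k) (F k) < ∞ :=
  ENNReal.lt_top_of_mul_ne_top_right ((ENNReal.le_tsum k).trans_lt hM).ne
    (ENNReal.ofReal_pos.2 (jb_rpow_pos _ _)).ne'

lemma sobolevSq_eLpNorm_six_lt_top {α s b : ℝ} {v F : ℤ → ℝ → ℂ}
    (hp : ∀ k, TemperedPair (v k) (F k)) (hF : ∀ k, Measurable (F k)) (hb : 2 / 5 ≤ b)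
    (hb' : b < 1 / 2) (hM : ∑' k, modeSq α s b F k < ∞) :
    sobolevSq s (fun k => (eLpNorm (v k) 6).toNNReal) < ∞ := by
  have hconst : sixConst b ^ (3⁻¹ : ℝ) < ∞ :=
    ENNReal.rpow_lt_top_of_nonneg (by norm_num) (sixConst_lt_top hb').ne
  refine lt_of_le_of_lt ?_ (ENNReal.mul_lt_top hconst hM)
  rw [← ENNReal.tsum_mul_left]
  refine ENNReal.tsum_le_tsum fun k => ?_
  have hwk := wNorm_lt_top_of_tsum_modeSq_lt_top hM k
  rw [ENNReal.ofReal_mul (jb_rpow_pos _ _).le, ENNReal.ofReal_pow NNReal.zero_le_coe,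
    ENNReal.ofReal_coe_nnreal,
    ENNReal.coe_toNNReal ((hp k).memLp_six (hF k) hb hb' hwk).eLpNorm_ne_top, modeSq,
    mul_left_comm]
  exact mul_le_mul_right (eLpNorm_six_sq_le (hp k) (hF k) hb hb' hwk) _

/-- What the quintic estimate needs of the frequency sets `S k` and the denominators `D k`, for
each output frequency `k`: momentum conservation, a bound `C` for the sums produced by the
Cauchy–Schwarz inequality, and absolute convergence for coefficients in the Sobolev space of
order `s`. -/
structure AdmissibleFamily (α s a b : ℝ) (S : ℤ → Set (Fin 5 → ℤ)) (D : ℤ → (Fin 5 → ℤ) → ℝ)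
    (C : ℝ≥0) : Prop where
  momentum_eq_zero : ∀ k, ∀ κ ∈ S k, k - κ 0 + κ 1 - κ 2 + κ 3 - κ 4 = 0
  tsum_weightTerm_le : ∀ k,
    ∑' κ : S k, ENNReal.ofReal (weightTerm α s a (1 - 9 * (1 - 2 * b)) D k κ) ≤ C
  tsum_lt_top : ∀ c : ℤ → ℝ≥0, sobolevSq s c < ∞ →
    ∀ k, ∑' κ : S k, ENNReal.ofReal (|D k κ|⁻¹ * ∏ i, (c ((κ : Fin 5 → ℤ) i) : ℝ)) < ∞

variable {α s a b : ℝ} {S : ℤ → Set (Fin 5 → ℤ)} {D : ℤ → (Fin 5 → ℤ) → ℝ} {C : ℝ≥0}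

lemma AdmissibleFamily.tsum_tsum_le (h : AdmissibleFamily α s a b S D C)
    (f : (Fin 5 → ℤ) → ℝ≥0∞) : ∑' k, ∑' κ : S k, f κ ≤ ∑' κ, f κ := by
  rw [← ENNReal.tsum_sigma' (fun p : (k : ℤ) × S k => f p.2)]
  refine ENNReal.tsum_comp_le_tsum_of_injective
    (f := fun p : (k : ℤ) × S k => (p.2 : Fin 5 → ℤ)) ?_ f
  rintro ⟨k, κ, hκ⟩ ⟨k', κ', hκ'⟩ (rfl : κ = κ')
  have hk := h.momentum_eq_zero k κ hκ
  have hk' := h.momentum_eq_zero k' κ hκ'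
  obtain rfl : k = k' := by linarith
  rfl

lemma AdmissibleFamily.tsum_eLpNorm_lt_top (h : AdmissibleFamily α s a b S D C)
    {v : ℤ → ℝ → ℂ} (hv : ∀ k, MemLp (v k) 6)
    (hs : sobolevSq s (fun k => (eLpNorm (v k) 6).toNNReal) < ∞) (k : ℤ) :
    ∑' κ : S k, ENNReal.ofReal |D k κ|⁻¹ * ∏ i, eLpNorm (v ((κ : Fin 5 → ℤ) i)) 6 < ∞ := by
  refine lt_of_le_of_lt (le_of_eq (tsum_congr fun κ => ?_)) (h.tsum_lt_top _ hs k)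
  rw [ENNReal.ofReal_mul (by positivity),
    ENNReal.ofReal_prod_of_nonneg fun i _ => NNReal.zero_le_coe]
  simp only [ENNReal.ofReal_coe_nnreal, ENNReal.coe_toNNReal (hv _).eLpNorm_ne_top]

lemma AdmissibleFamily.tsum_lintegral_quinticMajorant_sq_le (h : AdmissibleFamily α s a b S D C)
    (hb : 4 / 9 ≤ b) (hb' : b ≤ 1 / 2) {F : ℤ → ℝ → ℂ} (hF : ∀ k, Measurable (F k)) :
    ∑' k : ℤ, ENNReal.ofReal (jb k ^ (2 * (s + a))) * ∫⁻ τ,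
        (ENNReal.ofReal (jb (τ - disp α k) ^ (-b)) * quinticMajorant (S k) (D k) F τ) ^ 2 ≤
      4 * C * fiveConst b * (∑' k, modeSq α s b F k) ^ 5 := by
  calc _ ≤ ∑' k, 4 * C * fiveConst b *
        ∑' κ : S k, ∏ i, modeSq α s b F ((κ : Fin 5 → ℤ) i) := by
        refine ENNReal.tsum_le_tsum fun k => ?_
        rw [mul_assoc (4 * (C : ℝ≥0∞))]
        refine (mul_lintegral_quinticMajorant_sq_le a hF hb hb' (S k) D k).trans ?_
        gcongr
        exact h.tsum_weightTerm_le k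
    _ ≤ 4 * C * fiveConst b * (∑' k, modeSq α s b F k) ^ 5 := by
        rw [ENNReal.tsum_mul_left, ← tsum_fin_pi_prod]
        gcongr
        exact h.tsum_tsum_le fun κ => ∏ i, modeSq α s b F (κ i)

theorem AdmissibleFamily.exists_temperedPair (h : AdmissibleFamily α s a b S D C)
    (hb : 4 / 9 ≤ b) (hb' : b < 1 / 2) {v F : ℤ → ℝ → ℂ} (hp : ∀ k, TemperedPair (v k) (F k))
    (hF : ∀ k, Measurable (F k)) (hM : ∑' k, modeSq α s b F k < ∞) :
    (∀ k, ∀ᵐ t, Summable fun κ : S k => quintic (fun n => v n t) κ / (D k κ : ℂ)) ∧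
    ∃ G : ℤ → ℝ → ℂ, (∀ k, TemperedPair (quinticSum (S k) (D k) v) (G k)) ∧
      ∑' k, modeSq α (s + a) (-b) G k ≤
        4 * C * fiveConst b * (∑' k, modeSq α s b F k) ^ 5 := by
  have happrox (k : ℤ) : SixApprox (v k) (fun τ => ‖F k τ‖ₑ) :=
    (hp k).sixApprox (hF k) (by linarith) hb' (wNorm_lt_top_of_tsum_modeSq_lt_top hM k)
  have hv (k : ℤ) := (happrox k).memLp
  have hsum := h.tsum_eLpNorm_lt_top hv (sobolevSq_eLpNorm_six_lt_top hp hF (by linarith) hb' hM)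
  have hmajorant := h.tsum_lintegral_quinticMajorant_sq_le hb hb'.le hF
  have hfin : 4 * C * fiveConst b * (∑' k, modeSq α s b F k) ^ 5 < ∞ :=
    ENNReal.mul_lt_top (ENNReal.mul_lt_top (ENNReal.mul_lt_top (by norm_num)
      ENNReal.coe_lt_top) (fiveConst_lt_top hb')) (ENNReal.pow_lt_top hM)
  choose G hG hGle using fun k => FracNLS.exists_temperedPair
    (integrable_quinticSum_mul hv (hsum k)) (measurable_quinticMajorant hF)
    (enorm_integral_quinticSum_mul_le hF happrox (hsum k))
    (ENNReal.lt_top_of_mul_ne_top_right (((ENNReal.le_tsum k).trans hmajorant).trans_lt hfin).ne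
      (ENNReal.ofReal_pos.2 (jb_rpow_pos _ _)).ne')
  exact ⟨fun k => ae_summable_quintic hv (hsum k), G, hG,
    (ENNReal.tsum_le_tsum fun k => mul_le_mul_right (hGle k) _).trans hmajorant⟩

end QuinticEstimate

section Rescale

open Filter
open scoped FourierTransform SchwartzMap

/-! ### From tempered pairs to the norm of `X^{s,b}` -/

/-- Rescaling of time under which the normalization `∫ f(t) e^{-iτt} dt` of the Fourier transform
becomes Mathlib's `∫ f(t) e^{-2πiτt} dt`. -/
def rescale (f : ℝ → ℂ) (x : ℝ) : ℂ := ((2 * Real.pi : ℝ) : ℂ) * f (2 * Real.pi * x)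

lemma exists_schwartz_comp_mul {r : ℝ} (hr : r ≠ 0) (φ : 𝓢(ℝ, ℂ)) :
    ∃ ψ : 𝓢(ℝ, ℂ), ∀ x, ψ x = φ (r * x) := by
  refine ⟨SchwartzMap.compCLMOfContinuousLinearEquiv ℂ
    (ContinuousLinearEquiv.unitsEquivAut ℝ (Units.mk0 r hr)) φ, fun x => ?_⟩
  simp [mul_comm]

lemma integral_mul_exp_eq_fourier (φ : 𝓢(ℝ, ℂ)) (x : ℝ) :
    ∫ τ : ℝ, φ τ * Complex.exp (-(Complex.I * (τ : ℂ) * ((2 * Real.pi * x : ℝ) : ℂ))) =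
      𝓕 φ x := by
  rw [SchwartzMap.fourier_coe, Real.fourier_eq']
  refine integral_congr_ae (Eventually.of_forall fun τ => ?_)
  simp only [smul_eq_mul, RCLike.inner_apply, conj_trivial]
  rw [mul_comm]
  congr 2
  push_cast
  ring

lemma integral_rescale_mul_fourier (f : ℝ → ℂ) (φ : 𝓢(ℝ, ℂ)) :
    ∫ x, rescale f x * 𝓕 φ x =
      ∫ t, f t * ∫ τ : ℝ, φ τ * Complex.exp (-(Complex.I * (τ : ℂ) * (t : ℂ))) := by
  have hchange := Measure.integral_comp_mul_left (fun t : ℝ => f t *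
    ∫ τ : ℝ, φ τ * Complex.exp (-(Complex.I * (τ : ℂ) * (t : ℂ)))) (2 * Real.pi)
  simp only [integral_mul_exp_eq_fourier] at hchange
  simp only [rescale, mul_assoc ((2 * Real.pi : ℝ) : ℂ)]
  rw [integral_const_mul, hchange, abs_of_pos (inv_pos.2 Real.two_pi_pos), Complex.real_smul,
    ← mul_assoc, ← Complex.ofReal_mul, mul_inv_cancel₀ Real.two_pi_pos.ne', Complex.ofReal_one,
    one_mul]

lemma integrable_rescale_iff {f : ℝ → ℂ} : Integrable (rescale f) ↔ Integrable f := by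
  have hpi : ((2 * Real.pi : ℝ) : ℂ) ≠ 0 := Complex.ofReal_ne_zero.2 Real.two_pi_pos.ne'
  unfold rescale
  rw [integrable_const_mul_iff hpi.isUnit, integrable_comp_mul_left_iff _ Real.two_pi_pos.ne']

lemma forall_integrable_rescale_mul_iff {f : ℝ → ℂ} :
    (∀ φ : 𝓢(ℝ, ℂ), Integrable fun x => rescale f x * φ x) ↔
      ∀ φ : 𝓢(ℝ, ℂ), Integrable fun t => f t * φ t := by
  have hpi := Real.two_pi_pos.ne'
  refine ⟨fun h φ => ?_, fun h φ => ?_⟩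
  · obtain ⟨ψ, hψ⟩ := exists_schwartz_comp_mul hpi φ
    rw [← integrable_rescale_iff]
    refine (h ψ).congr (Eventually.of_forall fun x => ?_)
    simp only [rescale, hψ, mul_assoc]
  · obtain ⟨ψ, hψ⟩ := exists_schwartz_comp_mul (inv_ne_zero hpi) φ
    refine (integrable_rescale_iff.2 (h ψ)).congr (Eventually.of_forall fun x => ?_)
    simp only [rescale, hψ, inv_mul_cancel_left₀ hpi,
      mul_assoc ((2 * Real.pi : ℝ) : ℂ)]

lemma isTimeFourier_iff_temperedPair_rescale {f F : ℝ → ℂ} :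
    IsTimeFourier f F ↔ TemperedPair (rescale f) F := by
  simp only [IsTimeFourier, ← integral_rescale_mul_fourier,
    ← forall_integrable_rescale_mul_iff (f := f)]
  exact ⟨fun h => ⟨h.1, h.2.1, h.2.2⟩, fun h =>
    ⟨h.integrable_left, h.integrable_right, h.integral_eq⟩⟩

lemma TemperedPair.const_mul {v F : ℝ → ℂ} (h : TemperedPair v F) (c : ℂ) :
    TemperedPair (fun t => c * v t) (fun τ => c * F τ) where
  integrable_left φ := by simpa only [mul_assoc] using (h.integrable_left φ).const_mul c
  integrable_right φ := by simpa only [mul_assoc] using (h.integrable_right φ).const_mul c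
  integral_eq φ := by
    simp only [mul_assoc]
    rw [integral_const_mul, integral_const_mul, h.integral_eq]

lemma quintic_mul_left (r : ℝ) (a : ℤ → ℂ) (κ : Fin 5 → ℤ) :
    quintic (fun n => (r : ℂ) * a n) κ = (r : ℂ) ^ 5 * quintic a κ := by
  simp only [quintic, star_mul', Complex.star_def, Complex.conj_ofReal]
  ring

lemma quintic_rescale (f : ℤ → ℝ → ℂ) (x : ℝ) (κ : Fin 5 → ℤ) :
    quintic (fun n => rescale (f n) x) κ =
      ((2 * Real.pi : ℝ) : ℂ) ^ 5 * quintic (fun n => f n (2 * Real.pi * x)) κ :=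
  quintic_mul_left _ _ _

lemma rescale_mul_quinticSum (z : ℂ) (S : Set (Fin 5 → ℤ)) (D : (Fin 5 → ℤ) → ℝ)
    (f : ℤ → ℝ → ℂ) :
    rescale (fun t => z * quinticSum S D f t) = fun x =>
      (z * (((2 * Real.pi : ℝ) : ℂ) ^ 4)⁻¹) * quinticSum S D (fun n => rescale (f n)) x := by
  have hpi : ((2 * Real.pi : ℝ) : ℂ) ≠ 0 := Complex.ofReal_ne_zero.2 Real.two_pi_pos.ne'
  funext x
  simp only [quinticSum, quintic_rescale, mul_div_assoc, tsum_mul_left]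
  simp only [rescale]
  field_simp

lemma ae_forall_summable_of_rescale {S : ℤ → Set (Fin 5 → ℤ)} {D : ℤ → (Fin 5 → ℤ) → ℝ}
    {f : ℤ → ℝ → ℂ} (h : ∀ k, ∀ᵐ x, Summable fun κ : S k =>
      quintic (fun n => rescale (f n) x) κ / (D k κ : ℂ)) :
    ∀ᵐ t, ∀ k, Summable fun κ : S k => quintic (fun n => f n t) κ / (D k κ : ℂ) := by
  have hpi := Real.two_pi_pos.ne'
  have hpi5 : ((2 * Real.pi : ℝ) : ℂ) ^ 5 ≠ 0 := pow_ne_zero _ (Complex.ofReal_ne_zero.2 hpi)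
  filter_upwards [(Measure.quasiMeasurePreserving_smul (volume : Measure ℝ)
    (inv_ne_zero hpi)).ae (ae_all_iff.2 h)] with t ht k
  simpa only [smul_eq_mul, quintic_rescale, mul_inv_cancel_left₀ hpi, mul_div_assoc,
    summable_mul_left_iff hpi5] using ht k

lemma norm_mul_inv_two_pi_pow_four_le_one {z : ℂ} (hz : ‖z‖ ≤ 2) :
    ‖z * (((2 * Real.pi : ℝ) : ℂ) ^ 4)⁻¹‖ ≤ 1 := by
  have htwo : 2 ≤ 2 * Real.pi := by linarith [Real.pi_gt_three]
  have hpow : 2 ≤ (2 * Real.pi) ^ 4 := htwo.trans (le_self_pow₀ (by linarith) (by norm_num))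
  rw [norm_mul, norm_inv, norm_pow, Complex.norm_of_nonneg Real.two_pi_pos.le, ← div_eq_mul_inv,
    div_le_one (by positivity)]
  exact hz.trans hpow

end Rescale

section XNorm

variable {α s a b : ℝ}

lemma weightedL2_eq (α s b : ℝ) (F : ℤ → ℝ → ℂ) :
    weightedL2 α s b F = (∑' k, modeSq α s b F k) ^ (1 / 2 : ℝ) := by
  unfold weightedL2
  congr 1
  refine tsum_congr fun k => ?_
  rw [modeSq, wNorm, ← lintegral_const_mul' _ _ ENNReal.ofReal_ne_top]
  refine lintegral_congr fun τ => ?_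
  rw [ENNReal.ofReal_mul (jb_rpow_pos _ _).le, mul_comm 2 s, Real.rpow_mul (jb_pos _).le,
    Real.rpow_two, ENNReal.ofReal_pow (jb_rpow_pos _ _).le]
  ring

lemma modeSq_congr_ae {F G : ℤ → ℝ → ℂ} {k : ℤ} (h : F k =ᵐ[volume] G k) :
    modeSq α s b F k = modeSq α s b G k := by
  unfold modeSq wNorm
  congr 1
  refine lintegral_congr_ae ?_
  filter_upwards [h] with τ hτ
  rw [hτ]

lemma modeSq_const_mul_le {c : ℂ} (hc : ‖c‖ ≤ 1) (F : ℤ → ℝ → ℂ) (k : ℤ) :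
    modeSq α s b (fun k τ => c * F k τ) k ≤ modeSq α s b F k := by
  refine mul_le_mul_right (wNorm_mono fun τ => ?_) _
  rw [enorm_mul]
  refine mul_le_of_le_one_left' ?_
  rw [← ofReal_norm]
  exact ENNReal.ofReal_le_one.2 hc

lemma exists_measurable_temperedPair {v F : ℤ → ℝ → ℂ} (hp : ∀ k, TemperedPair (v k) (F k)) :
    ∃ F' : ℤ → ℝ → ℂ, (∀ k, Measurable (F' k)) ∧ (∀ k, TemperedPair (v k) (F' k)) ∧
      ∀ α s b k, modeSq α s b F' k = modeSq α s b F k :=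
  ⟨fun k => (hp k).aestronglyMeasurable_right.mk,
    fun k => (hp k).aestronglyMeasurable_right.stronglyMeasurable_mk.measurable,
    fun k => (hp k).congr_right (hp k).aestronglyMeasurable_right.ae_eq_mk,
    fun _ _ _ k => modeSq_congr_ae (hp k).aestronglyMeasurable_right.ae_eq_mk.symm⟩

variable {S : ℤ → Set (Fin 5 → ℤ)} {D : ℤ → (Fin 5 → ℤ) → ℝ} {C : ℝ≥0}

theorem AdmissibleFamily.summable_and_xNorm_le (h : AdmissibleFamily α s a b S D C)
    (hb : 4 / 9 ≤ b) (hb' : b < 1 / 2) {f F : ℤ → ℝ → ℂ} (hf : ∀ k, IsTimeFourier (f k) (F k))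
    (hF : weightedL2 α s b F < ∞) :
    (∀ᵐ t, ∀ k, Summable fun κ : S k => quintic (fun n => f n t) κ / (D k κ : ℂ)) ∧
    ∀ z : ℂ, ‖z‖ ≤ 2 →
      xNorm α (s + a) (-b) (fun k t => z * quinticSum (S k) (D k) f t) ≤
        (4 * C * fiveConst b) ^ (1 / 2 : ℝ) * weightedL2 α s b F ^ 5 := by
  obtain ⟨F', hFm, hpair, hmode⟩ := exists_measurable_temperedPair fun k =>
    isTimeFourier_iff_temperedPair_rescale.1 (hf k)
  have hF' : weightedL2 α s b F = (∑' k, modeSq α s b F' k) ^ (1 / 2 : ℝ) := by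
    simp only [weightedL2_eq, hmode]
  obtain ⟨hsum, G, hG, hGle⟩ := h.exists_temperedPair hb hb' hpair hFm
    ((ENNReal.rpow_lt_top_iff_of_pos (by norm_num)).1 (hF' ▸ hF))
  refine ⟨ae_forall_summable_of_rescale hsum, fun z hz => ?_⟩
  set c : ℂ := z * (((2 * Real.pi : ℝ) : ℂ) ^ 4)⁻¹
  have hfourier (k : ℤ) :
      IsTimeFourier (fun t => z * quinticSum (S k) (D k) f t) (fun τ => c * G k τ) := by
    rw [isTimeFourier_iff_temperedPair_rescale, rescale_mul_quinticSum]
    exact (hG k).const_mul c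
  calc xNorm α (s + a) (-b) (fun k t => z * quinticSum (S k) (D k) f t)
      ≤ weightedL2 α (s + a) (-b) fun k τ => c * G k τ := iInf₂_le _ hfourier
    _ ≤ (4 * C * fiveConst b * (∑' k, modeSq α s b F' k) ^ 5) ^ (1 / 2 : ℝ) := by
        rw [weightedL2_eq]
        refine ENNReal.rpow_le_rpow ((ENNReal.tsum_le_tsum fun k => ?_).trans hGle) (by norm_num)
        exact modeSq_const_mul_le (norm_mul_inv_two_pi_pow_four_le_one hz) G k
    _ = (4 * C * fiveConst b) ^ (1 / 2 : ℝ) * weightedL2 α s b F ^ 5 := by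
        rw [hF', ENNReal.mul_rpow_of_nonneg _ _ (by norm_num), ← ENNReal.rpow_natCast,
          ← ENNReal.rpow_natCast, ← ENNReal.rpow_mul, ← ENNReal.rpow_mul, mul_comm (1 / 2 : ℝ)]

lemma xNorm_le_mul_pow_of_forall {s' b' : ℝ} {N f : ℤ → ℝ → ℂ} {K : ℝ≥0∞} (hK : K ≠ 0)
    (hK' : K ≠ ∞)
    (h : ∀ F : ℤ → ℝ → ℂ, (∀ k, IsTimeFourier (f k) (F k)) → weightedL2 α s b F < ∞ →
      xNorm α s' b' N ≤ K * weightedL2 α s b F ^ 5) :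
    xNorm α s' b' N ≤ K * xNorm α s b f ^ 5 := by
  have hroot {X : ℝ≥0∞} :
      (K⁻¹ * xNorm α s' b' N) ^ (5⁻¹ : ℝ) ≤ X ↔ xNorm α s' b' N ≤ K * X ^ 5 := by
    rw [ENNReal.rpow_inv_le_iff (by norm_num), ENNReal.rpow_ofNat,
      ENNReal.inv_mul_le_iff hK hK']
  refine hroot.1 (le_iInf₂ fun F hF => ?_)
  rcases eq_or_ne (weightedL2 α s b F) ∞ with htop | htop
  · exact htop ▸ le_top
  · exact hroot.2 (h F hF htop.lt_top)

theorem exists_forall_admissibleFamily_xNorm_le (hb : 4 / 9 ≤ b) (hb' : b < 1 / 2) (C : ℝ≥0) :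
    ∃ K : ℝ≥0, ∀ {S : ℤ → Set (Fin 5 → ℤ)} {D : ℤ → (Fin 5 → ℤ) → ℝ},
      AdmissibleFamily α s a b S D C → ∀ {f : ℤ → ℝ → ℂ}, xNorm α s b f < ∞ →
        (∀ᵐ t, ∀ k, Summable fun κ : S k => quintic (fun n => f n t) κ / (D k κ : ℂ)) ∧
        ∀ z : ℂ, ‖z‖ ≤ 2 →
          xNorm α (s + a) (-b) (fun k t => z * quinticSum (S k) (D k) f t) ≤
            K * xNorm α s b f ^ 5 := by
  set K : ℝ≥0∞ := (4 * C * fiveConst b) ^ (1 / 2 : ℝ)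
  have hK : K + 1 ≠ ∞ := ENNReal.add_ne_top.2 ⟨ENNReal.rpow_ne_top_of_nonneg (by norm_num)
    (ENNReal.mul_lt_top (ENNReal.mul_lt_top (by norm_num) ENNReal.coe_lt_top)
      (fiveConst_lt_top hb')).ne, ENNReal.one_ne_top⟩
  refine ⟨(K + 1).toNNReal, fun {S D} h {f} hf => ?_⟩
  rw [ENNReal.coe_toNNReal hK]
  refine ⟨?_, fun z hz => xNorm_le_mul_pow_of_forall (by simp) hK fun F hF hF' => ?_⟩
  · simp only [xNorm, iInf_lt_iff] at hf
    obtain ⟨F, hF, hF'⟩ := hf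
    exact (h.summable_and_xNorm_le hb hb' hF hF').1
  · exact ((h.summable_and_xNorm_le hb hb' hF hF').2 z hz).trans
      (mul_le_mul_left le_self_add _)

end XNorm

section Resonances

variable {α c s a b : ℝ}

theorem exists_admissibleFamily (hα : 1 / 2 < α) (hα' : α ≤ 1) (hc : 0 < c)
    (hs : 3 / 4 - α / 2 < s) (hs' : s ≤ 1 / 2) (ha : a ≤ 2 * α - 1) (ha' : a < 2 * s + α - 1) :
    ∃ b₀ : ℝ, 4 / 9 ≤ b₀ ∧ b₀ < 1 / 2 ∧ ∀ b : ℝ, b₀ < b → b < 1 / 2 → ∃ C : ℝ≥0,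
      AdmissibleFamily α s a b (freq1 α c) (den1 α) C ∧
      AdmissibleFamily α s a b (freq2 α c) (den2 α) C := by
  set η := (4 * s - 3 + 2 * α) / 2 with hη
  have hη0 : 0 < η := by linarith
  have hmin : 0 < min (1 / 36 : ℝ) (η / 144) := lt_min (by norm_num) (by positivity)
  have := min_le_left (1 / 36 : ℝ) (η / 144)
  have hmin144 := min_le_right (1 / 36 : ℝ) (η / 144)
  refine ⟨1 / 2 - min (1 / 36) (η / 144), by linarith, by linarith, fun b hb hb' => ?_⟩
  obtain ⟨C₁, hC₁⟩ := exists_tsum_innerTerm_le (α := α) (s := s) (η := η)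
    (ε := 9 * (1 - 2 * b)) hα hα' hs' (by linarith) (by linarith) (by linarith) (by linarith)
  obtain ⟨C₂, hC₂⟩ :=
    exists_tsum_admissibleOuterTerm_le hα hα' hc (by linarith) hs' ha ha'
  refine ⟨C₁ * C₂, ⟨fun k κ hκ => hκ.1, fun k => ?_, fun d hd k => ?_⟩,
    ⟨fun k κ hκ => hκ.1, fun k => ?_, fun d hd k => ?_⟩⟩
  · exact_mod_cast tsum_weightTerm_freq1_le hC₁ k (hC₂ k)
  · exact tsum_freq1_lt_top hα hα' hc (by linarith) (by linarith) hd k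
  · exact_mod_cast tsum_weightTerm_freq2_le hC₁ k (hC₂ k)
  · exact tsum_freq2_lt_top hα hα' hc (by linarith) (by linarith) hd k

end Resonances

end FracNLS

end

open FracNLS

theorem mainTheorem6 (α c s a : ℝ) (hα : 1 / 2 < α) (hα' : α ≤ 1) (hc : 0 < c)
    (hs : 3 / 4 - α / 2 < s) (hs' : s ≤ 1 / 2)
    (ha : a ≤ min (2 * α - 1) (2 * s + α - 1))
    (ha' : min (2 * α - 1) (2 * s + α - 1) = 2 * s + α - 1 → a < 2 * s + α - 1) :
    ∃ b₀ : ℝ, b₀ < 1 / 2 ∧ ∀ b : ℝ, b₀ < b → b < 1 / 2 →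
      ∃ C : ℝ≥0, ∀ u : ℝ → FracNLS.Torus → ℂ, FracNLS.MemX α s b u →
        (∀ᵐ t : ℝ, ∀ k : ℤ,
          Summable (fun κ : FracNLS.freq1 α c k =>
            FracNLS.nr1Term α (fun n => FracNLS.modes u n t) k κ) ∧
          Summable (fun κ : FracNLS.freq2 α c k =>
            FracNLS.nr2Term α (fun n => FracNLS.modes u n t) k κ)) ∧
        FracNLS.xNorm α (s + a) (-b) (FracNLS.NR1 α c u) ≤
          C * FracNLS.xNorm α s b (FracNLS.modes u) ^ 5 ∧
        FracNLS.xNorm α (s + a) (-b) (FracNLS.NR2 α c u) ≤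
          C * FracNLS.xNorm α s b (FracNLS.modes u) ^ 5 := by
  have ha1 : a ≤ 2 * α - 1 := ha.trans (min_le_left _ _)
  have ha2 : a < 2 * s + α - 1 := (ha.trans (min_le_right _ _)).lt_of_ne fun h =>
    (ha' (le_antisymm (min_le_right _ _) (h ▸ ha))).ne h
  obtain ⟨b₀, hb₀, hb₀', hadm⟩ := exists_admissibleFamily hα hα' hc hs hs' ha1 ha2
  refine ⟨b₀, hb₀', fun b hb hb' => ?_⟩
  obtain ⟨C, hadm₁, hadm₂⟩ := hadm b hb hb'
  obtain ⟨K, hK⟩ := exists_forall_admissibleFamily_xNorm_le (hb₀.trans hb.le) hb' C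
  refine ⟨K, fun u hu => ?_⟩
  obtain ⟨hsum₁, hle₁⟩ := hK hadm₁ hu.2
  obtain ⟨hsum₂, hle₂⟩ := hK hadm₂ hu.2
  have hNR2 : NR2 α c u = fun k t =>
      -1 * quinticSum (freq2 α c k) (den2 α k) (modes u) t := by
    funext k t
    rw [neg_one_mul]
    rfl
  refine ⟨?_, hle₁ 2 (by simp), hNR2 ▸ hle₂ (-1) (by simp)⟩
  filter_upwards [hsum₁, hsum₂] with t ht₁ ht₂ k
  exact ⟨ht₁ k, ht₂ k⟩
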